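/- **Setting.** Let $p>1$, $c\in(0,1]$, let $X$ be a nonempty convex compact subset of a finite-dimensional normed space with $\|x_1-x_2\|\le D_X$ on $X$, let $\xi$ be a random variable and let $F(\cdot,\xi)$ be continuous and convex. Put $f(x)=\mathbb E[F(x,\xi)]$ and $$h(x)=f(x)+c\,\mathbb E^{1/p}\big[(F(x,\xi)-f(x))_+^p\big],$$ let $x^*$ minimize $h$ over $X$, and let $z^*=p^{\frac1{p-1}}\mathbb E^{1/p}[(F(x^*,\xi)-f(x^*))_+^p]$. An oracle returns, for independent samples $\xi$, the value $F(x,\xi)$ and a subgradient $F'(x,\xi)$ of $F(\cdot,\xi)$ at $x$. Write $f'(x)=\mathbb E[F'(x,\xi)]$. Assume that $f$ is $L_f$-Lipschitz on $X$ with $\|f'(x)\|_\star\le L_f$, and that $\mathbb E\|F'(x,\xi)-f'(x)\|_\star^2\le\sigma_f^2$ and $\mathbb E(F(x,\xi)-f(x))^2\le\beta^2$ on $X$. Let $\delta>0$, $x_0\in X$, $R=L_fD_X+\delta$, let $y_0$ be an estimate of $f(x_0)$ such that $f(x)\in Y:=[y_0-R,y_0+R]$ for all $x\in X$, and let $U=X\times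 Y\times[0,1]$. Let $V$ be the sum of the Bregman divergences of differentiable, $1$-strongly convex distance generating functions on $X$, $Y$, $[0,1]$ whose gradients are $L_v$-Lipschitz. **Assumptions.** For all $x\in X$: (4) $\mathbb E[(F(x,\xi)-f(x))_+^{2p}]\le M_f^{2p}$, with $M_f\ge 0$; (5) $\mathbb E\|G'(x,\xi)\|_\star^2\le L_G^2$, with $L_G>0$, where $G'(x,\xi)=p\,(F(x,\xi)-f(x))_+^{p-1}(F'(x,\xi)-f'(x))$ is the subgradient of $G(x,\xi)=(F(x,\xi)-f(x))_+^p$. **Method.** Let $$\mathcal L(x,y,z,\lambda,\xi)=\tfrac{c}{z^{p-1}}(F(x,\xi)-y)_+^p+y+c(p-1)p^{-\frac p{p-1}}z+\lambda(F(x,\xi)-y),$$ with stochastic subgradients $\mathcal L'_x=\big(\tfrac{cp}{z^{p-1}}(F-y)_+^{p-1}+\lambda\big)F'$, $\mathcal L'_y=-\tfrac{cp}{z^{p-1}}(F-y)_+^{p-1}+1-\lambda$, $\mathcal L'_z=-\tfrac{c(p-1)}{z^p}(F-y)_+^p+c(p-1)p^{-\frac p{p-1}}$, $\mathcal L'_\lambda=F-y$.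 *Inner method at $z>0$* (stochastic mirror descent, $T$ steps): start at $u_0=(x_0,y_0,0)$, iterate $u_{t+1}=\arg\min_{u\in U}\gamma_t\langle(\mathcal L'_x,\mathcal L'_y,-\mathcal L'_\lambda)(u_t,z,\xi_t),u\rangle+V(u_t,u)$, and output the $\gamma$-weighted averages $\bar u=(\bar x,\bar y,\bar\lambda)$ of $u_0,\dots,u_{T-1}$ and $\zeta$ of $\mathcal L'_z(u_t,z,\xi'_t)$, with fresh independent samples $\xi_t,\xi_t'$ (so $2T$ samples). *Outer method* (probabilistic bisection): start with $a=0$, $b=z_0>0$. Phase 1: run the inner method at $z_k=b$; if $\zeta_k<0$ replace $b$ by $2b$ and repeat, otherwise go to phase 2. Phase 2: run the inner method at $z_k=(a+b)/2$; if $\zeta_k<0$ set $a=z_k$, otherwise set $b=z_k$; stop if $b\le\theta$, else repeat. **Constants.** Let $D_V^2=\frac{L_v}2[D_X^2+4R^2+1]$, $m=\max\{2^{p-2},1\}$, $$M_z^2=\tfrac{3c^2m^2}{z^{2p-2}}\Big\{L_G^2+p^2(L_f^2+1)M_f^{2p-2}+p^2\big[2^{2p}(L_f^2+\sigma_f^2)+2^{2p-2}\big]R^{2p-2}\Big\}+12(L_f^2+\sigma_f^2)+8R^2+2\beta^2+3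 .$$ For $\epsilon>0$ and $\alpha\in(0,1)$ let $w=\max\{z^*,z_0/2\}$ (so $w=z^*$ when $z_0\le 2z^*$) and, with $\log_2$ terms at argument $0$ omitted from the maxima, $$K=\max\Big\{1,\Big\lceil\log_2\tfrac{2z^*}{z_0}\Big\rceil\Big\}+\max\Big\{1,\Big\lceil\log_2\Big(\tfrac{8cw}{\epsilon}p^{-\frac1{p-1}}\Big)\Big\rceil,\Big\lceil\log_2\Big(\tfrac{c^{p+1}w}{\epsilon^{p+1}}(p-1)p^{-\frac p{p-1}}2^{3p+1}[M_f^p+2^pR^p]+\tfrac{4cw}{\epsilon}(p-1)p^{-\frac p{p-1}}\Big)\Big\rceil\Big\},$$ $$\tilde C_{K,\alpha}=\max\Big\{\tfrac{16K^2}{\alpha^2},\tfrac{32K\max\{1,4p^{2/(p-1)}M_f^2/z_0^2\}(p-1)^22^{2p-2}[5M_f^{2p}+2^{2p}R^{2p}]}{81\,\alpha\, m^2D_V^2L_G^2}\Big\},\qquad \theta=\frac{p^{\frac1{p-1}}\epsilon}{2c},$$ $$T_k=\Big\lceil\tfrac{81\tilde C_{K,\alpha}M_{z_k}^2D_V^2}{\epsilon^2}\Big\rceil,\quad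 \gamma_{kt}=\tfrac{D_V}{M_{z_k}\sqrt{T_k}},\quad \tilde T=\Big\lceil\tfrac{81\tilde C_{K,\alpha}M_{\hat z}^2D_V^2}{\epsilon^2}\Big\rceil,\quad \hat z=\min\Big\{z_0,\max\Big\{\tfrac{z^*}2,\tfrac{p^{1/(p-1)}\epsilon}{4c}\Big\}\Big\}.$$ **Theorem.** For every $\epsilon>0$ and $\alpha\in(0,1)$, run the probabilistic bisection method with these $\theta,T_k,\gamma_{kt}$. With probability at least $1-\alpha$, one of its first $K$ outer iterations is carried out and yields a point $\bar x_k\in X$ that is $\epsilon$-optimal, both in the sense $h(\bar x_k)-h(x^*)\le\epsilon$ and in the sense $\mathbb E[h(\bar x_k)\mid z_k]-h(x^*)\le\epsilon$ (expectation over the samples of iteration $k$), and at most $2K\tilde T$ samples have been drawn up to and including that iteration. Moreover $0\le z^*\le p^{1/(p-1)}M_f$, and $2K\tilde T=\tilde O\big(1/(\max\{z^*,\epsilon\}^{2p-2}\epsilon^2)\big)$: with the other parameters fixed there is a constant $C>0$ such that, for all $\epsilon\in(0,\tfrac12]$ and all values $z^*\in[0,p^{1/(p-1)}M_f]$, $$2K\tilde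 T\le \frac{C\,\log^3(1/\epsilon)}{\max\{z^*,\epsilon\}^{2p-2}\,\epsilon^2}.$$ -/

import Mathlib

open MeasureTheory ProbabilityTheory

noncomputable section

namespace LpRisk

/-- The numerical constants: order `p`, weight `c`, Lipschitz constant `Lf` of the mean cost,
standard deviation bounds `σf` (oracle subgradients) and `β` (oracle values), semimoment bound `Mf`,
semideviation Lipschitz bound `LG`, smoothness `Lv` of the distance generating functions,
diameter bound `DX`, estimation error `δ` and first trial value `z0` of the bisection. -/
structure Params where
  p : ℝ
  c : ℝ
  Lf : ℝ
  σf : ℝ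
  β : ℝ
  Mf : ℝ
  LG : ℝ
  Lv : ℝ
  DX : ℝ
  δ : ℝ
  z0 : ℝ

namespace Params

/-- Half-width `L_f D_X + δ` of the feasible interval for `y`. -/
def R (q : Params) : ℝ := q.Lf * q.DX + q.δ

/-- `D_V²`. -/
def DVsq (q : Params) : ℝ := q.Lv / 2 * (q.DX ^ 2 + 4 * q.R ^ 2 + 1)

/-- `max {2^(p-2), 1}`. -/
def m (q : Params) : ℝ := max ((2 : ℝ) ^ (q.p - 2)) 1

/-- `M_z²`. -/
def Msq (q : Params) (z : ℝ) : ℝ :=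
  3 * q.c ^ 2 / z ^ (2 * q.p - 2) * q.m ^ 2 *
      (q.LG ^ 2 + q.p ^ 2 * (q.Lf ^ 2 + 1) * q.Mf ^ (2 * q.p - 2)
        + q.p ^ 2 * ((2 : ℝ) ^ (2 * q.p) * (q.Lf ^ 2 + q.σf ^ 2) + (2 : ℝ) ^ (2 * q.p - 2))
          * q.R ^ (2 * q.p - 2))
    + 12 * (q.Lf ^ 2 + q.σf ^ 2) + 8 * q.R ^ 2 + 2 * q.β ^ 2 + 3

/-- The termination threshold `θ`. -/
def θ (q : Params) (ε : ℝ) : ℝ := q.p ^ (1 / (q.p - 1)) * ε / (2 * q.c)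

/-- The bound `K` on the number of outer iterations, as a function of the optimal value `zs` of the
lifting variable. The first summand counts the doublings, the second one the bisections of an
initial interval of length at most `2 * w`. -/
def K (q : Params) (zs ε : ℝ) : ℕ :=
  let w : ℝ := max zs (q.z0 / 2)
  max 1 ⌈Real.logb 2 (2 * zs / q.z0)⌉₊ +
    max 1 (max
      ⌈Real.logb 2 (8 * q.c * w / ε * q.p ^ (-1 / (q.p - 1)))⌉₊
      ⌈Real.logb 2
        (q.c ^ (q.p + 1) * w / ε ^ (q.p + 1) * (q.p - 1) * q.p ^ (-q.p / (q.p - 1))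
            * (2 : ℝ) ^ (3 * q.p + 1) * (q.Mf ^ q.p + (2 : ℝ) ^ q.p * q.R ^ q.p)
          + 4 * q.c * w / ε * (q.p - 1) * q.p ^ (-q.p / (q.p - 1)))⌉₊)

/-- The constant `C̃_{K,α}`. -/
def Ctilde (q : Params) (K : ℕ) (α : ℝ) : ℝ :=
  max (16 * (K : ℝ) ^ 2 / α ^ 2)
    (32 * (K : ℝ) * max 1 (4 * q.p ^ (2 / (q.p - 1)) * q.Mf ^ 2 / q.z0 ^ 2)
        * (q.p - 1) ^ 2 * (2 : ℝ) ^ (2 * q.p - 2)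
        * (5 * q.Mf ^ (2 * q.p) + (2 : ℝ) ^ (2 * q.p) * q.R ^ (2 * q.p))
      / (81 * α * q.m ^ 2 * q.DVsq * q.LG ^ 2))

/-- Number of inner iterations at the value `z` (rounded up to an integer). -/
def T (q : Params) (zs ε α z : ℝ) : ℕ :=
  ⌈81 * q.Ctilde (q.K zs ε) α * q.Msq z * q.DVsq / ε ^ 2⌉₊

/-- The constant step size at the value `z`. -/
def γ (q : Params) (zs ε α z : ℝ) (_t : ℕ) : ℝ :=
  √q.DVsq / (√(q.Msq z) * √(q.T zs ε α z : ℝ))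

/-- `T̃` (rounded up to an integer). -/
def Ttilde (q : Params) (zs ε α : ℝ) : ℕ :=
  q.T zs ε α (min q.z0 (max (zs / 2) (q.p ^ (1 / (q.p - 1)) * ε / (4 * q.c))))

end Params

/-- A distance generating function on `S`: differentiable along `S` with `L`-Lipschitz gradient
(dual norm), and `1`-strongly convex. -/
structure DistGen {E : Type*} [NormedAddCommGroup E] [NormedSpace ℝ E] (S : Set E) (L : ℝ) where
  v : E → ℝ
  grad : E → StrongDual ℝ E
  hasFDerivWithinAt : ∀ x ∈ S, HasFDerivWithinAt v (grad x) S x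
  lipschitz : ∀ x ∈ S, ∀ w ∈ S, ‖grad x - grad w‖ ≤ L * ‖x - w‖
  strongConvex : ∀ x ∈ S, ∀ w ∈ S, v x + grad x (w - x) + 1 / 2 * ‖w - x‖ ^ 2 ≤ v w

/-- The Bregman divergence (prox-function) `V(x, w)`. -/
def DistGen.breg {E : Type*} [NormedAddCommGroup E] [NormedSpace ℝ E] {S : Set E} {L : ℝ}
    (d : DistGen S L) (x w : E) : ℝ := d.v w - d.v x - d.grad x (w - x)

open Classical in
/-- A minimizer of `φ` over `S` (the argument `d` if there is none). -/
def argminOn {A : Type*} (S : Set A) (φ : A → ℝ) (d : A) : A :=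
  if h : ∃ w ∈ S, IsMinOn φ S w then h.choose else d

/-- An instance: law `P` of the random data, feasible set `X`, random cost `F`, the oracle's
subgradients `F'`, the initial point `x0` and the estimate `y0` of the mean cost at `x0`. -/
structure Problem (E Ξ : Type*) [NormedAddCommGroup E] [NormedSpace ℝ E]
    [MeasurableSpace Ξ] extends Params where
  P : Measure Ξ
  X : Set E
  F : E → Ξ → ℝ
  F' : E → Ξ → StrongDual ℝ E
  x0 : E
  y0 : ℝ

namespace Problem

/-- Mean cost `f(x) = E[F(x,ξ)]`. -/
def f {E Ξ : Type*} [NormedAddCommGroup E] [NormedSpace ℝ E] [MeasurableSpace Ξ]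
    (Q : Problem E Ξ) (x : E) : ℝ := ∫ s, Q.F x s ∂Q.P

/-- `f'(x) = E[F'(x,ξ)]`. -/
def f' {E Ξ : Type*} [NormedAddCommGroup E] [NormedSpace ℝ E] [MeasurableSpace Ξ]
    (Q : Problem E Ξ) (x : E) : StrongDual ℝ E := ∫ s, Q.F' x s ∂Q.P

/-- The upper semideviation of order `p`. -/
def semidev {E Ξ : Type*} [NormedAddCommGroup E] [NormedSpace ℝ E] [MeasurableSpace Ξ]
    (Q : Problem E Ξ) (x : E) : ℝ :=
  (∫ s, (max (Q.F x s - Q.f x) 0) ^ Q.p ∂Q.P) ^ (1 / Q.p)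

/-- The `L_p` risk objective. -/
def h {E Ξ : Type*} [NormedAddCommGroup E] [NormedSpace ℝ E] [MeasurableSpace Ξ]
    (Q : Problem E Ξ) (x : E) : ℝ := Q.f x + Q.c * Q.semidev x

/-- The optimal lifting variable `z*` attached to a solution `x`. -/
def zstar {E Ξ : Type*} [NormedAddCommGroup E] [NormedSpace ℝ E] [MeasurableSpace Ξ]
    (Q : Problem E Ξ) (x : E) : ℝ := Q.p ^ (1 / (Q.p - 1)) * Q.semidev x

/-- The feasible interval for the variable `y`. -/
def Y {E Ξ : Type*} [NormedAddCommGroup E] [NormedSpace ℝ E] [MeasurableSpace Ξ]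
    (Q : Problem E Ξ) : Set ℝ := {y | |y - Q.y0| ≤ Q.R}

/-- `U = X × Y × [0,1]`. -/
def U {E Ξ : Type*} [NormedAddCommGroup E] [NormedSpace ℝ E] [MeasurableSpace Ξ]
    (Q : Problem E Ξ) : Set (E × ℝ × ℝ) := Q.X ×ˢ (Q.Y ×ˢ Set.Icc 0 1)

/-- `G'(x,ξ)` for `G(x,ξ) = (F(x,ξ) - f(x))_+^p`, by the chain rule. -/
def G' {E Ξ : Type*} [NormedAddCommGroup E] [NormedSpace ℝ E] [MeasurableSpace Ξ]
    (Q : Problem E Ξ) (x : E) (s : Ξ) : StrongDual ℝ E :=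
  (Q.p * (max (Q.F x s - Q.f x) 0) ^ (Q.p - 1)) • (Q.F' x s - Q.f' x)

/-- The standing assumptions on the problem and the oracle. -/
structure Standing {E Ξ : Type*} [NormedAddCommGroup E] [NormedSpace ℝ E] [MeasurableSpace E]
    [MeasurableSpace Ξ] (Q : Problem E Ξ) : Prop where
  one_lt_p : 1 < Q.p
  c_pos : 0 < Q.c
  c_le_one : Q.c ≤ 1
  Lf_nonneg : 0 ≤ Q.Lf
  σf_nonneg : 0 ≤ Q.σf
  β_nonneg : 0 ≤ Q.β
  δ_pos : 0 < Q.δ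
  z0_pos : 0 < Q.z0
  isProb : IsProbabilityMeasure Q.P
  convex_X : Convex ℝ Q.X
  compact_X : IsCompact Q.X
  diam_X : ∀ x ∈ Q.X, ∀ w ∈ Q.X, ‖x - w‖ ≤ Q.DX
  measurable_F : ∀ x, Measurable (Q.F x)
  continuous_F : ∀ s, Continuous fun x => Q.F x s
  convex_F : ∀ s, ConvexOn ℝ Set.univ fun x => Q.F x s
  measurable_F' : Measurable fun a : E × Ξ => Q.F' a.1 a.2
  /-- the oracle returns subgradients of the random cost -/
  subgrad_F' : ∀ x ∈ Q.X, ∀ s, ∀ w ∈ Q.X, Q.F x s + Q.F' x s (w - x) ≤ Q.F w s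
  memLp_F : ∀ x ∈ Q.X, MemLp (Q.F x) 2 Q.P
  variance_F : ∀ x ∈ Q.X, ∫ s, (Q.F x s - Q.f x) ^ 2 ∂Q.P ≤ Q.β ^ 2
  memLp_F' : ∀ x ∈ Q.X, MemLp (Q.F' x) 2 Q.P
  variance_F' : ∀ x ∈ Q.X, ∫ s, ‖Q.F' x s - Q.f' x‖ ^ 2 ∂Q.P ≤ Q.σf ^ 2
  /-- `f` is `L_f`-Lipschitz on `X`, for values and for subgradients -/
  lipschitz_f : ∀ x ∈ Q.X, ∀ w ∈ Q.X, |Q.f x - Q.f w| ≤ Q.Lf * ‖x - w‖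
  norm_f' : ∀ x ∈ Q.X, ‖Q.f' x‖ ≤ Q.Lf
  x0_mem : Q.x0 ∈ Q.X
  /-- the estimation of the mean cost at `x0` has been successful -/
  mean_mem_Y : ∀ x ∈ Q.X, Q.f x ∈ Q.Y

/-- `2p`-th semimoment bound. -/
structure SemimomentBound {E Ξ : Type*} [NormedAddCommGroup E] [NormedSpace ℝ E]
    [MeasurableSpace Ξ] (Q : Problem E Ξ) : Prop where
  Mf_nonneg : 0 ≤ Q.Mf
  integrable : ∀ x ∈ Q.X, Integrable (fun s => (max (Q.F x s - Q.f x) 0) ^ (2 * Q.p)) Q.P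
  bound : ∀ x ∈ Q.X, ∫ s, (max (Q.F x s - Q.f x) 0) ^ (2 * Q.p) ∂Q.P ≤ Q.Mf ^ (2 * Q.p)

/-- Lipschitz bound for the stochastic `p`-semideviation. -/
structure SemidevLipschitz {E Ξ : Type*} [NormedAddCommGroup E] [NormedSpace ℝ E]
    [MeasurableSpace Ξ] (Q : Problem E Ξ) : Prop where
  LG_pos : 0 < Q.LG
  integrable : ∀ x ∈ Q.X, Integrable (fun s => ‖Q.G' x s‖ ^ 2) Q.P
  bound : ∀ x ∈ Q.X, ∫ s, ‖Q.G' x s‖ ^ 2 ∂Q.P ≤ Q.LG ^ 2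

/-- Distance generating functions on the three factors of `U`; the prox-function on `U` is the sum
of the three Bregman divergences. -/
structure Prox {E Ξ : Type*} [NormedAddCommGroup E] [NormedSpace ℝ E] [MeasurableSpace Ξ]
    (Q : Problem E Ξ) where
  dX : DistGen Q.X Q.Lv
  dY : DistGen Q.Y Q.Lv
  dΛ : DistGen (Set.Icc (0 : ℝ) 1) Q.Lv

/-- The separable prox-function `V(u, w)` on `U`. -/
def Prox.V {E Ξ : Type*} [NormedAddCommGroup E] [NormedSpace ℝ E] [MeasurableSpace Ξ]
    {Q : Problem E Ξ} (D : Q.Prox) (u w : E × ℝ × ℝ) : ℝ :=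
  D.dX.breg u.1 w.1 + D.dY.breg u.2.1 w.2.1 + D.dΛ.breg u.2.2 w.2.2

/-- The factor `(cp / z^(p-1)) (F(x,ξ) - y)_+^(p-1)`. -/
def slope {E Ξ : Type*} [NormedAddCommGroup E] [NormedSpace ℝ E] [MeasurableSpace Ξ]
    (Q : Problem E Ξ) (z : ℝ) (u : E × ℝ × ℝ) (s : Ξ) : ℝ :=
  Q.c * Q.p / z ^ (Q.p - 1) * (max (Q.F u.1 s - u.2.1) 0) ^ (Q.p - 1)

/-- Stochastic subgradient of the lifted Lagrangian
`(c / z^(p-1)) (F(x,ξ) - y)_+^p + y + c (p-1) p^(-p/(p-1)) z + λ (F(x,ξ) - y)` in `x`. -/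
def gradX {E Ξ : Type*} [NormedAddCommGroup E] [NormedSpace ℝ E] [MeasurableSpace Ξ]
    (Q : Problem E Ξ) (z : ℝ) (u : E × ℝ × ℝ) (s : Ξ) : StrongDual ℝ E :=
  (Q.slope z u s + u.2.2) • Q.F' u.1 s

/-- Stochastic derivative of the lifted Lagrangian in `y`. -/
def gradY {E Ξ : Type*} [NormedAddCommGroup E] [NormedSpace ℝ E] [MeasurableSpace Ξ]
    (Q : Problem E Ξ) (z : ℝ) (u : E × ℝ × ℝ) (s : Ξ) : ℝ := -Q.slope z u s + 1 - u.2.2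

/-- Stochastic derivative of the lifted Lagrangian in `λ`. -/
def gradΛ {E Ξ : Type*} [NormedAddCommGroup E] [NormedSpace ℝ E] [MeasurableSpace Ξ]
    (Q : Problem E Ξ) (u : E × ℝ × ℝ) (s : Ξ) : ℝ := Q.F u.1 s - u.2.1

/-- Stochastic derivative of the lifted Lagrangian in `z`. -/
def gradZ {E Ξ : Type*} [NormedAddCommGroup E] [NormedSpace ℝ E] [MeasurableSpace Ξ]
    (Q : Problem E Ξ) (z : ℝ) (u : E × ℝ × ℝ) (s : Ξ) : ℝ :=
  -(Q.c * (Q.p - 1) / z ^ Q.p) * (max (Q.F u.1 s - u.2.1) 0) ^ Q.p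
    + Q.c * (Q.p - 1) * Q.p ^ (-Q.p / (Q.p - 1))

/-- The initial point `(x0, y0, 0)`. -/
def u0 {E Ξ : Type*} [NormedAddCommGroup E] [NormedSpace ℝ E] [MeasurableSpace Ξ]
    (Q : Problem E Ξ) : E × ℝ × ℝ := (Q.x0, Q.y0, 0)

/-- Iterates of stochastic mirror descent for the inner saddle point problem at the value `z`, with
step sizes `γ` and samples `ξ`: the next iterate is
`argmin_{w ∈ U} γ_t ⟨(L'_x, L'_y, -L'_λ), w⟩ + V(u_t, w)`. -/
def smd {E Ξ : Type*} [NormedAddCommGroup E] [NormedSpace ℝ E] [MeasurableSpace Ξ]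
    (Q : Problem E Ξ) (D : Q.Prox) (z : ℝ) (γ : ℕ → ℝ) (ξ : ℕ → Ξ) : ℕ → E × ℝ × ℝ
  | 0 => Q.u0
  | t + 1 =>
    let u := smd Q D z γ ξ t
    argminOn Q.U (fun w => γ t * (Q.gradX z u (ξ t) w.1 + Q.gradY z u (ξ t) * w.2.1
      - Q.gradΛ u (ξ t) * w.2.2) + D.V u w) u

/-- The `x`-part of the averaged output of stochastic mirror descent after `T` steps. -/
def smdX {E Ξ : Type*} [NormedAddCommGroup E] [NormedSpace ℝ E] [MeasurableSpace Ξ]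
    (Q : Problem E Ξ) (D : Q.Prox) (z : ℝ) (T : ℕ) (γ : ℕ → ℝ) (ξ : ℕ → Ξ) : E :=
  (∑ t ∈ Finset.range T, γ t)⁻¹ • ∑ t ∈ Finset.range T, γ t • (Q.smd D z γ ξ t).1

/-- The approximate derivative `ζ_T` in `z`, computed with the separate samples `ξ'`. -/
def smdζ {E Ξ : Type*} [NormedAddCommGroup E] [NormedSpace ℝ E] [MeasurableSpace Ξ]
    (Q : Problem E Ξ) (D : Q.Prox) (z : ℝ) (T : ℕ) (γ : ℕ → ℝ) (ξ ξ' : ℕ → Ξ) : ℝ :=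
  (∑ t ∈ Finset.range T, γ t)⁻¹ *
    ∑ t ∈ Finset.range T, γ t * Q.gradZ z (Q.smd D z γ ξ t) (ξ' t)

end Problem

/-- State of the probabilistic bisection: the interval `[a, b]`, whether the second (bisection)
phase has begun, and whether the method has terminated. -/
structure BisectState where
  a : ℝ
  b : ℝ
  phaseTwo : Bool
  stopped : Bool

/-- The value `z_k` examined in the current outer iteration. -/
def BisectState.query (st : BisectState) : ℝ := if st.phaseTwo then (st.a + st.b) / 2 else st.b

open Classical in
/-- One outer iteration, given the approximate derivative `ζ` at the examined value. -/
def BisectState.next (θ : ℝ) (st : BisectState) (ζ : ℝ) : BisectState :=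
  if st.stopped then st
  else if st.phaseTwo then
    let a' := if ζ < 0 then st.query else st.a
    let b' := if ζ < 0 then st.b else st.query
    ⟨a', b', true, decide (b' ≤ θ)⟩
  else if ζ < 0 then ⟨st.a, 2 * st.b, false, false⟩
  else ⟨st.a, st.b, true, false⟩

/-- State of the probabilistic bisection method before its `k`-th outer iteration. At the examined
value `z` the inner method runs for `T z` steps with step sizes `γ z`; the `t`-th inner step of outer
iteration `k` uses the samples `σ (k, t, false)` (mirror descent) and `σ (k, t, true)` (for `ζ`). -/
def Problem.bisection {E Ξ : Type*} [NormedAddCommGroup E] [NormedSpace ℝ E] [MeasurableSpace Ξ]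
    (Q : Problem E Ξ) (D : Q.Prox) (θ : ℝ) (T : ℝ → ℕ) (γ : ℝ → ℕ → ℝ)
    (σ : ℕ × ℕ × Bool → Ξ) : ℕ → BisectState
  | 0 => ⟨0, Q.z0, false, false⟩
  | k + 1 =>
    let st := Problem.bisection Q D θ T γ σ k
    st.next θ (Q.smdζ D st.query (T st.query) (γ st.query)
      (fun t => σ (k, t, false)) (fun t => σ (k, t, true)))

end LpRisk

end

/-! For c > 0, Young's inequality writes c a^(1/p) as the minimum over z of c a / z^(p-1) + κ z.
This turns the risk into the value of a Lagrangian in (x, y, z, λ) which is convex in (x, y, z) and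
affine in λ: at (x, f(x), z*) it equals h(x) for every λ (`lag_zstar`), while at any (x, y, z) with
z > 0 its value at λ = 0 or at λ = 1 is at least h(x) (`h_le_lag`).

Mirror descent at a fixed z controls the gap in (x, y, λ). Since the subgradient inequality also
holds in z (`lagS_subgradient`), a run at z compares with the optimum at z*: for every λ in [0,1],
the Lagrangian at the averaged output is at most h(x*) + err + ζ'(z - z*), where ζ' is the averaged
expected z-derivative (`lag_smd_le_opt`). So a run with err < ε/4 either is successful, or has ζ'(z
- z*) > ε/2. In the second case ζ' has the sign of z - z*, and so has its estimate ζ, as long as |ζ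
- ζ'| times a bound for |z - z*| is at most ε/4. Unsuccessful iterations therefore never discard z*
(`sign_of_not_good`, `inv_succ`) and never trigger termination, because ζ' ≤ κ rules out ζ'(z - z*)
> ε/2 for z ≤ θ. The interval halves, ζ' is bounded on both sides, and after K iterations |z - z*|
is too small for ζ'(z - z*) > ε/2 (`exists_good`). Until success every examined value is at least ẑ,
which bounds the number of samples.

Both noise conditions hold at a fixed z with probability at least 1 - α/K, by second moments of
martingale sums (`sum_centered_fresh_samples`) and Markov's inequality (`isNoisy_small`). The state
before iteration k takes finitely many values and is independent of the samples of iteration k, so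
the bound survives at the random z_k, and a union bound gives 1 - α (`exists_bad_le`). For
optimality in expectation, the output of the successful run is itself a point of small Lagrangian at
z_k; used as a fixed comparator at the same z, it shows that an independent run at z_k is accurate
on average (`integral_h_smdX_le`). -/

namespace LpRisk

/-! ### Prox-mappings of strongly convex functions. -/

section Prox

variable {W : Type*} [NormedAddCommGroup W] [NormedSpace ℝ W]

/-- `v` has derivative `g` along `S` and is `1`-strongly convex with respect to the squared norm
`N`. -/
structure StronglyConvexWith (S : Set W) (N v : W → ℝ) (g : W → StrongDual ℝ W) : Prop where
  hasFDerivWithinAt : ∀ x ∈ S, HasFDerivWithinAt v (g x) S x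
  strong : ∀ x ∈ S, ∀ w ∈ S, v x + g x (w - x) + 1 / 2 * N (w - x) ≤ v w

theorem variational_of_isMinOn {S : Set W} (hS : Convex ℝ S) {v : W → ℝ} {g : StrongDual ℝ W}
    {w : W} (hw : w ∈ S) (hv : HasFDerivWithinAt v g S w) {η : StrongDual ℝ W}
    (hmin : IsMinOn (fun x => η x + v x) S w) {w' : W} (hw' : w' ∈ S) :
    0 ≤ η (w' - w) + g (w' - w) := by
  have h1 : HasFDerivWithinAt (fun x => η x + v x) (η + g) S w :=
    (η.hasFDerivAt.hasFDerivWithinAt).add hv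
  have h2 := IsLocalMinOn.hasFDerivWithinAt_nonneg hmin.localize h1
    (sub_mem_posTangentConeAt_of_segment_subset (hS.segment_subset hw hw'))
  simpa using h2

theorem StronglyConvexWith.exists_variational {S : Set W} {N v : W → ℝ} {g : W → StrongDual ℝ W}
    (h : StronglyConvexWith S N v g) (hS : Convex ℝ S) (hc : IsCompact S) (hne : S.Nonempty)
    (η : StrongDual ℝ W) :
    ∃ w ∈ S, IsMinOn (fun x => η x + v x) S w ∧
      ∀ w' ∈ S, 0 ≤ η (w' - w) + g w (w' - w) := by
  have hcont : ContinuousOn (fun x => η x + v x) S := fun x hx =>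
    (η.continuous.continuousWithinAt).add (h.hasFDerivWithinAt x hx).continuousWithinAt
  obtain ⟨w, hw, hmin⟩ := hc.exists_isMinOn hne hcont
  exact ⟨w, hw, hmin, fun w' hw' =>
    variational_of_isMinOn hS hw (h.hasFDerivWithinAt w hw) hmin hw'⟩

theorem StronglyConvexWith.monotone {S : Set W} {N v : W → ℝ} {g : W → StrongDual ℝ W}
    (h : StronglyConvexWith S N v g) (hN : ∀ d, ‖d‖ ^ 2 ≤ N d) {x w : W} (hx : x ∈ S)
    (hw : w ∈ S) : ‖w - x‖ ^ 2 ≤ g w (w - x) - g x (w - x) := by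
  have h1 := h.strong x hx w hw
  have h2 := h.strong w hw x hx
  have h3 := hN (w - x)
  have h4 := hN (x - w)
  rw [norm_sub_rev x w] at h4
  have h5 : g w (x - w) = - g w (w - x) := by rw [← map_neg]; simp
  linarith

/-- Add the two variational inequalities and use strong monotonicity of `g`. With `η₁ = η₂` this is
uniqueness of the minimizer; in general it is the continuity of the prox-mapping, hence the source
of its measurability. -/
theorem StronglyConvexWith.dist_variational_le {S : Set W} {N v : W → ℝ}
    {g : W → StrongDual ℝ W}
    (h : StronglyConvexWith S N v g) (hN : ∀ d, ‖d‖ ^ 2 ≤ N d) {η₁ η₂ : StrongDual ℝ W} {w₁ w₂ : W}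
    (hw₁ : w₁ ∈ S) (hw₂ : w₂ ∈ S) (h₁ : ∀ w' ∈ S, 0 ≤ η₁ (w' - w₁) + g w₁ (w' - w₁))
    (h₂ : ∀ w' ∈ S, 0 ≤ η₂ (w' - w₂) + g w₂ (w' - w₂)) : ‖w₁ - w₂‖ ≤ ‖η₁ - η₂‖ := by
  have a1 := h₁ _ hw₂
  have a2 := h₂ _ hw₁
  have a3 := h.monotone hN hw₂ hw₁
  have e1 : η₁ (w₂ - w₁) = - η₁ (w₁ - w₂) := by rw [← map_neg]; simp
  have e2 : g w₁ (w₂ - w₁) = - g w₁ (w₁ - w₂) := by rw [← map_neg]; simp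
  have a4 : ‖w₁ - w₂‖ ^ 2 ≤ (η₂ - η₁) (w₁ - w₂) := by
    simp only [sub_apply]; linarith
  have a5 : (η₂ - η₁) (w₁ - w₂) ≤ ‖η₁ - η₂‖ * ‖w₁ - w₂‖ := by
    rw [norm_sub_rev]
    exact (le_abs_self _).trans ((η₂ - η₁).le_opNorm _)
  by_contra! hlt
  have := norm_nonneg (η₁ - η₂)
  nlinarith

/-- The minimizer of `η + v` over `S`, as a function of `η`. -/
noncomputable def StronglyConvexWith.proxMap {S : Set W} {N v : W → ℝ} {g : W → StrongDual ℝ W}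
    (h : StronglyConvexWith S N v g) (hS : Convex ℝ S) (hc : IsCompact S) (hne : S.Nonempty)
    (η : StrongDual ℝ W) : W := (h.exists_variational hS hc hne η).choose

theorem StronglyConvexWith.proxMap_mem {S : Set W} {N v : W → ℝ} {g : W → StrongDual ℝ W}
    (h : StronglyConvexWith S N v g) (hS : Convex ℝ S) (hc : IsCompact S) (hne : S.Nonempty)
    (η : StrongDual ℝ W) : h.proxMap hS hc hne η ∈ S :=
  (h.exists_variational hS hc hne η).choose_spec.1

theorem StronglyConvexWith.proxMap_isMinOn {S : Set W} {N v : W → ℝ} {g : W → StrongDual ℝ W}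
    (h : StronglyConvexWith S N v g) (hS : Convex ℝ S) (hc : IsCompact S) (hne : S.Nonempty)
    (η : StrongDual ℝ W) : IsMinOn (fun x => η x + v x) S (h.proxMap hS hc hne η) :=
  (h.exists_variational hS hc hne η).choose_spec.2.1

theorem StronglyConvexWith.proxMap_variational {S : Set W} {N v : W → ℝ}
    {g : W → StrongDual ℝ W}
    (h : StronglyConvexWith S N v g) (hS : Convex ℝ S) (hc : IsCompact S) (hne : S.Nonempty)
    (η : StrongDual ℝ W) : ∀ w' ∈ S, 0 ≤ η (w' - h.proxMap hS hc hne η)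
      + g (h.proxMap hS hc hne η) (w' - h.proxMap hS hc hne η) :=
  (h.exists_variational hS hc hne η).choose_spec.2.2

theorem StronglyConvexWith.continuous_proxMap {S : Set W} {N v : W → ℝ} {g : W → StrongDual ℝ W}
    (h : StronglyConvexWith S N v g) (hN : ∀ d, ‖d‖ ^ 2 ≤ N d) (hS : Convex ℝ S)
    (hc : IsCompact S) (hne : S.Nonempty) : Continuous (h.proxMap hS hc hne) := by
  refine LipschitzWith.continuous (K := 1) (LipschitzWith.of_dist_le_mul fun η₁ η₂ => ?_)
  simpa [dist_eq_norm] using h.dist_variational_le hN (h.proxMap_mem hS hc hne η₁)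
    (h.proxMap_mem hS hc hne η₂) (h.proxMap_variational hS hc hne η₁)
    (h.proxMap_variational hS hc hne η₂)

/-- One step of mirror descent decreases the Bregman divergence to any comparator. -/
theorem StronglyConvexWith.prox_step {S : Set W} {N v : W → ℝ} {g : W → StrongDual ℝ W}
    (h : StronglyConvexWith S N v g) {u w w' : W} (hu : u ∈ S) (hw : w ∈ S)
    {l : StrongDual ℝ W} {q : ℝ} (hl : ∀ d, l d ≤ 1 / 2 * q + 1 / 2 * N d)
    (hNe : ∀ d, N (-d) = N d)
    (hvi : 0 ≤ (l - g u) (w' - w) + g w (w' - w)) :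
    l (u - w') ≤ (v w' - v u - g u (w' - u)) - (v w' - v w - g w (w' - w)) + 1 / 2 * q := by
  -- Three-point identity for Bregman divergences: the term `l (u - w)` is paid by the strong
  -- convexity term `N (w - u) / 2` up to `q / 2`, and `hvi` bounds `l (w - w')`.
  have h1 := h.strong u hu w hw
  have h2 := hl (u - w)
  have h3 : N (u - w) = N (w - u) := by rw [← hNe]; simp
  simp only [sub_apply, map_sub] at *
  linarith

end Prox

/-- Along the segment from `x` to `w`, the difference between the quadratic model with curvature `L`
and `v` has nonnegative derivative, because the gradient is `L`-Lipschitz. Only differentiability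
along `S` is available, so the argument is one-dimensional on `[0, 1]`. -/
theorem DistGen.breg_le {E : Type*} [NormedAddCommGroup E] [NormedSpace ℝ E] {S : Set E} {L : ℝ}
    (d : DistGen S L) (hS : Convex ℝ S) {x w : E} (hx : x ∈ S) (hw : w ∈ S) :
    d.breg x w ≤ L / 2 * ‖w - x‖ ^ 2 := by
  set c : ℝ → E := fun t => x + t • (w - x) with hc
  have hmem : ∀ t ∈ Set.Icc (0 : ℝ) 1, c t ∈ S := fun t ht =>
    hS.add_smul_sub_mem hx hw ht
  have hcd : ∀ t, HasDerivAt c (w - x) t := fun t => by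
    have h := ((hasDerivAt_id t).smul_const (w - x)).const_add x
    rw [one_smul] at h
    exact h
  set ψ : ℝ → ℝ := fun t => L / 2 * t ^ 2 * ‖w - x‖ ^ 2 + t * d.grad x (w - x) - d.v (c t) with hψ
  have hψd : ∀ t ∈ Set.Icc (0 : ℝ) 1, HasDerivWithinAt ψ
      (L * t * ‖w - x‖ ^ 2 + d.grad x (w - x) - d.grad (c t) (w - x)) (Set.Icc 0 1) t := by
    intro t ht
    have h1 := (d.hasFDerivWithinAt _ (hmem t ht)).comp_hasDerivWithinAt t
      ((hcd t).hasDerivWithinAt (s := Set.Icc 0 1)) hmem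
    have h2 : HasDerivWithinAt (fun t : ℝ => L / 2 * t ^ 2 * ‖w - x‖ ^ 2 + t * d.grad x (w - x))
        (L * t * ‖w - x‖ ^ 2 + d.grad x (w - x)) (Set.Icc 0 1) t := by
      have h := ((((hasDerivAt_id t).pow 2).const_mul (L / 2)).mul_const (‖w - x‖ ^ 2)).add
        ((hasDerivAt_id t).mul_const (d.grad x (w - x)))
      refine (h.congr_deriv ?_).hasDerivWithinAt
      simp only [id_eq]; push_cast; ring
    exact h2.sub h1
  have hmono : MonotoneOn ψ (Set.Icc 0 1) := by
    refine monotoneOn_of_hasDerivWithinAt_nonneg (convex_Icc 0 1)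
      (fun t ht => (hψd t ht).continuousWithinAt)
      (fun t ht => (hψd t (interior_subset ht)).mono interior_subset) fun t ht => ?_
    have ht' := interior_subset ht
    have h1 := d.lipschitz _ (hmem t ht') x hx
    have h2 : (d.grad (c t) - d.grad x) (w - x) ≤ L * ‖c t - x‖ * ‖w - x‖ :=
      ((le_abs_self _).trans ((d.grad (c t) - d.grad x).le_opNorm _)).trans
        (mul_le_mul_of_nonneg_right h1 (norm_nonneg _))
    have h3 : ‖c t - x‖ = t * ‖w - x‖ := by
      simp [hc, norm_smul, abs_of_nonneg ht'.1]
    rw [h3] at h2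
    simp only [sub_apply] at h2
    nlinarith
  have := hmono (Set.left_mem_Icc.2 zero_le_one) (Set.right_mem_Icc.2 zero_le_one) zero_le_one
  simp only [hψ, hc, DistGen.breg] at this ⊢
  simp at this ⊢
  linarith

/-- The squared Euclidean combination of the norms on the three factors. -/
def sqNorm {E : Type*} [NormedAddCommGroup E] (d : E × ℝ × ℝ) : ℝ :=
  ‖d.1‖ ^ 2 + d.2.1 ^ 2 + d.2.2 ^ 2

/-- The norm of a product type is the maximum norm, whereas a sum of three divergences is strongly
convex for the Euclidean combination. The finer `sqNorm` gives the constants, and this comparison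
gives uniqueness and continuity of the prox-mapping. -/
theorem sq_norm_le_sqNorm {E : Type*} [NormedAddCommGroup E] (d : E × ℝ × ℝ) : ‖d‖ ^ 2 ≤ sqNorm d := by
  have h1 := sq_nonneg ‖d.1‖
  have h2 := sq_nonneg d.2.1
  have h3 := sq_nonneg d.2.2
  simp only [sqNorm, Prod.norm_def, Real.norm_eq_abs]
  rcases max_choice ‖d.1‖ (max |d.2.1| |d.2.2|) with h | h <;> rw [h]
  · linarith
  · rcases max_choice |d.2.1| |d.2.2| with h | h <;> rw [h, sq_abs] <;> linarith

theorem sqNorm_neg {E : Type*} [NormedAddCommGroup E] (d : E × ℝ × ℝ) : sqNorm (-d) = sqNorm d := by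
  simp [sqNorm]

/-! ### Prox-function and stochastic gradient on U. -/

namespace Problem

variable {E Ξ : Type*} [NormedAddCommGroup E] [NormedSpace ℝ E] [MeasurableSpace Ξ]
  {Q : Problem E Ξ}

/-- The distance generating function on `U`. -/
def Prox.v (D : Q.Prox) (w : E × ℝ × ℝ) : ℝ := D.dX.v w.1 + D.dY.v w.2.1 + D.dΛ.v w.2.2

/-- The gradient of the distance generating function on `U`. -/
noncomputable def Prox.grad (D : Q.Prox) (w : E × ℝ × ℝ) : StrongDual ℝ (E × ℝ × ℝ) :=
  (D.dX.grad w.1).coprod ((D.dY.grad w.2.1).coprod (D.dΛ.grad w.2.2))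

theorem Prox.grad_apply (D : Q.Prox) (w d : E × ℝ × ℝ) :
    D.grad w d = D.dX.grad w.1 d.1 + D.dY.grad w.2.1 d.2.1 + D.dΛ.grad w.2.2 d.2.2 := by
  simp [Prox.grad, add_assoc]

theorem Prox.V_eq (D : Q.Prox) (u w : E × ℝ × ℝ) :
    D.V u w = D.v w - D.v u - D.grad u (w - u) := by
  simp only [Prox.V, DistGen.breg, Prox.v, Prox.grad_apply]
  simp only [Prod.fst_sub, Prod.snd_sub]
  ring

theorem Prox.stronglyConvexWith (D : Q.Prox) :
    StronglyConvexWith Q.U sqNorm D.v D.grad where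
  hasFDerivWithinAt x hx := by
    have h1 : HasFDerivWithinAt (fun w : E × ℝ × ℝ => D.dX.v w.1)
        ((D.dX.grad x.1).comp (ContinuousLinearMap.fst ℝ E (ℝ × ℝ))) Q.U x :=
      (D.dX.hasFDerivWithinAt x.1 hx.1).comp x hasFDerivWithinAt_fst fun w hw => hw.1
    have h2 : HasFDerivWithinAt (fun w : E × ℝ × ℝ => D.dY.v w.2.1)
        ((D.dY.grad x.2.1).comp ((ContinuousLinearMap.fst ℝ ℝ ℝ).comp
          (ContinuousLinearMap.snd ℝ E (ℝ × ℝ)))) Q.U x :=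
      (D.dY.hasFDerivWithinAt x.2.1 hx.2.1).comp x
        ((ContinuousLinearMap.fst ℝ ℝ ℝ).comp
          (ContinuousLinearMap.snd ℝ E (ℝ × ℝ))).hasFDerivAt.hasFDerivWithinAt fun w hw => hw.2.1
    have h3 : HasFDerivWithinAt (fun w : E × ℝ × ℝ => D.dΛ.v w.2.2)
        ((D.dΛ.grad x.2.2).comp ((ContinuousLinearMap.snd ℝ ℝ ℝ).comp
          (ContinuousLinearMap.snd ℝ E (ℝ × ℝ)))) Q.U x :=
      (D.dΛ.hasFDerivWithinAt x.2.2 hx.2.2).comp x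
        ((ContinuousLinearMap.snd ℝ ℝ ℝ).comp
          (ContinuousLinearMap.snd ℝ E (ℝ × ℝ))).hasFDerivAt.hasFDerivWithinAt fun w hw => hw.2.2
    refine ((h1.add h2).add h3).congr_fderiv ?_
    ext d <;> simp [Prox.grad]
  strong x hx w hw := by
    have h1 := D.dX.strongConvex x.1 hx.1 w.1 hw.1
    have h2 := D.dY.strongConvex x.2.1 hx.2.1 w.2.1 hw.2.1
    have h3 := D.dΛ.strongConvex x.2.2 hx.2.2 w.2.2 hw.2.2
    simp only [Prox.v, Prox.grad_apply, sqNorm]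
    simp only [Prod.fst_sub, Prod.snd_sub]
    simp only [Real.norm_eq_abs, sq_abs] at h2 h3
    linarith

/-- The stochastic gradient `(L'_x, L'_y, -L'_λ)` as a functional. -/
noncomputable def gradU (Q : Problem E Ξ) (z : ℝ) (u : E × ℝ × ℝ) (s : Ξ) :
    StrongDual ℝ (E × ℝ × ℝ) :=
  (Q.gradX z u s).coprod ((Q.gradY z u s • ContinuousLinearMap.id ℝ ℝ).coprod
    ((-Q.gradΛ u s) • ContinuousLinearMap.id ℝ ℝ))

theorem gradU_apply (z : ℝ) (u : E × ℝ × ℝ) (s : Ξ) (d : E × ℝ × ℝ) :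
    Q.gradU z u s d = Q.gradX z u s d.1 + Q.gradY z u s * d.2.1 - Q.gradΛ u s * d.2.2 := by
  simp [gradU, sub_eq_add_neg, add_assoc]

/-- The squared dual norm of the stochastic gradient. -/
noncomputable def gradSq (Q : Problem E Ξ) (z : ℝ) (u : E × ℝ × ℝ) (s : Ξ) : ℝ :=
  ‖Q.gradX z u s‖ ^ 2 + Q.gradY z u s ^ 2 + Q.gradΛ u s ^ 2

theorem gradSq_nonneg (z : ℝ) (u : E × ℝ × ℝ) (s : Ξ) : 0 ≤ Q.gradSq z u s := by
  unfold gradSq; positivity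

theorem smul_gradU_le (z γ : ℝ) (u : E × ℝ × ℝ) (s : Ξ) (d : E × ℝ × ℝ) :
    (γ • Q.gradU z u s) d ≤ 1 / 2 * (γ ^ 2 * Q.gradSq z u s) + 1 / 2 * sqNorm d := by
  have h1 : γ * Q.gradX z u s d.1 ≤ |γ| * ‖Q.gradX z u s‖ * ‖d.1‖ := by
    refine (le_abs_self _).trans ?_
    rw [abs_mul, mul_assoc]
    exact mul_le_mul_of_nonneg_left ((Q.gradX z u s).le_opNorm _) (abs_nonneg _)
  have h2 := sq_nonneg (|γ| * ‖Q.gradX z u s‖ - ‖d.1‖)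
  have h3 := sq_nonneg (γ * Q.gradY z u s - d.2.1)
  have h4 := sq_nonneg (γ * Q.gradΛ u s + d.2.2)
  have h5 : (|γ| * ‖Q.gradX z u s‖) ^ 2 = γ ^ 2 * ‖Q.gradX z u s‖ ^ 2 := by
    rw [mul_pow, sq_abs]
  simp only [smul_apply, smul_eq_mul, gradU_apply, gradSq, sqNorm]
  nlinarith

theorem sq_gradU_le (z : ℝ) (u : E × ℝ × ℝ) (s : Ξ) (d : E × ℝ × ℝ) :
    (Q.gradU z u s d) ^ 2 ≤ Q.gradSq z u s * sqNorm d := by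
  have h1 : |Q.gradX z u s d.1| ≤ ‖Q.gradX z u s‖ * ‖d.1‖ := (Q.gradX z u s).le_opNorm _
  have h2 : |Q.gradU z u s d| ≤
      ‖Q.gradX z u s‖ * ‖d.1‖ + |Q.gradY z u s| * |d.2.1| + |Q.gradΛ u s| * |d.2.2| := by
    rw [gradU_apply, ← abs_mul, ← abs_mul]
    exact (abs_sub _ _).trans (add_le_add_left ((abs_add_le _ _).trans (by gcongr)) _)
  have h3 := abs_nonneg (Q.gradU z u s d)
  rw [← sq_abs]
  refine (pow_le_pow_left₀ h3 h2 2).trans ?_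
  simp only [gradSq, sqNorm]
  rw [← sq_abs (Q.gradY z u s), ← sq_abs (Q.gradΛ u s), ← sq_abs d.2.1, ← sq_abs d.2.2]
  generalize ‖Q.gradX z u s‖ = a, |Q.gradY z u s| = b, |Q.gradΛ u s| = c, ‖d.1‖ = x,
    |d.2.1| = y, |d.2.2| = t
  -- Lagrange's identity: these squares add up to the defect in the Cauchy–Schwarz inequality.
  nlinarith [sq_nonneg (a * y - b * x), sq_nonneg (a * t - c * x), sq_nonneg (b * t - c * y)]

theorem Y_eq_Icc : Q.Y = Set.Icc (Q.y0 - Q.R) (Q.y0 + Q.R) := by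
  ext y
  simp only [Y, Set.mem_ofPred_eq, Set.mem_Icc, abs_le]
  constructor <;> rintro ⟨h1, h2⟩ <;> constructor <;> linarith

theorem convex_Y : Convex ℝ Q.Y := by rw [Y_eq_Icc]; exact convex_Icc _ _

theorem abs_sub_le_of_mem_Y {y w : ℝ} (hy : y ∈ Q.Y) (hw : w ∈ Q.Y) : |y - w| ≤ 2 * Q.R := by
  simp only [Y, Set.mem_ofPred_eq] at hy hw
  rw [abs_le] at *
  constructor <;> linarith [hy.1, hw.1, hy.2, hw.2]

/-- On `[0, 1]` the divergence from 0 to 1 is at least 1/2 by strong convexity and at most `Lv / 2`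
by smoothness. -/
theorem Prox.one_le_Lv (D : Q.Prox) : 1 ≤ Q.Lv := by
  have h0 : (0 : ℝ) ∈ Set.Icc (0 : ℝ) 1 := by simp
  have h1 : (1 : ℝ) ∈ Set.Icc (0 : ℝ) 1 := by simp
  have a := D.dΛ.strongConvex 0 h0 1 h1
  have b := D.dΛ.breg_le (convex_Icc 0 1) h0 h1
  simp only [DistGen.breg] at b
  norm_num at a b
  linarith

theorem Prox.half_le_DVsq (D : Q.Prox) : 1 / 2 ≤ Q.DVsq := by
  have h4 := D.one_le_Lv
  have h5 : Q.DX ^ 2 + 4 * Q.R ^ 2 + 1 ≤ Q.Lv * (Q.DX ^ 2 + 4 * Q.R ^ 2 + 1) :=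
    le_mul_of_one_le_left (by positivity) h4
  simp only [Params.DVsq]
  nlinarith [sq_nonneg Q.DX, sq_nonneg Q.R]

/-! ### Diameter and divergence bounds on U. -/

section Geometry

variable [MeasurableSpace E]

theorem Standing.DX_nonneg (hQ : Q.Standing) : 0 ≤ Q.DX := by
  simpa using hQ.diam_X _ hQ.x0_mem _ hQ.x0_mem

theorem Standing.R_pos (hQ : Q.Standing) : 0 < Q.R :=
  add_pos_of_nonneg_of_pos (mul_nonneg hQ.Lf_nonneg hQ.DX_nonneg) hQ.δ_pos

theorem Standing.convex_U (hQ : Q.Standing) : Convex ℝ Q.U :=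
  hQ.convex_X.prod (convex_Y.prod (convex_Icc 0 1))

theorem Standing.isCompact_U (hQ : Q.Standing) : IsCompact Q.U := by
  refine hQ.compact_X.prod (IsCompact.prod ?_ isCompact_Icc)
  rw [Y_eq_Icc]; exact isCompact_Icc

theorem Standing.u0_mem (hQ : Q.Standing) : Q.u0 ∈ Q.U := by
  refine ⟨hQ.x0_mem, ?_, ?_⟩
  · simp [u0, Y, hQ.R_pos.le]
  · simp [u0]

theorem Standing.nonempty_U (hQ : Q.Standing) : Q.U.Nonempty := ⟨_, hQ.u0_mem⟩

theorem Standing.sqNorm_sub_le (hQ : Q.Standing) (D : Q.Prox) {u w : E × ℝ × ℝ} (hu : u ∈ Q.U)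
    (hw : w ∈ Q.U) : sqNorm (u - w) ≤ 2 * Q.DVsq := by
  have h1 : ‖u.1 - w.1‖ ^ 2 ≤ Q.DX ^ 2 :=
    pow_le_pow_left₀ (norm_nonneg _) (hQ.diam_X _ hu.1 _ hw.1) 2
  have h2 : (u.2.1 - w.2.1) ^ 2 ≤ (2 * Q.R) ^ 2 := by
    rw [← sq_abs]
    exact pow_le_pow_left₀ (abs_nonneg _) (abs_sub_le_of_mem_Y hu.2.1 hw.2.1) 2
  have h3 : (u.2.2 - w.2.2) ^ 2 ≤ 1 := by
    have := hu.2.2; have := hw.2.2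
    simp only [Set.mem_Icc] at *
    rw [← sq_abs]
    exact pow_le_one₀ (abs_nonneg _) (abs_le.2 ⟨by linarith, by linarith⟩)
  have h4 := D.one_le_Lv
  have h5 : Q.DX ^ 2 + 4 * Q.R ^ 2 + 1 ≤ Q.Lv * (Q.DX ^ 2 + 4 * Q.R ^ 2 + 1) :=
    le_mul_of_one_le_left (by positivity) h4
  simp only [sqNorm, Params.DVsq]
  simp only [Prod.fst_sub, Prod.snd_sub]
  linarith

theorem Standing.V_le (hQ : Q.Standing) (D : Q.Prox) {u w : E × ℝ × ℝ} (hu : u ∈ Q.U)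
    (hw : w ∈ Q.U) : D.V u w ≤ Q.DVsq := by
  have h1 := D.dX.breg_le hQ.convex_X hu.1 hw.1
  have h2 := D.dY.breg_le convex_Y hu.2.1 hw.2.1
  have h3 := D.dΛ.breg_le (convex_Icc 0 1) hu.2.2 hw.2.2
  have h4 := D.one_le_Lv
  have a1 : ‖w.1 - u.1‖ ^ 2 ≤ Q.DX ^ 2 :=
    pow_le_pow_left₀ (norm_nonneg _) (hQ.diam_X _ hw.1 _ hu.1) 2
  have a2 : ‖w.2.1 - u.2.1‖ ^ 2 ≤ (2 * Q.R) ^ 2 :=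
    pow_le_pow_left₀ (norm_nonneg _) (abs_sub_le_of_mem_Y hw.2.1 hu.2.1) 2
  have a3 : ‖w.2.2 - u.2.2‖ ^ 2 ≤ 1 := by
    have := hu.2.2; have := hw.2.2
    simp only [Set.mem_Icc] at *
    exact pow_le_one₀ (norm_nonneg _) (abs_le.2 ⟨by linarith, by linarith⟩)
  simp only [Prox.V, Params.DVsq]
  have := mul_le_mul_of_nonneg_left a1 (by linarith : 0 ≤ Q.Lv / 2)
  have := mul_le_mul_of_nonneg_left a2 (by linarith : 0 ≤ Q.Lv / 2)
  have := mul_le_mul_of_nonneg_left a3 (by linarith : 0 ≤ Q.Lv / 2)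
  linarith

end Geometry

/-! ### Iterates and regret of mirror descent. -/

section MirrorDescent

variable [MeasurableSpace E]

/-- The prox-mapping of `U`. -/
noncomputable def Standing.prox (hQ : Q.Standing) (D : Q.Prox) :
    StrongDual ℝ (E × ℝ × ℝ) → E × ℝ × ℝ :=
  D.stronglyConvexWith.proxMap hQ.convex_U hQ.isCompact_U hQ.nonempty_U

theorem Standing.continuous_prox (hQ : Q.Standing) (D : Q.Prox) : Continuous (hQ.prox D) :=
  D.stronglyConvexWith.continuous_proxMap sq_norm_le_sqNorm _ _ _

/-- Up to a constant the step objective is a linear functional plus `D.v`. Its minimizer is unique,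
so the arbitrary choice in `argminOn` agrees with the continuous prox-mapping. -/
theorem Standing.argminOn_eq_prox (hQ : Q.Standing) (D : Q.Prox) (u : E × ℝ × ℝ)
    (z γ : ℝ) (s : Ξ) :
    argminOn Q.U (fun w => γ * (Q.gradX z u s w.1 + Q.gradY z u s * w.2.1
      - Q.gradΛ u s * w.2.2) + D.V u w) u = hQ.prox D (γ • Q.gradU z u s - D.grad u) := by
  set η := γ • Q.gradU z u s - D.grad u with hη
  set φ : E × ℝ × ℝ → ℝ := fun w => γ * (Q.gradX z u s w.1 + Q.gradY z u s * w.2.1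
      - Q.gradΛ u s * w.2.2) + D.V u w with hφ
  have hφη : ∀ w, φ w = (η w + D.v w) + (D.grad u u - D.v u) := fun w => by
    simp only [hφ, hη, Prox.V_eq, sub_apply, smul_apply, smul_eq_mul, map_sub]
    rw [gradU_apply]; ring
  have hmin : ∀ w, IsMinOn φ Q.U w ↔ IsMinOn (fun x => η x + D.v x) Q.U w := fun w => by
    simp only [isMinOn_iff, hφη]
    exact forall₂_congr fun x _ => by rw [add_le_add_iff_right]
  have hex : ∃ w ∈ Q.U, IsMinOn φ Q.U w := ⟨hQ.prox D η,
    D.stronglyConvexWith.proxMap_mem _ _ _ _,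
    (hmin _).2 (D.stronglyConvexWith.proxMap_isMinOn _ _ _ _)⟩
  obtain ⟨h1, h2⟩ := hex.choose_spec
  rw [argminOn, dif_pos hex]
  have h3 := D.stronglyConvexWith.dist_variational_le sq_norm_le_sqNorm (η₁ := η) (η₂ := η) h1
    (D.stronglyConvexWith.proxMap_mem hQ.convex_U hQ.isCompact_U hQ.nonempty_U η)
    (fun w' hw' => variational_of_isMinOn hQ.convex_U h1
      (D.stronglyConvexWith.hasFDerivWithinAt _ h1) ((hmin _).1 h2) hw')
    (D.stronglyConvexWith.proxMap_variational _ _ _ η)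
  rw [sub_self, norm_zero, norm_le_zero_iff, sub_eq_zero] at h3
  exact h3

theorem Standing.smd_mem (hQ : Q.Standing) (D : Q.Prox) (z : ℝ) (γ : ℕ → ℝ) (ξ : ℕ → Ξ) (t : ℕ) :
    Q.smd D z γ ξ t ∈ Q.U := by
  induction t with
  | zero => exact hQ.u0_mem
  | succ t ih =>
    rw [smd, hQ.argminOn_eq_prox D]
    exact D.stronglyConvexWith.proxMap_mem _ _ _ _

theorem Standing.smd_succ (hQ : Q.Standing) (D : Q.Prox) (z : ℝ) (γ : ℕ → ℝ) (ξ : ℕ → Ξ) (t : ℕ) :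
    Q.smd D z γ ξ (t + 1) = hQ.prox D (γ t • Q.gradU z (Q.smd D z γ ξ t) (ξ t)
      - D.grad (Q.smd D z γ ξ t)) := by
  rw [smd, hQ.argminOn_eq_prox D]

/-- Regret bound for mirror descent. -/
theorem Standing.smd_regret (hQ : Q.Standing) (D : Q.Prox) (z : ℝ) (γ : ℕ → ℝ) (ξ : ℕ → Ξ)
    {w : E × ℝ × ℝ} (hw : w ∈ Q.U) (T : ℕ) :
    ∑ t ∈ Finset.range T, γ t * Q.gradU z (Q.smd D z γ ξ t) (ξ t) (Q.smd D z γ ξ t - w)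
      ≤ Q.DVsq + 1 / 2 * ∑ t ∈ Finset.range T, γ t ^ 2 * Q.gradSq z (Q.smd D z γ ξ t) (ξ t) := by
  have key : ∀ T : ℕ, ∑ t ∈ Finset.range T,
      γ t * Q.gradU z (Q.smd D z γ ξ t) (ξ t) (Q.smd D z γ ξ t - w)
      ≤ D.V Q.u0 w - D.V (Q.smd D z γ ξ T) w
        + 1 / 2 * ∑ t ∈ Finset.range T, γ t ^ 2 * Q.gradSq z (Q.smd D z γ ξ t) (ξ t) := by
    intro T
    induction T with
    | zero => simp [smd]
    | succ t ih =>
      rw [Finset.sum_range_succ, Finset.sum_range_succ]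
      have h := D.stronglyConvexWith.prox_step (w' := w) (hQ.smd_mem D z γ ξ t)
        (hQ.smd_mem D z γ ξ (t + 1))
        (fun d => smul_gradU_le z (γ t) (Q.smd D z γ ξ t) (ξ t) d) sqNorm_neg (by
          rw [hQ.smd_succ]
          exact D.stronglyConvexWith.proxMap_variational _ _ _ _ w hw)
      rw [← D.V_eq, ← D.V_eq, smul_apply, smul_eq_mul] at h
      linarith
  have h1 := key T
  have h2 := hQ.V_le D hQ.u0_mem hw
  have h3 : 0 ≤ D.V (Q.smd D z γ ξ T) w := by
    have h := D.stronglyConvexWith.strong _ (hQ.smd_mem D z γ ξ T) _ hw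
    have : 0 ≤ sqNorm (w - Q.smd D z γ ξ T) := by unfold sqNorm; positivity
    rw [D.V_eq]; linarith
  linarith

end MirrorDescent

end Problem

/-! ### Power inequalities and joint convexity of the lifted Lagrangian. -/

theorem rpow_add_le_max_mul {a b r : ℝ} (ha : 0 ≤ a) (hb : 0 ≤ b) (hr : 0 ≤ r) :
    (a + b) ^ r ≤ max ((2 : ℝ) ^ (r - 1)) 1 * (a ^ r + b ^ r) := by
  have h0 : 0 ≤ a ^ r + b ^ r := by positivity
  rcases le_total r 1 with h | h
  · refine (Real.rpow_add_le_add_rpow ha hb hr h).trans (le_mul_of_one_le_left h0 (le_max_right _ _))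
  · refine le_trans ?_ (mul_le_mul_of_nonneg_right (le_max_left _ _) h0)
    lift a to NNReal using ha
    lift b to NNReal using hb
    exact_mod_cast NNReal.rpow_add_le_mul_rpow_add_rpow a b h

theorem rpow_eq_mul_rpow_sub_one {a p : ℝ} (ha : 0 ≤ a) (hp : 1 < p) : a ^ p = a * a ^ (p - 1) := by
  rcases ha.eq_or_lt with rfl | ha
  · rw [Real.zero_rpow (by linarith), zero_mul]
  · rw [Real.rpow_sub_one ha.ne']; field_simp

/-- Young's inequality for the perspective `(a, z) ↦ a ^ p / z ^ (p - 1)` of the `p`-th power. -/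
theorem perspective_young {p r a z : ℝ} (hp : 1 < p) (hr : 0 ≤ r) (ha : 0 ≤ a)
    (hz : 0 < z ∨ z = 0 ∧ a = 0) :
    p * r ^ (p - 1) * a ≤ a ^ p / z ^ (p - 1) + (p - 1) * r ^ p * z := by
  rcases hz with hz | ⟨rfl, rfl⟩
  · have hq : p.HolderConjugate (p / (p - 1)) := Real.HolderConjugate.conjExponent hp
    -- Young with exponents `p` and `p / (p - 1)` for `a / z` and `r ^ (p - 1)`, then multiplication
    -- by `p * z`.
    have h := Real.young_inequality_of_nonneg (div_nonneg ha hz.le)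
      (Real.rpow_nonneg hr (p - 1)) hq
    have hp1 : p - 1 ≠ 0 := by linarith
    have hp0 : p ≠ 0 := by linarith
    rw [← Real.rpow_mul hr, mul_div_cancel₀ _ hp1, Real.div_rpow ha hz.le,
      rpow_eq_mul_rpow_sub_one hz.le hp] at h
    have h2 := mul_le_mul_of_nonneg_left h (mul_nonneg (zero_le_one.trans hp.le) hz.le)
    have hzz := (Real.rpow_pos_of_pos hz (p - 1)).ne'
    have e1 : p * z * (a / z * r ^ (p - 1)) = p * r ^ (p - 1) * a := by field_simp
    have e2 : p * z * (a ^ p / (z * z ^ (p - 1)) / p + r ^ p / (p / (p - 1)))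
        = a ^ p / z ^ (p - 1) + (p - 1) * r ^ p * z := by field_simp
    rwa [e1, e2] at h2
  · have : p ≠ 0 := by linarith
    simp [Real.zero_rpow this]

namespace Problem

variable {E Ξ : Type*} [NormedAddCommGroup E] [NormedSpace ℝ E] [MeasurableSpace Ξ]
  {Q : Problem E Ξ}

/-- The positive part `(F(x,ξ) - y)_+`. -/
def posPart (Q : Problem E Ξ) (x : E) (y : ℝ) (s : Ξ) : ℝ := max (Q.F x s - y) 0

/-- The coefficient `c (p-1) p^(-p/(p-1))` of `z` in the Lagrangian. -/
noncomputable def κ (Q : Problem E Ξ) : ℝ := Q.c * (Q.p - 1) * Q.p ^ (-Q.p / (Q.p - 1))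

/-- The stochastic Lagrangian. -/
noncomputable def lagS (Q : Problem E Ξ) (x : E) (y z l : ℝ) (s : Ξ) : ℝ :=
  Q.c / z ^ (Q.p - 1) * Q.posPart x y s ^ Q.p + y + Q.κ * z + l * (Q.F x s - y)

theorem posPart_nonneg (x : E) (y : ℝ) (s : Ξ) : 0 ≤ Q.posPart x y s := le_max_right _ _

theorem slope_nonneg (hp : 1 < Q.p) (hc : 0 < Q.c) {z : ℝ} (hz : 0 < z) (u : E × ℝ × ℝ) (s : Ξ) :
    0 ≤ Q.slope z u s := by
  have : 0 ≤ Q.p := by linarith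
  have := Real.rpow_nonneg (Q.posPart_nonneg u.1 u.2.1 s) (Q.p - 1)
  unfold posPart at this
  unfold slope; positivity

/-- `perspective_young` with `r = a / z` is the tangent inequality of the perspective at `(a, z)`;
the nonnegative slope and multiplier let it compose with the subgradient inequality of `F`. The
comparator value `z' = 0` is included where the excess vanishes, because `z*` may be 0. -/
theorem Standing.lagS_subgradient [MeasurableSpace E] (hQ : Q.Standing) {z : ℝ} (hz : 0 < z)
    {u : E × ℝ × ℝ} (hu : u.1 ∈ Q.X) (hl : 0 ≤ u.2.2) {x : E} (hx : x ∈ Q.X) {y z' : ℝ} (s : Ξ)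
    (hz' : 0 < z' ∨ z' = 0 ∧ Q.posPart x y s = 0) :
    Q.lagS u.1 u.2.1 z u.2.2 s + Q.gradX z u s (x - u.1) + Q.gradY z u s * (y - u.2.1)
      + Q.gradZ z u s * (z' - z) ≤ Q.lagS x y z' u.2.2 s := by
  have hp := hQ.one_lt_p
  have hc := hQ.c_pos
  set a := Q.posPart u.1 u.2.1 s with ha
  have ha0 : 0 ≤ a := posPart_nonneg _ _ _
  set a' := Q.posPart x y s with ha'
  have ha'0 : 0 ≤ a' := posPart_nonneg _ _ _
  set r := a / z with hr
  have hr0 : 0 ≤ r := div_nonneg ha0 hz.le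
  have hY := perspective_young hp hr0 ha'0 hz'
  have hsg := hQ.subgrad_F' u.1 hu s x hx
  have hsl := slope_nonneg hp hc hz u s
  have hslr : Q.slope z u s = Q.c * (Q.p * r ^ (Q.p - 1)) := by
    rw [hr, Real.div_rpow ha0 hz.le, slope, ← posPart, ← ha]; ring
  have hrp : r ^ Q.p = a ^ Q.p / z ^ Q.p := by rw [hr, Real.div_rpow ha0 hz.le]
  have hgz : Q.gradZ z u s = -(Q.c * (Q.p - 1) * r ^ Q.p) + Q.κ := by
    rw [hrp, gradZ, ← posPart, ← ha, κ]; ring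
  have hl1 : Q.c / z ^ (Q.p - 1) * a ^ Q.p = Q.c * (r ^ Q.p * z) := by
    have := (Real.rpow_pos_of_pos hz (Q.p - 1)).ne'
    rw [hrp, rpow_eq_mul_rpow_sub_one hz.le hp]; field_simp
  have hslF : Q.slope z u s * (Q.F u.1 s - u.2.1) = Q.c * (Q.p * (r ^ Q.p * z)) := by
    have h1 : Q.slope z u s * (Q.F u.1 s - u.2.1) = Q.slope z u s * a := by
      -- Below `y` the positive part is 0, and so is the slope because `p - 1 > 0`; hence `F - y`
      -- may be replaced by its positive part.
      rcases le_total (Q.F u.1 s - u.2.1) 0 with h | h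
      · have : a = 0 := by rw [ha, posPart, max_eq_right h]
        have h0 : Q.slope z u s = 0 := by
          rw [hslr, hr, this, zero_div, Real.zero_rpow (by linarith)]; ring
        rw [h0]; ring
      · rw [ha, posPart, max_eq_left h]
    rw [h1, hslr, rpow_eq_mul_rpow_sub_one hr0 hp, hr]; field_simp
  have hF' : Q.F x s - y ≤ a' := le_max_left _ _
  have h1 := mul_le_mul_of_nonneg_left hsg hsl
  have h2 := mul_le_mul_of_nonneg_left hsg hl
  have h3 := mul_le_mul_of_nonneg_left hF' hsl
  have h4 : Q.slope z u s * a' = Q.c * (Q.p * r ^ (Q.p - 1) * a') := by rw [hslr]; ring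
  have h5 := mul_le_mul_of_nonneg_left hY hc.le
  simp only [lagS, gradX, gradY, smul_apply, smul_eq_mul]
  rw [← ha, ← ha', hl1, hgz]
  have h6 : Q.c * (a' ^ Q.p / z' ^ (Q.p - 1)) = Q.c / z' ^ (Q.p - 1) * a' ^ Q.p := by ring
  rw [mul_add, h6] at h5
  linarith

/-! ### Joint measurability. -/

section Measurability

variable [MeasurableSpace E]

theorem secondCountableTopology_of_finiteDimensional (E : Type*) [NormedAddCommGroup E]
    [NormedSpace ℝ E] [FiniteDimensional ℝ E] : SecondCountableTopology E := by
  have := FiniteDimensional.proper ℝ E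
  infer_instance

variable [BorelSpace E] [FiniteDimensional ℝ E]

/-- `F` is a Carathéodory function, continuous in the point and measurable in the sample, on a
second countable space. -/
theorem Standing.measurable_uncurry_F (hQ : Q.Standing) :
    Measurable fun a : E × Ξ => Q.F a.1 a.2 := by
  have := secondCountableTopology_of_finiteDimensional E
  exact measurable_uncurry_of_continuous_of_measurable (u := Q.F) hQ.continuous_F hQ.measurable_F

theorem Standing.measurable_posPart (hQ : Q.Standing) :
    Measurable fun a : (E × ℝ) × Ξ => Q.posPart a.1.1 a.1.2 a.2 := by
  have h := hQ.measurable_uncurry_F.comp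
    ((measurable_fst.comp measurable_fst).prodMk measurable_snd :
      Measurable fun a : (E × ℝ) × Ξ => (a.1.1, a.2))
  exact (h.sub (measurable_snd.comp measurable_fst)).max measurable_const

theorem Standing.measurable_posPart_right (hQ : Q.Standing) (x : E) (y : ℝ) :
    Measurable fun s => Q.posPart x y s :=
  hQ.measurable_posPart.comp (measurable_const.prodMk measurable_id :
    Measurable fun s => ((x, y), s))

theorem Standing.measurable_slope (hQ : Q.Standing) (z : ℝ) :
    Measurable fun a : (E × ℝ × ℝ) × Ξ => Q.slope z a.1 a.2 := by
  have h := hQ.measurable_posPart.comp ((by fun_prop :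
      Measurable fun a : (E × ℝ × ℝ) × Ξ => ((a.1.1, a.1.2.1), a.2)))
  exact (h.pow_const (Q.p - 1)).const_mul _

theorem Standing.measurable_gradX (hQ : Q.Standing) (z : ℝ) :
    Measurable fun a : (E × ℝ × ℝ) × Ξ => Q.gradX z a.1 a.2 := by
  have := secondCountableTopology_of_finiteDimensional (StrongDual ℝ E)
  have h1 := hQ.measurable_F'.comp ((by fun_prop :
      Measurable fun a : (E × ℝ × ℝ) × Ξ => (a.1.1, a.2)))
  exact ((hQ.measurable_slope z).add (by fun_prop)).smul h1

theorem Standing.measurable_gradY (hQ : Q.Standing) (z : ℝ) :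
    Measurable fun a : (E × ℝ × ℝ) × Ξ => Q.gradY z a.1 a.2 :=
  ((hQ.measurable_slope z).neg.add_const 1).sub (by fun_prop)

theorem Standing.measurable_gradΛ (hQ : Q.Standing) :
    Measurable fun a : (E × ℝ × ℝ) × Ξ => Q.gradΛ a.1 a.2 :=
  (hQ.measurable_uncurry_F.comp ((by fun_prop :
      Measurable fun a : (E × ℝ × ℝ) × Ξ => (a.1.1, a.2)))).sub (by fun_prop)

theorem Standing.measurable_gradZ (hQ : Q.Standing) (z : ℝ) :
    Measurable fun a : (E × ℝ × ℝ) × Ξ => Q.gradZ z a.1 a.2 := by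
  have h := hQ.measurable_posPart.comp ((by fun_prop :
      Measurable fun a : (E × ℝ × ℝ) × Ξ => ((a.1.1, a.1.2.1), a.2)))
  exact ((h.pow_const Q.p).const_mul _).add_const _

theorem Standing.measurable_gradSq (hQ : Q.Standing) (z : ℝ) :
    Measurable fun a : (E × ℝ × ℝ) × Ξ => Q.gradSq z a.1 a.2 :=
  (((hQ.measurable_gradX z).norm.pow_const 2).add ((hQ.measurable_gradY z).pow_const 2)).add
    (hQ.measurable_gradΛ.pow_const 2)

theorem Standing.measurable_gradU_apply (hQ : Q.Standing) (z : ℝ)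
    {d : E × ℝ × ℝ → E × ℝ × ℝ} (hd : Measurable d) :
    Measurable fun a : (E × ℝ × ℝ) × Ξ => Q.gradU z a.1 a.2 (d a.1) := by
  have := secondCountableTopology_of_finiteDimensional E
  have := secondCountableTopology_of_finiteDimensional (StrongDual ℝ E)
  have hev : Measurable fun b : StrongDual ℝ E × E => b.1 b.2 :=
    (by fun_prop : Continuous fun b : StrongDual ℝ E × E => b.1 b.2).measurable
  simp only [gradU_apply]
  exact ((hev.comp ((hQ.measurable_gradX z).prodMk
    (measurable_fst.comp (hd.comp measurable_fst)))).add
      ((hQ.measurable_gradY z).mul (by fun_prop))).sub (hQ.measurable_gradΛ.mul (by fun_prop))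

theorem Standing.measurable_f (hQ : Q.Standing) : Measurable Q.f := by
  have := hQ.isProb
  exact (StronglyMeasurable.integral_prod_right
    (f := fun x s => Q.F x s) hQ.measurable_uncurry_F.stronglyMeasurable).measurable

theorem Standing.measurable_h (hQ : Q.Standing) : Measurable Q.h := by
  have := hQ.isProb
  have h1 : Measurable fun a : E × Ξ => Q.posPart a.1 (Q.f a.1) a.2 :=
    hQ.measurable_posPart.comp ((measurable_fst.prodMk
      (hQ.measurable_f.comp measurable_fst)).prodMk measurable_snd)
  have h2 : Measurable fun x => ∫ s, Q.posPart x (Q.f x) s ^ Q.p ∂Q.P :=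
    (StronglyMeasurable.integral_prod_right
      (f := fun x s => Q.posPart x (Q.f x) s ^ Q.p)
        (h1.pow_const Q.p).stronglyMeasurable).measurable
  exact hQ.measurable_f.add ((h2.pow_const (1 / Q.p)).const_mul Q.c)

end Measurability

end Problem

/-! ### Moment bounds for the stochastic gradient. -/

theorem sq_add_add_le (a b c : ℝ) : (a + b + c) ^ 2 ≤ 3 * (a ^ 2 + b ^ 2 + c ^ 2) := by
  linarith [sq_nonneg (a - b), sq_nonneg (a - c), sq_nonneg (b - c)]

namespace Problem

variable {E Ξ : Type*} [NormedAddCommGroup E] [NormedSpace ℝ E] [MeasurableSpace Ξ]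
  {Q : Problem E Ξ} [MeasurableSpace E]

section Moments

theorem Standing.integrable_F (hQ : Q.Standing) {x : E} (hx : x ∈ Q.X) :
    Integrable (Q.F x) Q.P := by
  have := hQ.isProb
  exact (hQ.memLp_F x hx).integrable (by norm_num)

theorem Standing.abs_f_sub_le (hQ : Q.Standing) {x : E} (hx : x ∈ Q.X) {y : ℝ} (hy : y ∈ Q.Y) :
    |Q.f x - y| ≤ 2 * Q.R := abs_sub_le_of_mem_Y (hQ.mean_mem_Y x hx) hy

theorem Standing.posPart_le (hQ : Q.Standing) {x : E} (hx : x ∈ Q.X) {y : ℝ} (hy : y ∈ Q.Y)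
    (s : Ξ) : Q.posPart x y s ≤ Q.posPart x (Q.f x) s + 2 * Q.R := by
  have h := (abs_le.1 (hQ.abs_f_sub_le hx hy)).2
  have h1 : Q.F x s - Q.f x ≤ Q.posPart x (Q.f x) s := le_max_left _ _
  have h2 := Q.posPart_nonneg x (Q.f x) s
  have := hQ.R_pos
  exact max_le (by linarith) (by linarith)

theorem Standing.posPart_rpow_le (hQ : Q.Standing) {x : E} (hx : x ∈ Q.X) {y : ℝ} (hy : y ∈ Q.Y)
    (s : Ξ) {r : ℝ} (hr : 0 ≤ r) : Q.posPart x y s ^ r ≤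
      max ((2 : ℝ) ^ (r - 1)) 1 * (Q.posPart x (Q.f x) s ^ r + (2 * Q.R) ^ r) := by
  have := hQ.R_pos
  exact (Real.rpow_le_rpow (posPart_nonneg _ _ _) (hQ.posPart_le hx hy s) hr).trans
    (rpow_add_le_max_mul (posPart_nonneg _ _ _) (by linarith) hr)

theorem Standing.integrable_sq_sub_f (hQ : Q.Standing) {x : E} (hx : x ∈ Q.X) :
    Integrable (fun s => (Q.F x s - Q.f x) ^ 2) Q.P := by
  have := hQ.isProb
  exact ((hQ.memLp_F x hx).sub (memLp_const _)).integrable_sq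

theorem Standing.integrable_sq_sub_f' (hQ : Q.Standing) {x : E} (hx : x ∈ Q.X) :
    Integrable (fun s => ‖Q.F' x s - Q.f' x‖ ^ 2) Q.P := by
  have := hQ.isProb
  exact ((hQ.memLp_F' x hx).sub (memLp_const _)).integrable_norm_pow (by norm_num)

/-- Pointwise majorant of the squared norm of the stochastic gradient. -/
theorem Standing.gradSq_le (hQ : Q.Standing) {z : ℝ} (hz : 0 < z) {u : E × ℝ × ℝ}
    (hu : u ∈ Q.U) (s : Ξ) : Q.gradSq z u s ≤
      3 * (Q.c * Q.m / z ^ (Q.p - 1)) ^ 2 * ‖Q.G' u.1 s‖ ^ 2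
      + 3 * (Q.c * Q.m / z ^ (Q.p - 1)) ^ 2 * Q.p ^ 2 * (Q.Lf ^ 2 + 1)
          * Q.posPart u.1 (Q.f u.1) s ^ (2 * Q.p - 2)
      + 12 * ((Q.c * Q.m / z ^ (Q.p - 1)) ^ 2 * Q.p ^ 2 * (2 * Q.R) ^ (2 * Q.p - 2) + 1)
          * (‖Q.F' u.1 s - Q.f' u.1‖ ^ 2 + Q.Lf ^ 2)
      + 3 * ((Q.c * Q.m / z ^ (Q.p - 1)) ^ 2 * Q.p ^ 2 * (2 * Q.R) ^ (2 * Q.p - 2) + 1)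
      + 2 * (Q.F u.1 s - Q.f u.1) ^ 2 + 8 * Q.R ^ 2 := by
  have hp := hQ.one_lt_p
  have hc := hQ.c_pos
  have hR := hQ.R_pos
  obtain ⟨hx, hy, hl0, hl1⟩ := hu
  set k := Q.c * Q.m / z ^ (Q.p - 1) with hk
  have hm : 0 < Q.m := lt_max_of_lt_right one_pos
  have hk0 : 0 ≤ k := by positivity
  have he0 := Q.posPart_nonneg u.1 (Q.f u.1) s
  set e := Q.posPart u.1 (Q.f u.1) s ^ (Q.p - 1) with he
  set ρ := (2 * Q.R) ^ (Q.p - 1) with hρ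
  have he1 : 0 ≤ e := Real.rpow_nonneg he0 _
  have hρ1 : 0 ≤ ρ := Real.rpow_nonneg (by linarith) _
  have e2 : Q.posPart u.1 (Q.f u.1) s ^ (2 * Q.p - 2) = e ^ 2 := by
    rw [he, ← Real.rpow_mul_natCast he0]; congr 1; push_cast; ring
  have ρ2 : (2 * Q.R) ^ (2 * Q.p - 2) = ρ ^ 2 := by
    rw [hρ, ← Real.rpow_mul_natCast (by linarith)]; congr 1; push_cast; ring
  rw [e2, ρ2]
  have hsl0 := slope_nonneg hp hc hz u s
  -- The excess over `y` is at most the excess over the mean plus `2R`, since both the mean and `y`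
  -- lie in `Y`. This splits the slope into a random part `e` and a deterministic part `ρ`.
  have hsl : Q.slope z u s ≤ k * Q.p * e + k * Q.p * ρ := by
    have h := hQ.posPart_rpow_le hx hy s (by linarith : 0 ≤ Q.p - 1)
    rw [show Q.p - 1 - 1 = Q.p - 2 by ring, ← Params.m, ← he, ← hρ] at h
    have h1 : 0 ≤ Q.c * Q.p / z ^ (Q.p - 1) := by positivity
    have h2 := mul_le_mul_of_nonneg_left h h1
    have h3 : Q.c * Q.p / z ^ (Q.p - 1) * (Q.m * (e + ρ)) = k * Q.p * e + k * Q.p * ρ := by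
      rw [hk]; ring
    rw [h3] at h2
    exact h2
  set φ := ‖Q.F' u.1 s‖ with hφ
  have hφ0 : 0 ≤ φ := norm_nonneg _
  set δ := ‖Q.F' u.1 s - Q.f' u.1‖ with hδ
  have hf' := hQ.norm_f' u.1 hx
  have hφle : φ ≤ δ + Q.Lf := by
    have : φ ≤ δ + ‖Q.f' u.1‖ := by
      have := norm_add_le (Q.F' u.1 s - Q.f' u.1) (Q.f' u.1)
      rwa [sub_add_cancel] at this
    linarith
  -- The product of the excess power with the subgradient noise is exactly the norm of `G'`, so its
  -- second moment is bounded without higher moments of `F'`.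
  have hG : ‖Q.G' u.1 s‖ = Q.p * e * δ := by
    rw [G', norm_smul]
    show ‖Q.p * e‖ * δ = _
    rw [Real.norm_of_nonneg (mul_nonneg (by linarith) he1)]
  have hδ0 : 0 ≤ δ := norm_nonneg _
  have hpe : 0 ≤ Q.p * e := mul_nonneg (by linarith) he1
  set g := ‖Q.G' u.1 s‖ with hg
  clear_value k e ρ φ δ g
  have hX : ‖Q.gradX z u s‖ ≤ k * g + k * Q.p * e * Q.Lf + (k * Q.p * ρ + 1) * φ := by
    rw [gradX, norm_smul, Real.norm_of_nonneg (add_nonneg hsl0 hl0), ← hφ]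
    have h1 : (Q.slope z u s + u.2.2) * φ ≤ (k * Q.p * e + k * Q.p * ρ + 1) * φ :=
      mul_le_mul_of_nonneg_right (by linarith) hφ0
    have h2 : k * (Q.p * e) * φ ≤ k * (Q.p * e) * (δ + Q.Lf) :=
      mul_le_mul_of_nonneg_left hφle (mul_nonneg hk0 hpe)
    rw [hG]; linarith
  have hX2 : ‖Q.gradX z u s‖ ^ 2 ≤ 3 * k ^ 2 * g ^ 2 + 3 * k ^ 2 * Q.p ^ 2 * Q.Lf ^ 2 * e ^ 2
      + 6 * (k ^ 2 * Q.p ^ 2 * ρ ^ 2 + 1) * φ ^ 2 := by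
    have h1 := pow_le_pow_left₀ (norm_nonneg _) hX 2
    have a1 : (k * g + k * Q.p * e * Q.Lf + (k * Q.p * ρ + 1) * φ) ^ 2 ≤
        3 * ((k * g) ^ 2 + (k * Q.p * e * Q.Lf) ^ 2 + ((k * Q.p * ρ + 1) * φ) ^ 2) := sq_add_add_le _ _ _
    have a2 : (k * Q.p * ρ + 1) ^ 2 * φ ^ 2 ≤ 2 * ((k * Q.p * ρ) ^ 2 + 1) * φ ^ 2 :=
      mul_le_mul_of_nonneg_right (by linarith [sq_nonneg (k * Q.p * ρ - 1)]) (sq_nonneg _)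
    linarith
  have hφ2 : φ ^ 2 ≤ 2 * (δ ^ 2 + Q.Lf ^ 2) := by
    have := pow_le_pow_left₀ hφ0 hφle 2
    linarith [sq_nonneg (δ - Q.Lf)]
  have hY2 : Q.gradY z u s ^ 2 ≤ 3 * (k ^ 2 * Q.p ^ 2 * e ^ 2 + k ^ 2 * Q.p ^ 2 * ρ ^ 2 + 1) := by
    have h1 : |Q.gradY z u s| ≤ k * Q.p * e + k * Q.p * ρ + 1 := by
      rw [gradY, abs_le]
      constructor
      · linarith
      · have : 0 ≤ k * Q.p := mul_nonneg hk0 (by linarith)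
        have := mul_nonneg this he1
        have : 0 ≤ k * Q.p * ρ := by positivity
        linarith
    have h2 := pow_le_pow_left₀ (abs_nonneg _) h1 2
    rw [sq_abs] at h2
    have h3 := sq_add_add_le (k * Q.p * e) (k * Q.p * ρ) 1
    rw [mul_pow, mul_pow, mul_pow, mul_pow] at h3
    linarith
  have hΛ2 : Q.gradΛ u s ^ 2 ≤ 2 * (Q.F u.1 s - Q.f u.1) ^ 2 + 8 * Q.R ^ 2 := by
    have h1 := pow_le_pow_left₀ (abs_nonneg _) (hQ.abs_f_sub_le hx hy) 2
    rw [sq_abs] at h1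
    rw [gradΛ]
    linarith [sq_nonneg ((Q.F u.1 s - Q.f u.1) - (Q.f u.1 - u.2.1))]
  have hA : 6 * (k ^ 2 * Q.p ^ 2 * ρ ^ 2 + 1) * φ ^ 2 ≤
      6 * (k ^ 2 * Q.p ^ 2 * ρ ^ 2 + 1) * (2 * (δ ^ 2 + Q.Lf ^ 2)) :=
    mul_le_mul_of_nonneg_left hφ2 (by positivity)
  rw [gradSq]
  generalize ‖Q.gradX z u s‖ ^ 2 = X at *
  generalize Q.gradY z u s ^ 2 = Y at *
  generalize Q.gradΛ u s ^ 2 = L at *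
  generalize (Q.F u.1 s - Q.f u.1) ^ 2 = V at *
  linarith

variable [BorelSpace E] [FiniteDimensional ℝ E]

theorem Standing.integrable_excess_rpow (hQ : Q.Standing) (hM : Q.SemimomentBound) {x : E}
    (hx : x ∈ Q.X) {r : ℝ} (hr0 : 0 ≤ r) (hr : r ≤ 2 * Q.p) :
    Integrable (fun s => Q.posPart x (Q.f x) s ^ r) Q.P := by
  have := hQ.isProb
  refine ((integrable_const 1).add (hM.integrable x hx)).mono'
    ((hQ.measurable_posPart_right x _).pow_const r).aestronglyMeasurable
    (Filter.Eventually.of_forall fun s => ?_)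
  have h0 := Q.posPart_nonneg x (Q.f x) s
  rw [Real.norm_of_nonneg (Real.rpow_nonneg h0 r)]
  show _ ≤ 1 + Q.posPart x (Q.f x) s ^ (2 * Q.p)
  rcases le_total (Q.posPart x (Q.f x) s) 1 with h | h
  · have := Real.rpow_le_one h0 h hr0
    have := Real.rpow_nonneg h0 (2 * Q.p)
    linarith
  · have := Real.rpow_le_rpow_of_exponent_le h hr
    linarith

/-- Jensen's inequality for the concave power with exponent `r / (2p) ≤ 1`, applied to the `2p`-th
power of the excess. -/
theorem Standing.integral_excess_rpow_le (hQ : Q.Standing) (hM : Q.SemimomentBound) {x : E}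
    (hx : x ∈ Q.X) {r : ℝ} (hr0 : 0 ≤ r) (hr : r ≤ 2 * Q.p) :
    ∫ s, Q.posPart x (Q.f x) s ^ r ∂Q.P ≤ Q.Mf ^ r := by
  have := hQ.isProb
  have hp := hQ.one_lt_p
  have h2p : 0 < 2 * Q.p := by linarith
  set t := r / (2 * Q.p) with ht
  have ht0 : 0 ≤ t := by positivity
  have ht1 : t ≤ 1 := (div_le_one h2p).2 hr
  have hcomp : ∀ b : ℝ, 0 ≤ b → (b ^ (2 * Q.p)) ^ t = b ^ r := fun b hb => by
    rw [← Real.rpow_mul hb, ht, mul_div_cancel₀ _ h2p.ne']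
  have hint := hM.integrable x hx
  have h := (Real.concaveOn_rpow ht0 ht1).le_map_integral
    (f := fun s => Q.posPart x (Q.f x) s ^ (2 * Q.p)) (μ := Q.P)
    (fun b _ => (Real.continuousAt_rpow_const b t (by
      rcases ht0.eq_or_lt with h | h
      · right; exact h.le
      · right; exact h.le)).continuousWithinAt) isClosed_Ici
    (Filter.Eventually.of_forall fun s => Real.rpow_nonneg (Q.posPart_nonneg _ _ _) _) hint (by
      refine (hQ.integrable_excess_rpow hM hx hr0 hr).congr
        (Filter.Eventually.of_forall fun s => ?_)
      simp only [Function.comp]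
      rw [hcomp _ (posPart_nonneg _ _ _)])
  simp only [hcomp _ (Q.posPart_nonneg _ _ _)] at h
  refine h.trans ?_
  rw [← hcomp _ hM.Mf_nonneg]
  exact Real.rpow_le_rpow (integral_nonneg fun s => Real.rpow_nonneg (Q.posPart_nonneg _ _ _) _)
    (hM.bound x hx) ht0

theorem Standing.integrable_posPart_rpow (hQ : Q.Standing) (hM : Q.SemimomentBound) {x : E}
    (hx : x ∈ Q.X) {y : ℝ} (hy : y ∈ Q.Y) {r : ℝ} (hr0 : 0 ≤ r) (hr : r ≤ 2 * Q.p) :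
    Integrable (fun s => Q.posPart x y s ^ r) Q.P := by
  have := hQ.isProb
  refine (((hQ.integrable_excess_rpow hM hx hr0 hr).add
    (integrable_const ((2 * Q.R) ^ r))).const_mul (max ((2 : ℝ) ^ (r - 1)) 1)).mono'
    ((hQ.measurable_posPart_right x _).pow_const r).aestronglyMeasurable
    (Filter.Eventually.of_forall fun s => ?_)
  rw [Real.norm_of_nonneg (Real.rpow_nonneg (posPart_nonneg _ _ _) r)]
  exact hQ.posPart_rpow_le hx hy s hr0

theorem Standing.integral_posPart_rpow_le (hQ : Q.Standing) (hM : Q.SemimomentBound) {x : E}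
    (hx : x ∈ Q.X) {y : ℝ} (hy : y ∈ Q.Y) {r : ℝ} (hr0 : 1 ≤ r) (hr : r ≤ 2 * Q.p) :
    ∫ s, Q.posPart x y s ^ r ∂Q.P ≤ (2 : ℝ) ^ (r - 1) * (Q.Mf ^ r + (2 * Q.R) ^ r) := by
  have := hQ.isProb
  have hr1 : 0 ≤ r := by linarith
  have h1 := hQ.integrable_excess_rpow hM hx hr1 hr
  have h2 : Integrable (fun s => Q.posPart x (Q.f x) s ^ r + (2 * Q.R) ^ r) Q.P :=
    h1.add (integrable_const _)
  refine (integral_mono (hQ.integrable_posPart_rpow hM hx hy hr1 hr)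
    (h2.const_mul ((2 : ℝ) ^ (r - 1))) fun s => ?_).trans ?_
  · have := hQ.posPart_rpow_le hx hy s hr1
    rwa [max_eq_left (Real.one_le_rpow one_le_two (by linarith))] at this
  · rw [integral_const_mul, integral_add h1 (integrable_const _)]
    simp only [integral_const, probReal_univ, one_smul]
    gcongr
    exact hQ.integral_excess_rpow_le hM hx hr1 hr

theorem Standing.integrable_gradSq_and_integral_le (hQ : Q.Standing) (hM : Q.SemimomentBound)
    (hG : Q.SemidevLipschitz) {z : ℝ} (hz : 0 < z) {u : E × ℝ × ℝ} (hu : u ∈ Q.U) :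
    Integrable (Q.gradSq z u) Q.P ∧ ∫ s, Q.gradSq z u s ∂Q.P ≤ Q.Msq z := by
  have := hQ.isProb
  have hp := hQ.one_lt_p
  have hR := hQ.R_pos
  have hx := hu.1
  set k := Q.c * Q.m / z ^ (Q.p - 1) with hk
  set ρ := (2 * Q.R) ^ (2 * Q.p - 2) with hρ
  have hρ0 : 0 ≤ ρ := Real.rpow_nonneg (by linarith) _
  have i1 := (hG.integrable u.1 hx).const_mul (3 * k ^ 2)
  have i2 := (hQ.integrable_excess_rpow hM hx (r := 2 * Q.p - 2) (by linarith)
    (by linarith)).const_mul (3 * k ^ 2 * Q.p ^ 2 * (Q.Lf ^ 2 + 1))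
  have i3' := (hQ.integrable_sq_sub_f' hx).add (integrable_const (Q.Lf ^ 2))
  have i3 := i3'.const_mul (12 * (k ^ 2 * Q.p ^ 2 * ρ + 1))
  have i4 : Integrable (fun _ : Ξ => 3 * (k ^ 2 * Q.p ^ 2 * ρ + 1)) Q.P := integrable_const _
  have i5 := (hQ.integrable_sq_sub_f hx).const_mul 2
  have i6 : Integrable (fun _ : Ξ => 8 * Q.R ^ 2) Q.P := integrable_const _
  have i12 := i1.add i2
  have i123 := i12.add i3
  have i1234 := i123.add i4
  have i12345 := i1234.add i5
  have iall := i12345.add i6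
  have hle : ∀ s, Q.gradSq z u s ≤ _ := fun s => hQ.gradSq_le hz hu s
  have hint : Integrable (Q.gradSq z u) Q.P := by
    refine iall.mono' ((hQ.measurable_gradSq z).comp
      (measurable_const.prodMk measurable_id)).aestronglyMeasurable
      (Filter.Eventually.of_forall fun s => ?_)
    rw [Real.norm_of_nonneg (gradSq_nonneg _ _ _)]
    exact hle s
  refine ⟨hint, (integral_mono hint iall hle).trans ?_⟩
  rw [integral_add' i12345 i6, integral_add' i1234 i5, integral_add' i123 i4, integral_add' i12 i3,
    integral_add' i1 i2, integral_const_mul, integral_const_mul, integral_const_mul,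
    integral_const_mul, integral_const_mul, integral_add' (hQ.integrable_sq_sub_f' hx) (integrable_const _)]
  simp only [integral_const, probReal_univ, one_smul]
  have b1 := hG.bound u.1 hx
  have b2 := hQ.integral_excess_rpow_le hM hx (r := 2 * Q.p - 2) (by linarith) (by linarith)
  have b3 := hQ.variance_F' u.1 hx
  have b4 := hQ.variance_F u.1 hx
  -- `M_z²` is what the integral of the majorant becomes when every moment is replaced by its bound.
  have hMsq : Q.Msq z = 3 * k ^ 2 * Q.LG ^ 2
      + 3 * k ^ 2 * Q.p ^ 2 * (Q.Lf ^ 2 + 1) * Q.Mf ^ (2 * Q.p - 2)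
      + 12 * (k ^ 2 * Q.p ^ 2 * ρ + 1) * (Q.σf ^ 2 + Q.Lf ^ 2)
      + 3 * (k ^ 2 * Q.p ^ 2 * ρ + 1) + 2 * Q.β ^ 2 + 8 * Q.R ^ 2 := by
    have hz2 : z ^ (2 * Q.p - 2) = (z ^ (Q.p - 1)) ^ 2 := by
      rw [← Real.rpow_mul_natCast hz.le]; congr 1; push_cast; ring
    have hr2 : ρ = (2 : ℝ) ^ (2 * Q.p - 2) * Q.R ^ (2 * Q.p - 2) :=
      Real.mul_rpow (by norm_num) hR.le
    have h4 : (2 : ℝ) ^ (2 * Q.p) = 4 * (2 : ℝ) ^ (2 * Q.p - 2) := by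
      rw [Real.rpow_sub (by norm_num)]; norm_num; ring
    rw [Params.Msq, hz2, h4, hr2, hk]
    field_simp
    ring
  rw [hMsq]
  gcongr

end Moments

end Problem

/-! ### The expected Lagrangian and its relation to the risk. -/

namespace Problem

variable {E Ξ : Type*} [NormedAddCommGroup E] [NormedSpace ℝ E] [MeasurableSpace Ξ]
  {Q : Problem E Ξ}

/-- The Lagrangian. -/
noncomputable def lag (Q : Problem E Ξ) (x : E) (y z l : ℝ) : ℝ := ∫ s, Q.lagS x y z l s ∂Q.P

/-- The expected gradient `(L'_x, L'_y, -L'_λ)` applied to `d`. -/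
noncomputable def meanU (Q : Problem E Ξ) (z : ℝ) (u d : E × ℝ × ℝ) : ℝ :=
  ∫ s, Q.gradU z u s d ∂Q.P

/-- The expected derivative in `z`. -/
noncomputable def meanZ (Q : Problem E Ξ) (z : ℝ) (u : E × ℝ × ℝ) : ℝ := ∫ s, Q.gradZ z u s ∂Q.P

theorem gradZ_eq (z : ℝ) (u : E × ℝ × ℝ) (s : Ξ) : Q.gradZ z u s =
    -(Q.c * (Q.p - 1) / z ^ Q.p) * Q.posPart u.1 u.2.1 s ^ Q.p + Q.κ := rfl

theorem semidev_eq (x : E) :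
    Q.semidev x = (∫ s, Q.posPart x (Q.f x) s ^ Q.p ∂Q.P) ^ (1 / Q.p) := rfl

theorem semidev_nonneg (x : E) : 0 ≤ Q.semidev x :=
  Real.rpow_nonneg (integral_nonneg fun _ => Real.rpow_nonneg (Q.posPart_nonneg _ _ _) _) _

theorem Standing.convexOn_lagS [MeasurableSpace E] (hQ : Q.Standing) {z l : ℝ} (hz : 0 < z)
    (hl : 0 ≤ l) (s : Ξ) :
    ConvexOn ℝ Set.univ fun w : E × ℝ => Q.lagS w.1 w.2 z l s := by
  have hp := hQ.one_lt_p
  have hc := hQ.c_pos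
  have h1 : ConvexOn ℝ Set.univ fun w : E × ℝ => Q.F w.1 s - w.2 := by
    have hF : ConvexOn ℝ Set.univ fun w : E × ℝ => Q.F w.1 s :=
      (hQ.convex_F s).comp_linearMap (LinearMap.fst ℝ E ℝ)
    exact hF.sub ((LinearMap.snd ℝ E ℝ).concaveOn convex_univ)
  have h2 : ConvexOn ℝ Set.univ fun w : E × ℝ => Q.posPart w.1 w.2 s :=
    h1.sup (convexOn_const 0 convex_univ)
  have h3 : ConvexOn ℝ Set.univ fun w : E × ℝ => Q.posPart w.1 w.2 s ^ Q.p := by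
    refine ⟨convex_univ, fun w _ w' _ a b ha hb hab => ?_⟩
    refine (Real.rpow_le_rpow (posPart_nonneg _ _ _)
      (h2.2 (Set.mem_univ w) (Set.mem_univ w') ha hb hab) (by linarith)).trans ?_
    exact (convexOn_rpow hp.le).2 (posPart_nonneg _ _ _) (posPart_nonneg _ _ _) ha hb hab
  have h4 : ConvexOn ℝ Set.univ fun w : E × ℝ => w.2 :=
    (LinearMap.snd ℝ E ℝ).convexOn convex_univ
  have h5 := ((h3.smul (by positivity : 0 ≤ Q.c / z ^ (Q.p - 1))).add h4).add
    (convexOn_const (Q.κ * z) convex_univ)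
  refine (h5.add (h1.smul hl)).congr fun w _ => ?_
  simp only [Pi.add_apply, smul_eq_mul, lagS]

theorem sq_gradZ_sub {z : ℝ} (hz : 0 < z) (u : E × ℝ × ℝ) (s : Ξ) :
    (Q.gradZ z u s - Q.κ) ^ 2 =
      (Q.c * (Q.p - 1)) ^ 2 / z ^ (2 * Q.p) * Q.posPart u.1 u.2.1 s ^ (2 * Q.p) := by
  have hsq : ∀ b : ℝ, 0 ≤ b → b ^ (2 * Q.p) = (b ^ Q.p) ^ 2 := fun b hb => by
    rw [← Real.rpow_mul_natCast hb]; congr 1; push_cast; ring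
  rw [gradZ_eq, hsq z hz.le, hsq _ (posPart_nonneg _ _ _)]
  ring

variable [MeasurableSpace E]

theorem Standing.semidev_rpow (hQ : Q.Standing) (x : E) :
    Q.semidev x ^ Q.p = ∫ s, Q.posPart x (Q.f x) s ^ Q.p ∂Q.P := by
  have hp := hQ.one_lt_p
  rw [semidev_eq, ← Real.rpow_mul
    (integral_nonneg fun _ => Real.rpow_nonneg (Q.posPart_nonneg _ _ _) _),
    one_div_mul_cancel (by linarith), Real.rpow_one]

/-- Any value of the lifting variable gives an upper bound on the risk. -/
theorem Standing.rpow_inv_le (hQ : Q.Standing) {a z : ℝ} (ha : 0 ≤ a) (hz : 0 < z) :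
    Q.c * a ^ (1 / Q.p) ≤ Q.c / z ^ (Q.p - 1) * a + Q.κ * z := by
  have hp := hQ.one_lt_p
  have hc := hQ.c_pos
  have hp0 : 0 < Q.p := by linarith
  have hp1 : Q.p - 1 ≠ 0 := by linarith
  -- This `r` solves `p r^(p-1) = 1`; then `c (p-1) r^p` is the coefficient `κ` of `z`.
  have h := perspective_young hp (r := Q.p ^ (-1 / (Q.p - 1))) (a := a ^ (1 / Q.p)) (z := z)
    (Real.rpow_nonneg hp0.le _) (Real.rpow_nonneg ha _) (Or.inl hz)
  rw [← Real.rpow_mul hp0.le, ← Real.rpow_mul hp0.le, ← Real.rpow_mul ha,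
    one_div_mul_cancel hp0.ne', Real.rpow_one, div_mul_cancel₀ _ hp1, Real.rpow_neg_one,
    mul_inv_cancel₀ hp0.ne', one_mul] at h
  have h2 := mul_le_mul_of_nonneg_left h hc.le
  refine h2.trans (le_of_eq ?_)
  rw [κ, show -1 / (Q.p - 1) * Q.p = -Q.p / (Q.p - 1) by ring]
  ring

variable [BorelSpace E] [FiniteDimensional ℝ E]

theorem Standing.memLp_gradU_apply (hQ : Q.Standing) (hM : Q.SemimomentBound)
    (hG : Q.SemidevLipschitz) {z : ℝ} (hz : 0 < z) {u : E × ℝ × ℝ} (hu : u ∈ Q.U)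
    (d : E × ℝ × ℝ) : MemLp (fun s => Q.gradU z u s d) 2 Q.P := by
  have hm0 : Measurable fun a : (E × ℝ × ℝ) × Ξ => Q.gradU z a.1 a.2 d :=
    hQ.measurable_gradU_apply z (d := fun _ => d) measurable_const
  have hs : Measurable fun s : Ξ => (u, s) := measurable_const.prodMk measurable_id
  have hm : Measurable fun s => Q.gradU z u s d := by
    simpa only [Function.comp_def] using hm0.comp hs
  rw [memLp_two_iff_integrable_sq hm.aestronglyMeasurable]
  refine ((hQ.integrable_gradSq_and_integral_le hM hG hz hu).1.mul_const (sqNorm d)).mono'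
    (hm.pow_const 2).aestronglyMeasurable (Filter.Eventually.of_forall fun s => ?_)
  rw [Real.norm_of_nonneg (sq_nonneg _)]
  exact sq_gradU_le z u s d

theorem Standing.integrable_gradU_apply (hQ : Q.Standing) (hM : Q.SemimomentBound)
    (hG : Q.SemidevLipschitz) {z : ℝ} (hz : 0 < z) {u : E × ℝ × ℝ} (hu : u ∈ Q.U)
    (d : E × ℝ × ℝ) : Integrable (fun s => Q.gradU z u s d) Q.P := by
  have := hQ.isProb
  exact (hQ.memLp_gradU_apply hM hG hz hu d).integrable (by norm_num)

theorem Standing.integral_sq_gradU_le (hQ : Q.Standing) (hM : Q.SemimomentBound)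
    (hG : Q.SemidevLipschitz) {z : ℝ} (hz : 0 < z) {u : E × ℝ × ℝ} (hu : u ∈ Q.U)
    (d : E × ℝ × ℝ) : ∫ s, Q.gradU z u s d ^ 2 ∂Q.P ≤ Q.Msq z * sqNorm d := by
  obtain ⟨h1, h2⟩ := hQ.integrable_gradSq_and_integral_le hM hG hz hu
  have hd : 0 ≤ sqNorm d := by unfold sqNorm; positivity
  refine (integral_mono (hQ.memLp_gradU_apply hM hG hz hu d).integrable_sq (h1.mul_const _)
    fun s => sq_gradU_le z u s d).trans ?_
  rw [integral_mul_const]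
  exact mul_le_mul_of_nonneg_right h2 hd

theorem Standing.integrable_posPart_rpow_p (hQ : Q.Standing) (hM : Q.SemimomentBound) {x : E}
    (hx : x ∈ Q.X) {y : ℝ} (hy : y ∈ Q.Y) : Integrable (fun s => Q.posPart x y s ^ Q.p) Q.P := by
  have hp := hQ.one_lt_p
  exact hQ.integrable_posPart_rpow hM hx hy (by linarith) (by linarith)

theorem Standing.integrable_gradZ (hQ : Q.Standing) (hM : Q.SemimomentBound) (z : ℝ)
    {u : E × ℝ × ℝ} (hu : u ∈ Q.U) : Integrable (Q.gradZ z u) Q.P := by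
  have := hQ.isProb
  exact ((hQ.integrable_posPart_rpow_p hM hu.1 hu.2.1).const_mul _).add (integrable_const _)

theorem Standing.meanZ_eq (hQ : Q.Standing) (hM : Q.SemimomentBound) (z : ℝ)
    {u : E × ℝ × ℝ} (hu : u ∈ Q.U) : Q.meanZ z u =
      -(Q.c * (Q.p - 1) / z ^ Q.p) * (∫ s, Q.posPart u.1 u.2.1 s ^ Q.p ∂Q.P) + Q.κ := by
  have := hQ.isProb
  simp only [meanZ, gradZ_eq]
  rw [integral_add ((hQ.integrable_posPart_rpow_p hM hu.1 hu.2.1).const_mul _)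
    (integrable_const _), integral_const_mul]
  simp

theorem Standing.meanZ_le (hQ : Q.Standing) (hM : Q.SemimomentBound) {z : ℝ} (hz : 0 < z)
    {u : E × ℝ × ℝ} (hu : u ∈ Q.U) : Q.meanZ z u ≤ Q.κ := by
  have hp := hQ.one_lt_p
  have hc := hQ.c_pos
  have hp1 : 0 < Q.p - 1 := by linarith
  have h1 : 0 ≤ ∫ s, Q.posPart u.1 u.2.1 s ^ Q.p ∂Q.P :=
    integral_nonneg fun s => Real.rpow_nonneg (posPart_nonneg _ _ _) _
  have h2 : 0 ≤ Q.c * (Q.p - 1) / z ^ Q.p := by positivity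
  rw [hQ.meanZ_eq hM z hu]
  nlinarith [mul_nonneg h2 h1]

theorem Standing.neg_meanZ_le (hQ : Q.Standing) (hM : Q.SemimomentBound) {z : ℝ} (hz : 0 < z)
    {u : E × ℝ × ℝ} (hu : u ∈ Q.U) : -Q.meanZ z u ≤
      Q.c * (Q.p - 1) / z ^ Q.p * ((2 : ℝ) ^ (Q.p - 1) * (Q.Mf ^ Q.p + (2 * Q.R) ^ Q.p)) := by
  have hp := hQ.one_lt_p
  have hc := hQ.c_pos
  have hp1 : 0 < Q.p - 1 := by linarith
  have h1 := hQ.integral_posPart_rpow_le hM hu.1 hu.2.1 hp.le (by linarith)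
  have h2 : 0 ≤ Q.c * (Q.p - 1) / z ^ Q.p := by positivity
  have h3 : 0 ≤ Q.κ := by unfold κ; positivity
  rw [hQ.meanZ_eq hM z hu]
  linarith [mul_le_mul_of_nonneg_left h1 h2]

theorem Standing.integrable_sq_gradZ_sub (hQ : Q.Standing) (hM : Q.SemimomentBound) {z : ℝ}
    (hz : 0 < z) {u : E × ℝ × ℝ} (hu : u ∈ Q.U) :
    Integrable (fun s => (Q.gradZ z u s - Q.κ) ^ 2) Q.P := by
  have hp := hQ.one_lt_p
  simp only [sq_gradZ_sub hz]
  exact (hQ.integrable_posPart_rpow hM hu.1 hu.2.1 (by linarith) le_rfl).const_mul _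

theorem Standing.integral_sq_gradZ_sub_le (hQ : Q.Standing) (hM : Q.SemimomentBound) {z : ℝ}
    (hz : 0 < z) {u : E × ℝ × ℝ} (hu : u ∈ Q.U) :
    ∫ s, (Q.gradZ z u s - Q.κ) ^ 2 ∂Q.P ≤ (Q.c * (Q.p - 1)) ^ 2 / z ^ (2 * Q.p) *
      ((2 : ℝ) ^ (2 * Q.p - 1) * (Q.Mf ^ (2 * Q.p) + (2 * Q.R) ^ (2 * Q.p))) := by
  have hp := hQ.one_lt_p
  simp only [sq_gradZ_sub hz]
  rw [integral_const_mul]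
  exact mul_le_mul_of_nonneg_left
    (hQ.integral_posPart_rpow_le hM hu.1 hu.2.1 (by linarith) le_rfl) (by positivity)

theorem Standing.integrable_lagS (hQ : Q.Standing) (hM : Q.SemimomentBound) {x : E}
    (hx : x ∈ Q.X) {y : ℝ} (hy : y ∈ Q.Y) (z l : ℝ) : Integrable (Q.lagS x y z l) Q.P := by
  have := hQ.isProb
  exact (((((hQ.integrable_posPart_rpow_p hM hx hy).const_mul _).add (integrable_const _)).add
    (integrable_const _)).add (((hQ.integrable_F hx).sub (integrable_const _)).const_mul _))

theorem Standing.lag_eq (hQ : Q.Standing) (hM : Q.SemimomentBound) {x : E}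
    (hx : x ∈ Q.X) {y : ℝ} (hy : y ∈ Q.Y) (z l : ℝ) : Q.lag x y z l =
      Q.c / z ^ (Q.p - 1) * (∫ s, Q.posPart x y s ^ Q.p ∂Q.P) + y + Q.κ * z + l * (Q.f x - y) := by
  have := hQ.isProb
  have i1 := (hQ.integrable_posPart_rpow_p hM hx hy).const_mul (Q.c / z ^ (Q.p - 1))
  have i2 : Integrable (fun s => Q.c / z ^ (Q.p - 1) * Q.posPart x y s ^ Q.p + y) Q.P :=
    i1.add (integrable_const y)
  have i3 : Integrable (fun s => Q.c / z ^ (Q.p - 1) * Q.posPart x y s ^ Q.p + y + Q.κ * z) Q.P :=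
    i2.add (integrable_const (Q.κ * z))
  have i5 : Integrable (fun s => Q.F x s - y) Q.P := (hQ.integrable_F hx).sub (integrable_const y)
  simp only [lag, lagS]
  rw [integral_add i3 (i5.const_mul l), integral_add i2 (integrable_const _),
    integral_add i1 (integrable_const _), integral_const_mul, integral_const_mul,
    integral_const_mul, integral_sub (hQ.integrable_F hx) (integrable_const _)]
  simp [f]

/-- Expectation of `lagS_subgradient`. The Lagrangian is affine in the multiplier, so exchanging
`u.2.2` for `l` on the left costs exactly the `gradΛ` term contained in `gradU`. -/
theorem Standing.lag_sub_lag_le (hQ : Q.Standing) (hM : Q.SemimomentBound)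
    (hG : Q.SemidevLipschitz) {z : ℝ} (hz : 0 < z) {u : E × ℝ × ℝ} (hu : u ∈ Q.U) {x : E}
    (hx : x ∈ Q.X) {y : ℝ} (hy : y ∈ Q.Y) (l : ℝ) {z' : ℝ}
    (hz' : 0 < z' ∨ z' = 0 ∧ ∀ᵐ s ∂Q.P, Q.posPart x y s = 0) :
    Q.lag u.1 u.2.1 z l - Q.lag x y z' u.2.2 ≤
      Q.meanU z u (u - (x, y, l)) + Q.meanZ z u * (z - z') := by
  have i1 := hQ.integrable_lagS hM hu.1 hu.2.1 z l
  have i2 := hQ.integrable_lagS hM hx hy z' u.2.2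
  have i3 := hQ.integrable_gradU_apply hM hG hz hu (u - (x, y, l))
  have i4 := (hQ.integrable_gradZ hM z hu).mul_const (z - z')
  rw [lag, lag, meanU, meanZ, ← integral_mul_const, ← integral_sub i1 i2, ← integral_add i3 i4]
  refine integral_mono_ae (i1.sub i2) (i3.add i4) ?_
  have hae : ∀ᵐ s ∂Q.P, 0 < z' ∨ z' = 0 ∧ Q.posPart x y s = 0 := by
    rcases hz' with h | ⟨h, h'⟩
    · exact Filter.Eventually.of_forall fun _ => Or.inl h
    · filter_upwards [h'] with s hs using Or.inr ⟨h, hs⟩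
  filter_upwards [hae] with s hs
  have h := hQ.lagS_subgradient hz hu.1 hu.2.2.1 hx s hs
  have e1 : Q.gradU z u s (u - (x, y, l)) = -(Q.gradX z u s (x - u.1))
      - Q.gradY z u s * (y - u.2.1) - Q.gradΛ u s * (u.2.2 - l) := by
    rw [gradU_apply, ← map_neg]; simp only [Prod.fst_sub, Prod.snd_sub, neg_sub]; ring
  have e2 : Q.lagS u.1 u.2.1 z l s = Q.lagS u.1 u.2.1 z u.2.2 s - Q.gradΛ u s * (u.2.2 - l) := by
    simp only [lagS, gradΛ]; ring
  rw [e1, e2]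
  linarith

theorem Standing.lag_sum_le (hQ : Q.Standing) (hM : Q.SemimomentBound) {z l : ℝ} (hz : 0 < z)
    (hl : 0 ≤ l) {ι : Type*} (t : Finset ι) {w : ι → ℝ} (hw : ∀ i ∈ t, 0 ≤ w i)
    (hw1 : ∑ i ∈ t, w i = 1) {x : ι → E} {y : ι → ℝ} (hx : ∀ i ∈ t, x i ∈ Q.X)
    (hy : ∀ i ∈ t, y i ∈ Q.Y) :
    Q.lag (∑ i ∈ t, w i • x i) (∑ i ∈ t, w i * y i) z l ≤
      ∑ i ∈ t, w i * Q.lag (x i) (y i) z l := by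
  have hxm := hQ.convex_X.sum_mem hw hw1 hx
  have hym : ∑ i ∈ t, w i * y i ∈ Q.Y := by
    simpa using (convex_Y (Q := Q)).sum_mem hw hw1 hy
  simp only [lag]
  simp_rw [← integral_const_mul]
  rw [← integral_finsetSum _ fun i hi =>
    (hQ.integrable_lagS hM (hx i hi) (hy i hi) z l).const_mul (w i)]
  refine integral_mono (hQ.integrable_lagS hM hxm hym z l) (integrable_finsetSum _ fun i hi =>
    (hQ.integrable_lagS hM (hx i hi) (hy i hi) z l).const_mul (w i)) fun s => ?_
  have h := (hQ.convexOn_lagS hz hl s).map_sum_le (p := fun i => (x i, y i)) hw hw1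
    fun _ _ => Set.mem_univ _
  simpa [Prod.fst_sum, Prod.snd_sum] using h

/-- This makes `z' = 0` an admissible comparator when `z* = 0`. -/
theorem Standing.posPart_ae_eq_zero (hQ : Q.Standing) (hM : Q.SemimomentBound) {x : E}
    (hx : x ∈ Q.X) (h0 : Q.semidev x = 0) : ∀ᵐ s ∂Q.P, Q.posPart x (Q.f x) s = 0 := by
  have hp := hQ.one_lt_p
  have h := hQ.semidev_rpow x
  rw [h0, Real.zero_rpow (by linarith)] at h
  have h1 := (integral_eq_zero_iff_of_nonneg
    (fun s => Real.rpow_nonneg (Q.posPart_nonneg x (Q.f x) s) Q.p)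
    (hQ.integrable_posPart_rpow_p hM hx (hQ.mean_mem_Y x hx))).1 h.symm
  filter_upwards [h1] with s hs
  exact (Real.rpow_eq_zero (posPart_nonneg _ _ _) (by linarith)).1 hs

theorem Standing.semidev_le (hQ : Q.Standing) (hM : Q.SemimomentBound) {x : E}
    (hx : x ∈ Q.X) : Q.semidev x ≤ Q.Mf := by
  have hp := hQ.one_lt_p
  have h := hQ.integral_excess_rpow_le hM hx (r := Q.p) (by linarith) (by linarith)
  rw [← hQ.semidev_rpow] at h
  exact (Real.rpow_le_rpow_iff (semidev_nonneg x) hM.Mf_nonneg (by linarith)).1 h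

theorem Standing.zstar_mem (hQ : Q.Standing) (hM : Q.SemimomentBound) {x : E}
    (hx : x ∈ Q.X) : Q.zstar x ∈ Set.Icc 0 (Q.p ^ (1 / (Q.p - 1)) * Q.Mf) := by
  have hp := hQ.one_lt_p
  have h0 : 0 ≤ Q.p ^ (1 / (Q.p - 1)) := Real.rpow_nonneg (by linarith) _
  exact ⟨mul_nonneg h0 (semidev_nonneg x), mul_le_mul_of_nonneg_left (hQ.semidev_le hM hx) h0⟩

/-- The lifting variable `z*` recovers the risk objective. -/
theorem Standing.lag_zstar (hQ : Q.Standing) (hM : Q.SemimomentBound) {x : E}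
    (hx : x ∈ Q.X) (l : ℝ) : Q.lag x (Q.f x) (Q.zstar x) l = Q.h x := by
  have hp := hQ.one_lt_p
  have hp0 : 0 < Q.p := by linarith
  have hp1 : Q.p - 1 ≠ 0 := by linarith
  rw [hQ.lag_eq hM hx (hQ.mean_mem_Y x hx), ← hQ.semidev_rpow, h, sub_self, mul_zero, add_zero]
  set S := Q.semidev x with hS
  have hS0 : 0 ≤ S := semidev_nonneg x
  rcases hS0.eq_or_lt with h0 | h0
  -- At `z* = 0` the quotient is multiplied by `0 ^ p = 0`, so its value at a zero denominator is
  -- irrelevant.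
  · have hz : Q.zstar x = 0 := by rw [zstar, ← hS, ← h0, mul_zero]
    rw [hz, ← h0, Real.zero_rpow (by linarith)]; ring
  · have hq : (Q.p ^ (1 / (Q.p - 1))) ^ (Q.p - 1) = Q.p := by
      rw [← Real.rpow_mul hp0.le, one_div_mul_cancel hp1, Real.rpow_one]
    have e1 : Q.zstar x ^ (Q.p - 1) = Q.p * S ^ (Q.p - 1) := by
      rw [zstar, Real.mul_rpow (Real.rpow_nonneg hp0.le _) hS0, hq]
    have e2 : Q.κ * Q.zstar x = Q.c * (Q.p - 1) / Q.p * S := by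
      rw [κ, zstar, ← hS]
      have : Q.p ^ (-Q.p / (Q.p - 1)) * Q.p ^ (1 / (Q.p - 1)) = 1 / Q.p := by
        rw [← Real.rpow_add hp0, ← add_div, show -Q.p + 1 = -(Q.p - 1) by ring, neg_div,
          div_self hp1, Real.rpow_neg_one, one_div]
      calc _ = Q.c * (Q.p - 1) * (Q.p ^ (-Q.p / (Q.p - 1)) * Q.p ^ (1 / (Q.p - 1))) * S := by ring
        _ = _ := by rw [this]; ring
    rw [e1, e2, rpow_eq_mul_rpow_sub_one hS0 hp]
    have := (Real.rpow_pos_of_pos h0 (Q.p - 1)).ne'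
    field_simp
    ring

/-- Minkowski's inequality in `L^p`: lowering the reference level from `y` to the mean raises the
excess by at most the constant `y - f(x)`. -/
theorem Standing.semidev_le_add (hQ : Q.Standing) (hM : Q.SemimomentBound) {x : E}
    (hx : x ∈ Q.X) {y : ℝ} (hy : y ∈ Q.Y) (hyf : Q.f x ≤ y) :
    Q.semidev x ≤ (∫ s, Q.posPart x y s ^ Q.p ∂Q.P) ^ (1 / Q.p) + (y - Q.f x) := by
  have := hQ.isProb
  have hp := hQ.one_lt_p
  have hp0 : 0 < Q.p := by linarith
  set P' : ENNReal := ENNReal.ofReal Q.p with hP'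
  have hP0 : P' ≠ 0 := by simp [hP', hp0]
  have hPt : P' ≠ ⊤ := ENNReal.ofReal_ne_top
  have hPr : P'.toReal = Q.p := ENNReal.toReal_ofReal hp0.le
  have hm : ∀ y, AEStronglyMeasurable (fun s => Q.posPart x y s) Q.P :=
    fun y => (hQ.measurable_posPart_right x y).aestronglyMeasurable
  have hlp : ∀ y, lpNorm (fun s => Q.posPart x y s) P' Q.P =
      (∫ s, Q.posPart x y s ^ Q.p ∂Q.P) ^ (1 / Q.p) := fun y => by
    rw [lpNorm_eq_integral_norm_rpow_toReal hP0 hPt (hm y), hPr, one_div]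
    simp only [Real.norm_of_nonneg (Q.posPart_nonneg _ _ _)]
  have hmem : MemLp (fun s => Q.posPart x y s) P' Q.P := by
    rw [← integrable_norm_rpow_iff (hm y) hP0 hPt, hPr]
    simp only [Real.norm_of_nonneg (Q.posPart_nonneg _ _ _)]
    exact hQ.integrable_posPart_rpow_p hM hx hy
  have hadd := lpNorm_add_le (g := fun _ : Ξ => y - Q.f x) hmem
    (ENNReal.one_le_ofReal.2 hp.le)
  rw [lpNorm_const' hP0 hPt] at hadd
  rw [hlp y] at hadd
  simp only [probReal_univ, Real.one_rpow, mul_one, Real.norm_of_nonneg (sub_nonneg.2 hyf)]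
    at hadd
  refine le_trans ?_ hadd
  rw [semidev_eq, ← hlp]
  refine lpNorm_mono_real (hmem.add (memLp_const (y - Q.f x))) fun s => ?_
  rw [Real.norm_of_nonneg (posPart_nonneg _ _ _)]
  have h1 : Q.F x s - y ≤ Q.posPart x y s := le_max_left _ _
  have h2 := Q.posPart_nonneg x y s
  exact max_le (by simp only [Pi.add_apply]; linarith) (by simp only [Pi.add_apply]; linarith)

/-- The primal function of the lifted saddle point problem majorizes the risk objective. -/
theorem Standing.h_le_lag (hQ : Q.Standing) (hM : Q.SemimomentBound) {x : E}
    (hx : x ∈ Q.X) {y : ℝ} (hy : y ∈ Q.Y) {z : ℝ} (hz : 0 < z) :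
    Q.h x ≤ Q.lag x y z 0 ∨ Q.h x ≤ Q.lag x y z 1 := by
  have hp := hQ.one_lt_p
  have hc := hQ.c_pos
  have ha : 0 ≤ ∫ s, Q.posPart x y s ^ Q.p ∂Q.P :=
    integral_nonneg fun _ => Real.rpow_nonneg (posPart_nonneg _ _ _) _
  have h1 := hQ.rpow_inv_le ha hz
  rw [hQ.lag_eq hM hx hy, hQ.lag_eq hM hx hy, h]
  rcases le_total (Q.f x) y with hle | hle
  -- If `y` overestimates the mean, multiplier 0 suffices: the term `y` pays for the larger
  -- semideviation because `c ≤ 1`.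
  · left
    have h2 := hQ.semidev_le_add hM hx hy hle
    have h3 := mul_le_mul_of_nonneg_left h2 hc.le
    have h4 : Q.c * (y - Q.f x) ≤ y - Q.f x :=
      mul_le_of_le_one_left (sub_nonneg.2 hle) hQ.c_le_one
    linarith
  -- If `y` underestimates the mean, multiplier 1 replaces `y` by `f(x)`, and the excess over `y`
  -- dominates the excess over the mean.
  · right
    have h2 : Q.semidev x ≤ (∫ s, Q.posPart x y s ^ Q.p ∂Q.P) ^ (1 / Q.p) := by
      rw [semidev_eq]
      refine Real.rpow_le_rpow
        (integral_nonneg fun _ => Real.rpow_nonneg (posPart_nonneg _ _ _) _)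
        (integral_mono (hQ.integrable_posPart_rpow_p hM hx (hQ.mean_mem_Y x hx))
          (hQ.integrable_posPart_rpow_p hM hx hy) fun s => ?_) (by positivity)
      exact Real.rpow_le_rpow (posPart_nonneg _ _ _)
        (max_le_max (by linarith) le_rfl) (by linarith)
    have h3 := mul_le_mul_of_nonneg_left h2 hc.le
    linarith

end Problem

/-! ### Fresh samples and martingale differences. -/

section Sampling

variable {ι A Ξ Ω : Type*} [MeasurableSpace Ξ]

/-- The σ-algebra generated by the samples with index in `I`. -/
abbrev sampleSigma (S : ι → Ω → Ξ) (I : Set ι) : MeasurableSpace Ω :=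
  ⨆ i ∈ I, MeasurableSpace.comap (S i) inferInstance

theorem sampleSigma_mono (S : ι → Ω → Ξ) {I J : Set ι} (h : I ⊆ J) :
    sampleSigma S I ≤ sampleSigma S J := biSup_mono fun _ hi => h hi

theorem measurable_sampleSigma (S : ι → Ω → Ξ) {I : Set ι} {i : ι} (hi : i ∈ I) :
    Measurable[sampleSigma S I] (S i) :=
  Measurable.mono (comap_measurable (S i)) (le_biSup (fun i => MeasurableSpace.comap (S i) _) hi)
    le_rfl

theorem centered_moments {P : Measure Ξ} [IsProbabilityMeasure P] {φ : Ξ → ℝ} (hφ : MemLp φ 2 P) {C : ℝ} (hC : ∫ s, φ s ^ 2 ∂P ≤ C) :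
    ∫ s, (φ s - ∫ s', φ s' ∂P) ∂P = 0 ∧ Integrable (fun s => (φ s - ∫ s', φ s' ∂P) ^ 2) P ∧
      ∫ s, (φ s - ∫ s', φ s' ∂P) ^ 2 ∂P ≤ C := by
  have hi : Integrable φ P := hφ.integrable (by norm_num)
  set b := ∫ s, φ s ∂P with hb
  have hi2 : Integrable (fun s => φ s ^ 2) P := hφ.integrable_sq
  have hexp : ∀ s, (φ s - b) ^ 2 = φ s ^ 2 - 2 * b * φ s + b ^ 2 := fun s => by ring
  refine ⟨?_, ?_, ?_⟩
  · rw [integral_sub hi (integrable_const _)]; simp [hb]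
  · simp only [hexp]
    exact (hi2.sub (hi.const_mul _)).add (integrable_const _)
  · simp only [hexp]
    have h1 : Integrable (fun s => φ s ^ 2 - 2 * b * φ s) P := hi2.sub (hi.const_mul _)
    rw [integral_add h1 (integrable_const _), integral_sub hi2 (hi.const_mul _),
      integral_const_mul, ← hb]
    simp only [integral_const, probReal_univ, one_smul]
    nlinarith [sq_nonneg b]

variable [MeasurableSpace Ω] [MeasurableSpace A]

theorem sampleSigma_le {S : ι → Ω → Ξ} (hS : ∀ i, Measurable (S i)) (I : Set ι) :
    sampleSigma S I ≤ ‹MeasurableSpace Ω› := iSup₂_le fun i _ => (hS i).comap_le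

variable {μ : Measure Ω} {S : ι → Ω → Ξ}

theorem indep_sampleSigma (hS : ∀ i, Measurable (S i)) (hindep : iIndepFun S μ) {I J : Set ι}
    (hIJ : Disjoint I J) : Indep (sampleSigma S I) (sampleSigma S J) μ :=
  indep_iSup_of_disjoint (fun i => (hS i).comap_le) hindep hIJ

variable [IsProbabilityMeasure μ] {P : Measure Ξ}

/-- A quantity computed from samples outside `i` is independent of `S i`. The product law lets
Tonelli and Fubini replace conditional expectations in what follows. -/
theorem map_prodMk_sample (hS : ∀ i, Measurable (S i)) (hlaw : ∀ i, μ.map (S i) = P)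
    (hindep : iIndepFun S μ) {I : Set ι} {i : ι} (hi : i ∉ I) {w : Ω → A}
    (hw : Measurable[sampleSigma S I] w) :
    μ.map (fun ω => (w ω, S i ω)) = (μ.map w).prod P := by
  have hw' : Measurable w := hw.mono (sampleSigma_le hS I) le_rfl
  rw [← hlaw i, ← indepFun_iff_map_prod_eq_prod_map_map hw'.aemeasurable (hS i).aemeasurable]
  have h := indep_sampleSigma hS hindep (Set.disjoint_singleton_right.2 hi)
  refine indep_of_indep_of_le_left (indep_of_indep_of_le_right h ?_) hw.comap_le
  exact (measurable_sampleSigma S (Set.mem_singleton i)).comap_le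

variable [IsProbabilityMeasure P]

theorem integrable_fresh_sample (hS : ∀ i, Measurable (S i)) (hlaw : ∀ i, μ.map (S i) = P)
    (hindep : iIndepFun S μ) {I : Set ι} {i : ι} (hi : i ∉ I) {w : Ω → A}
    (hw : Measurable[sampleSigma S I] w) {G : Set A} (hG : ∀ ω, w ω ∈ G) {φ : A → Ξ → ℝ}
    (hφ : Measurable (Function.uncurry φ)) (h0 : ∀ a s, 0 ≤ φ a s)
    (hint : ∀ a ∈ G, Integrable (φ a) P) {C : ℝ} (hC : ∀ a ∈ G, ∫ s, φ a s ∂P ≤ C) :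
    Integrable (fun ω => φ (w ω) (S i ω)) μ ∧ ∫ ω, φ (w ω) (S i ω) ∂μ ≤ C := by
  have hw' : Measurable w := hw.mono (sampleSigma_le hS I) le_rfl
  have hpair : Measurable fun ω => (w ω, S i ω) := hw'.prodMk (hS i)
  have hm : Measurable fun ω => φ (w ω) (S i ω) := hφ.comp hpair
  have hφe : Measurable fun b : A × Ξ => ENNReal.ofReal (φ b.1 b.2) := hφ.ennreal_ofReal
  have hC0 : 0 ≤ C := by
    obtain ⟨ω⟩ := nonempty_of_isProbabilityMeasure μ
    exact (integral_nonneg (h0 (w ω))).trans (hC _ (hG ω))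
  have key : ∫⁻ ω, ENNReal.ofReal (φ (w ω) (S i ω)) ∂μ ≤ ENNReal.ofReal C := by
    calc ∫⁻ ω, ENNReal.ofReal (φ (w ω) (S i ω)) ∂μ
        = ∫⁻ b, ENNReal.ofReal (φ b.1 b.2) ∂(μ.map fun ω => (w ω, S i ω)) :=
          (lintegral_map hφe hpair).symm
      _ = ∫⁻ a, ∫⁻ s, ENNReal.ofReal (φ a s) ∂P ∂(μ.map w) := by
          rw [map_prodMk_sample hS hlaw hindep hi hw, lintegral_prod _ hφe.aemeasurable]
      _ = ∫⁻ ω, ∫⁻ s, ENNReal.ofReal (φ (w ω) s) ∂P ∂μ :=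
          lintegral_map hφe.lintegral_prod_right' hw'
      _ ≤ ∫⁻ _, ENNReal.ofReal C ∂μ := lintegral_mono fun ω => by
          rw [← ofReal_integral_eq_lintegral_ofReal (hint _ (hG ω))
            (Filter.Eventually.of_forall (h0 _))]
          exact ENNReal.ofReal_le_ofReal (hC _ (hG ω))
      _ = ENNReal.ofReal C := by simp
  have hi : Integrable (fun ω => φ (w ω) (S i ω)) μ := by
    refine ⟨hm.aestronglyMeasurable, ?_⟩
    rw [hasFiniteIntegral_iff_ofReal (Filter.Eventually.of_forall fun ω => h0 _ _)]
    exact key.trans_lt ENNReal.ofReal_lt_top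
  refine ⟨hi, ?_⟩
  rw [← ofReal_integral_eq_lintegral_ofReal hi (Filter.Eventually.of_forall fun ω => h0 _ _)] at key
  exact (ENNReal.ofReal_le_ofReal_iff hC0).1 key

theorem integral_fresh_sample_eq_zero (hS : ∀ i, Measurable (S i)) (hlaw : ∀ i, μ.map (S i) = P)
    (hindep : iIndepFun S μ) {I : Set ι} {i : ι} (hi : i ∉ I) {w : Ω → A}
    (hw : Measurable[sampleSigma S I] w) {φ : A → Ξ → ℝ}
    (hφ : Measurable (Function.uncurry φ)) (hint : Integrable (fun ω => φ (w ω) (S i ω)) μ)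
    (h0 : ∀ ω, ∫ s, φ (w ω) s ∂P = 0) : ∫ ω, φ (w ω) (S i ω) ∂μ = 0 := by
  have hw' : Measurable w := hw.mono (sampleSigma_le hS I) le_rfl
  have hpair : Measurable fun ω => (w ω, S i ω) := hw'.prodMk (hS i)
  have hmap := map_prodMk_sample hS hlaw hindep hi hw
  have hint' : Integrable (Function.uncurry φ) ((μ.map w).prod P) := by
    rw [← hmap]
    exact (integrable_map_measure hφ.aestronglyMeasurable hpair.aemeasurable).2 hint
  calc ∫ ω, φ (w ω) (S i ω) ∂μ = ∫ b, Function.uncurry φ b ∂(μ.map fun ω => (w ω, S i ω)) :=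
        (integral_map hpair.aemeasurable hφ.aestronglyMeasurable).symm
    _ = ∫ a, ∫ s, φ a s ∂P ∂(μ.map w) := by rw [hmap, integral_prod _ hint']; rfl
    _ = ∫ ω, ∫ s, φ (w ω) s ∂P ∂μ := integral_map hw'.aemeasurable
        (StronglyMeasurable.integral_prod_right hφ.stronglyMeasurable).aestronglyMeasurable
    _ = 0 := by simp [h0]

/-- Second moment of a sum of martingale differences. -/
theorem sum_centered_fresh_samples (hS : ∀ i, Measurable (S i)) (hlaw : ∀ i, μ.map (S i) = P)
    (hindep : iIndepFun S μ) {I : ℕ → Set ι} {i : ℕ → ι} (hi : ∀ t, i t ∉ I t)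
    (hI : ∀ t, I t ⊆ I (t + 1)) (hi' : ∀ t, i t ∈ I (t + 1)) {w : ℕ → Ω → A}
    (hw : ∀ t, Measurable[sampleSigma S (I t)] (w t)) {G : Set A} (hG : ∀ t ω, w t ω ∈ G)
    {φ : A → Ξ → ℝ} (hφ : Measurable (Function.uncurry φ))
    (hint : ∀ a ∈ G, MemLp (φ a) 2 P) {C : ℝ} (hC : ∀ a ∈ G, ∫ s, φ a s ^ 2 ∂P ≤ C) (T : ℕ) :
    let M : Ω → ℝ := fun ω => ∑ t ∈ Finset.range T,
      (φ (w t ω) (S (i t) ω) - ∫ s, φ (w t ω) s ∂P)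
    Measurable[sampleSigma S (I T)] M ∧ Integrable (fun ω => M ω ^ 2) μ ∧
      ∫ ω, M ω ^ 2 ∂μ ≤ T * C := by
  set n : A → Ξ → ℝ := fun a s => φ a s - ∫ s', φ a s' ∂P with hn
  have hnm : Measurable (Function.uncurry n) := by
    have h1 : Measurable fun a => ∫ s, φ a s ∂P :=
      (StronglyMeasurable.integral_prod_right hφ.stronglyMeasurable).measurable
    exact hφ.sub (h1.comp measurable_fst)
  have hcm := fun a (ha : a ∈ G) => centered_moments (hint a ha) (hC a ha)
  show Measurable[sampleSigma S (I T)]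
      (fun ω => ∑ t ∈ Finset.range T, n (w t ω) (S (i t) ω)) ∧
    Integrable (fun ω => (∑ t ∈ Finset.range T, n (w t ω) (S (i t) ω)) ^ 2) μ ∧
    ∫ ω, (∑ t ∈ Finset.range T, n (w t ω) (S (i t) ω)) ^ 2 ∂μ ≤ T * C
  induction T with
  | zero => simp
  | succ t ih =>
    obtain ⟨h1, h2, h3⟩ := ih
    simp only [Finset.sum_range_succ]
    set M : Ω → ℝ := fun ω => ∑ t ∈ Finset.range t, n (w t ω) (S (i t) ω) with hM
    have hnt : Measurable[sampleSigma S (I (t + 1))] fun ω => n (w t ω) (S (i t) ω) :=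
      hnm.comp (((hw t).mono (sampleSigma_mono S (hI t)) le_rfl).prodMk
        (measurable_sampleSigma S (hi' t)))
    have hM1 : Measurable[sampleSigma S (I (t + 1))] M :=
      h1.mono (sampleSigma_mono S (hI t)) le_rfl
    have hle := sampleSigma_le hS (I (t + 1))
    have hMΩ : Measurable M := hM1.mono hle le_rfl
    have hnΩ : Measurable fun ω => n (w t ω) (S (i t) ω) := hnt.mono hle le_rfl
    obtain ⟨a1, a2⟩ := integrable_fresh_sample hS hlaw hindep (hi t) (hw t) (hG t)
      (φ := fun a s => n a s ^ 2) (hnm.pow_const 2) (fun a s => sq_nonneg _)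
      (fun a ha => (hcm a ha).2.1) (fun a ha => (hcm a ha).2.2)
    have hMn : Integrable (fun ω => M ω * n (w t ω) (S (i t) ω)) μ :=
      ((memLp_two_iff_integrable_sq hMΩ.aestronglyMeasurable).2 h2).integrable_mul
        ((memLp_two_iff_integrable_sq hnΩ.aestronglyMeasurable).2 a1)
    -- Orthogonality of martingale differences: the pair `(M, w t)` is known before the sample `i t`
    -- is drawn, and the increment has mean zero given it.
    have hz : ∫ ω, M ω * n (w t ω) (S (i t) ω) ∂μ = 0 := by
      refine integral_fresh_sample_eq_zero hS hlaw hindep (hi t) (w := fun ω => (M ω, w t ω))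
        (h1.prodMk (hw t)) (φ := fun b s => b.1 * n b.2 s) ?_ hMn fun ω => ?_
      · exact (measurable_fst.comp measurable_fst).mul
          (hnm.comp ((measurable_snd.comp measurable_fst).prodMk measurable_snd))
      · simp only [integral_const_mul]
        rw [(hcm _ (hG t ω)).1, mul_zero]
    have hexp : ∀ ω, (M ω + n (w t ω) (S (i t) ω)) ^ 2 =
        M ω ^ 2 + 2 * (M ω * n (w t ω) (S (i t) ω)) + n (w t ω) (S (i t) ω) ^ 2 :=
      fun ω => by ring
    have i1 : Integrable (fun ω => M ω ^ 2 + 2 * (M ω * n (w t ω) (S (i t) ω))) μ :=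
      h2.add (hMn.const_mul 2)
    refine ⟨hM1.add hnt, ?_, ?_⟩
    · show Integrable (fun ω => (M ω + n (w t ω) (S (i t) ω)) ^ 2) μ
      simp only [hexp]
      exact i1.add a1
    · show ∫ ω, (M ω + n (w t ω) (S (i t) ω)) ^ 2 ∂μ ≤ _
      simp only [hexp]
      rw [integral_add i1 a1, integral_add h2 (hMn.const_mul 2), integral_const_mul, hz]
      push_cast
      linarith

end Sampling

/-! ### Pathwise analysis of the inner method. -/

namespace Problem

variable {E Ξ : Type*} [NormedAddCommGroup E] [NormedSpace ℝ E] [MeasurableSpace Ξ]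
  {Q : Problem E Ξ}

/-- The `y`-part of the averaged output of stochastic mirror descent. -/
noncomputable def smdY (Q : Problem E Ξ) (D : Q.Prox) (z : ℝ) (T : ℕ) (g : ℝ) (ξ : ℕ → Ξ) : ℝ :=
  ∑ t ∈ Finset.range T, (T : ℝ)⁻¹ * (Q.smd D z (fun _ => g) ξ t).2.1

/-- The averaged expected derivative in `z`. -/
noncomputable def smdMeanZ (Q : Problem E Ξ) (D : Q.Prox) (z : ℝ) (T : ℕ) (g : ℝ) (ξ : ℕ → Ξ) :
    ℝ := ∑ t ∈ Finset.range T, (T : ℝ)⁻¹ * Q.meanZ z (Q.smd D z (fun _ => g) ξ t)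

/-- Accumulated oracle noise in the direction `d`. -/
noncomputable def noiseU (Q : Problem E Ξ) (D : Q.Prox) (z : ℝ) (T : ℕ) (g : ℝ)
    (d : E × ℝ × ℝ → E × ℝ × ℝ) (ξ : ℕ → Ξ) : ℝ :=
  ∑ t ∈ Finset.range T, (Q.gradU z (Q.smd D z (fun _ => g) ξ t) (ξ t)
    (d (Q.smd D z (fun _ => g) ξ t)) - Q.meanU z (Q.smd D z (fun _ => g) ξ t)
    (d (Q.smd D z (fun _ => g) ξ t)))

/-- Upper bound for the saddle point gap of the inner method against `(x, y)`. -/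
noncomputable def smdErr (Q : Problem E Ξ) (D : Q.Prox) (z : ℝ) (T : ℕ) (g : ℝ) (x : E) (y : ℝ)
    (ξ : ℕ → Ξ) : ℝ :=
  (g * T)⁻¹ * (2 * Q.DVsq
    + 1 / 2 * ∑ t ∈ Finset.range T, g ^ 2 * Q.gradSq z (Q.smd D z (fun _ => g) ξ t) (ξ t)
    + g ^ 2 / (2 * Q.DVsq) * (Q.noiseU D z T g (fun u => u - (x, y, 0)) ξ ^ 2
      + Q.noiseU D z T g (fun _ => (0, 0, 1)) ξ ^ 2))

theorem smdX_const (D : Q.Prox) (z : ℝ) {T : ℕ} {g : ℝ} (hg : 0 < g) (ξ : ℕ → Ξ) :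
    Q.smdX D z T (fun _ => g) ξ =
      ∑ t ∈ Finset.range T, (T : ℝ)⁻¹ • (Q.smd D z (fun _ => g) ξ t).1 := by
  rw [smdX, Finset.smul_sum]
  refine Finset.sum_congr rfl fun t _ => ?_
  rw [smul_smul]
  congr 1
  simp only [Finset.sum_const, Finset.card_range, nsmul_eq_mul]
  rw [mul_inv, mul_assoc, inv_mul_cancel₀ hg.ne', mul_one]

theorem smdζ_const (D : Q.Prox) (z : ℝ) {T : ℕ} {g : ℝ} (hg : 0 < g) (ξ ξ' : ℕ → Ξ) :
    Q.smdζ D z T (fun _ => g) ξ ξ' =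
      ∑ t ∈ Finset.range T, (T : ℝ)⁻¹ * Q.gradZ z (Q.smd D z (fun _ => g) ξ t) (ξ' t) := by
  rw [smdζ, Finset.mul_sum]
  refine Finset.sum_congr rfl fun t _ => ?_
  rw [← mul_assoc]
  congr 1
  simp only [Finset.sum_const, Finset.card_range, nsmul_eq_mul]
  rw [mul_inv, mul_assoc, inv_mul_cancel₀ hg.ne', mul_one]

theorem sum_range_inv {T : ℕ} (hT : 0 < T) : ∑ _t ∈ Finset.range T, (T : ℝ)⁻¹ = 1 := by
  rw [Finset.sum_const, Finset.card_range, nsmul_eq_mul, mul_inv_cancel₀ (by positivity)]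

theorem Prox.DVsq_pos (D : Q.Prox) : 0 < Q.DVsq := by
  have := D.half_le_DVsq
  linarith

theorem smdErr_nonneg (D : Q.Prox) (z : ℝ) (T : ℕ) {g : ℝ} (hg : 0 < g) (x : E) (y : ℝ)
    (ξ : ℕ → Ξ) : 0 ≤ Q.smdErr D z T g x y ξ := by
  have := D.DVsq_pos
  have : 0 ≤ ∑ t ∈ Finset.range T, g ^ 2 * Q.gradSq z (Q.smd D z (fun _ => g) ξ t) (ξ t) :=
    Finset.sum_nonneg fun t _ => mul_nonneg (sq_nonneg _) (gradSq_nonneg _ _ _)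
  unfold smdErr
  positivity

section Pathwise

variable [MeasurableSpace E]

theorem Standing.smdX_mem (hQ : Q.Standing) (D : Q.Prox) (z : ℝ) {T : ℕ} (hT : 0 < T) {g : ℝ}
    (hg : 0 < g) (ξ : ℕ → Ξ) : Q.smdX D z T (fun _ => g) ξ ∈ Q.X := by
  rw [smdX_const D z hg]
  exact hQ.convex_X.sum_mem (fun _ _ => by positivity) (sum_range_inv hT)
    fun t _ => (hQ.smd_mem D z _ ξ t).1

theorem Standing.smdY_mem (hQ : Q.Standing) (D : Q.Prox) (z : ℝ) {T : ℕ} (hT : 0 < T) (g : ℝ)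
    (ξ : ℕ → Ξ) : Q.smdY D z T g ξ ∈ Q.Y := by
  have h := (convex_Y (Q := Q)).sum_mem (t := Finset.range T) (w := fun _ => (T : ℝ)⁻¹)
    (fun _ _ => by positivity) (sum_range_inv hT)
    fun t _ => (hQ.smd_mem D z (fun _ => g) ξ t).2.1
  simpa [smdY] using h

theorem Standing.sum_inv_mul_le (hQ : Q.Standing) (D : Q.Prox) (z : ℝ) {T : ℕ} (hT : 0 < T)
    (g : ℝ) (ξ : ℕ → Ξ) {φ : E × ℝ × ℝ → ℝ} {C : ℝ} (h : ∀ u ∈ Q.U, φ u ≤ C) :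
    ∑ t ∈ Finset.range T, (T : ℝ)⁻¹ * φ (Q.smd D z (fun _ => g) ξ t) ≤ C := by
  refine (Finset.sum_le_sum fun t _ => mul_le_mul_of_nonneg_left
    (h _ (hQ.smd_mem D z (fun _ => g) ξ t)) (by positivity : 0 ≤ (T : ℝ)⁻¹)).trans ?_
  rw [← Finset.sum_mul, sum_range_inv hT, one_mul]

variable [BorelSpace E] [FiniteDimensional ℝ E]

/-- Regret bound plus noise. The noise in the direction `u - (x, y, l)` is affine in `l`, so it
splits into two sums not depending on `l`. The bound is thus uniform in the multiplier, which later
is 0 or 1 according to the random output. -/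
theorem Standing.sum_meanU_le (hQ : Q.Standing) (hM : Q.SemimomentBound)
    (hG : Q.SemidevLipschitz) (D : Q.Prox) {z : ℝ} (hz : 0 < z) {T : ℕ} (hT : 0 < T) {g : ℝ}
    (hg : 0 < g) (ξ : ℕ → Ξ) {x : E} (hx : x ∈ Q.X) {y : ℝ} (hy : y ∈ Q.Y) {l : ℝ} (hl0 : 0 ≤ l)
    (hl1 : l ≤ 1) :
    ∑ t ∈ Finset.range T, (T : ℝ)⁻¹ * Q.meanU z (Q.smd D z (fun _ => g) ξ t)
      (Q.smd D z (fun _ => g) ξ t - (x, y, l)) ≤ Q.smdErr D z T g x y ξ := by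
  have hD := D.DVsq_pos
  set u := Q.smd D z (fun _ => g) ξ with hu
  set N₁ := Q.noiseU D z T g (fun u => u - (x, y, 0)) ξ with hN₁
  set N₂ := Q.noiseU D z T g (fun _ => (0, 0, 1)) ξ with hN₂
  have hT' : (0 : ℝ) < T := Nat.cast_pos.2 hT
  have hreg := hQ.smd_regret D z (fun _ => g) ξ (w := (x, y, l)) ⟨hx, hy, hl0, hl1⟩ T
  have hdir : ∀ t, u t - (x, y, l) = (u t - (x, y, 0)) - l • ((0 : E), (0 : ℝ), (1 : ℝ)) := by
    intro t
    ext <;> simp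
  have hmean : ∀ t, Q.meanU z (u t) (u t - (x, y, l)) =
      Q.meanU z (u t) (u t - (x, y, 0)) - l * Q.meanU z (u t) (0, 0, 1) := by
    intro t
    have hi : ∀ d, Integrable (fun s => Q.gradU z (u t) s d) Q.P := fun d =>
      hQ.integrable_gradU_apply hM hG hz (hQ.smd_mem D z (fun _ => g) ξ t) d
    rw [hdir, meanU, meanU, meanU, ← integral_const_mul, ← integral_sub (hi _)
      ((hi _).const_mul l)]
    simp only [map_sub, map_smul, smul_eq_mul]
  have hsplit : ∑ t ∈ Finset.range T, Q.meanU z (u t) (u t - (x, y, l)) =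
      ∑ t ∈ Finset.range T, Q.gradU z (u t) (ξ t) (u t - (x, y, l)) - N₁ + l * N₂ := by
    rw [hN₁, hN₂, noiseU, noiseU, Finset.mul_sum, ← Finset.sum_sub_distrib,
      ← Finset.sum_add_distrib]
    refine Finset.sum_congr rfl fun t _ => ?_
    rw [hmean, hdir, map_sub, map_smul, smul_eq_mul]
    ring
  rw [← Finset.mul_sum] at hreg
  rw [← Finset.mul_sum, hsplit, smdErr, ← hN₁, ← hN₂, ← hu]
  set A := ∑ t ∈ Finset.range T, Q.gradU z (u t) (ξ t) (u t - (x, y, l)) with hA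
  set B := ∑ t ∈ Finset.range T, g ^ 2 * Q.gradSq z (u t) (ξ t) with hB
  have hreg' : g * A ≤ Q.DVsq + 1 / 2 * B := hreg
  -- Each of the two linear noise terms costs `D_V² / 2` plus a square. Together with the regret
  -- this gives the `2 * DVsq` in `smdErr`, and it makes that error nonnegative, as Markov's
  -- inequality requires.
  have hamgm : ∀ a : ℝ, a ≤ Q.DVsq / 2 + a ^ 2 / (2 * Q.DVsq) := fun a => by
    rw [div_add_div _ _ two_ne_zero (by positivity), le_div_iff₀ (by positivity)]
    nlinarith [sq_nonneg (a - Q.DVsq)]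
  have h1 := hamgm (-(g * N₁))
  have h2 := hamgm (l * (g * N₂))
  have h3 : (l * (g * N₂)) ^ 2 / (2 * Q.DVsq) ≤ (g * N₂) ^ 2 / (2 * Q.DVsq) := by
    refine div_le_div_of_nonneg_right ?_ (by positivity)
    rw [mul_pow]
    exact mul_le_of_le_one_left (sq_nonneg _) (pow_le_one₀ hl0 hl1)
  have h4 : g * (A - N₁ + l * N₂) ≤ 2 * Q.DVsq + 1 / 2 * B
      + g ^ 2 / (2 * Q.DVsq) * (N₁ ^ 2 + N₂ ^ 2) := by
    have e : g ^ 2 / (2 * Q.DVsq) * (N₁ ^ 2 + N₂ ^ 2) =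
        (-(g * N₁)) ^ 2 / (2 * Q.DVsq) + (g * N₂) ^ 2 / (2 * Q.DVsq) := by ring
    rw [e]; linarith
  have h5 := mul_le_mul_of_nonneg_left h4 (by positivity : 0 ≤ (g * T)⁻¹)
  refine le_trans (le_of_eq ?_) h5
  field_simp

/-- Pathwise bound for the primal gap of the inner method. -/
theorem Standing.lag_smd_le (hQ : Q.Standing) (hM : Q.SemimomentBound)
    (hG : Q.SemidevLipschitz) (D : Q.Prox) {z : ℝ} (hz : 0 < z) {T : ℕ} (hT : 0 < T) {g : ℝ}
    (hg : 0 < g) (ξ : ℕ → Ξ) {x : E} (hx : x ∈ Q.X) {y : ℝ} (hy : y ∈ Q.Y) {l : ℝ} (hl0 : 0 ≤ l)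
    (hl1 : l ≤ 1) {z' : ℝ} (hz' : 0 < z' ∨ z' = 0 ∧ ∀ᵐ s ∂Q.P, Q.posPart x y s = 0) {C : ℝ}
    (hC : ∀ l' ∈ Set.Icc (0 : ℝ) 1, Q.lag x y z' l' ≤ C) :
    Q.lag (Q.smdX D z T (fun _ => g) ξ) (Q.smdY D z T g ξ) z l ≤
      C + Q.smdErr D z T g x y ξ + Q.smdMeanZ D z T g ξ * (z - z') := by
  have h1 := hQ.lag_sum_le hM hz hl0 (Finset.range T) (w := fun _ => (T : ℝ)⁻¹)
    (fun _ _ => by positivity) (sum_range_inv hT)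
    (x := fun t => (Q.smd D z (fun _ => g) ξ t).1) (y := fun t => (Q.smd D z (fun _ => g) ξ t).2.1)
    (fun t _ => (hQ.smd_mem D z (fun _ => g) ξ t).1)
    (fun t _ => (hQ.smd_mem D z (fun _ => g) ξ t).2.1)
  have h2 : ∑ t ∈ Finset.range T, (T : ℝ)⁻¹ *
      Q.lag (Q.smd D z (fun _ => g) ξ t).1 (Q.smd D z (fun _ => g) ξ t).2.1 z l ≤
      ∑ t ∈ Finset.range T, (T : ℝ)⁻¹ * (C
        + Q.meanU z (Q.smd D z (fun _ => g) ξ t) (Q.smd D z (fun _ => g) ξ t - (x, y, l))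
        + Q.meanZ z (Q.smd D z (fun _ => g) ξ t) * (z - z')) := by
    refine Finset.sum_le_sum fun t _ => mul_le_mul_of_nonneg_left ?_ (by positivity)
    have hu := hQ.smd_mem D z (fun _ => g) ξ t
    have := hQ.lag_sub_lag_le hM hG hz hu hx hy l hz'
    have := hC _ hu.2.2
    linarith
  have h3 := hQ.sum_meanU_le hM hG D hz hT hg ξ hx hy hl0 hl1
  rw [smdX_const D z hg, smdY]
  refine (h1.trans h2).trans ?_
  simp only [mul_add, Finset.sum_add_distrib]
  rw [← Finset.sum_mul, sum_range_inv hT, one_mul, smdMeanZ, Finset.sum_mul]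
  simp only [mul_assoc] at h3 ⊢
  linarith

end Pathwise

end Problem

/-! ### Measurability and moments of a run of the inner method. -/

/-- The samples of kind `b` used in outer iteration `k`. -/
def samplePath {Ω Ξ : Type*} (S : ℕ × ℕ × Bool → Ω → Ξ) (k : ℕ) (b : Bool) (ω : Ω) : ℕ → Ξ :=
  fun t => S (k, t, b) ω

/-- Indices of the samples drawn before step `t` of outer iteration `k`, within that iteration. -/
def stepIdx (k t : ℕ) : Set (ℕ × ℕ × Bool) := {i | i.1 = k ∧ i.2.1 < t}

/-- Indices of the samples of outer iteration `k`. -/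
def iterIdx (k : ℕ) : Set (ℕ × ℕ × Bool) := {i | i.1 = k}

theorem stepIdx_subset_iterIdx (k t : ℕ) : stepIdx k t ⊆ iterIdx k := fun _ hi => hi.1

theorem stepIdx_subset_succ (k t : ℕ) : stepIdx k t ⊆ stepIdx k (t + 1) :=
  fun _ hi => ⟨hi.1, hi.2.trans (Nat.lt_succ_self t)⟩

theorem notMem_stepIdx (k t : ℕ) (b : Bool) : (k, t, b) ∉ stepIdx k t := fun h => lt_irrefl t h.2

theorem mem_stepIdx_succ (k t : ℕ) (b : Bool) : (k, t, b) ∈ stepIdx k (t + 1) :=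
  ⟨rfl, Nat.lt_succ_self t⟩

theorem DistGen.continuousOn_grad {E : Type*} [NormedAddCommGroup E] [NormedSpace ℝ E] {S : Set E}
    {L : ℝ} (d : DistGen S L) : ContinuousOn d.grad S := by
  have h : LipschitzOnWith L.toNNReal d.grad S := LipschitzOnWith.of_dist_le_mul fun x hx y hy => by
    rw [dist_eq_norm, dist_eq_norm]
    exact (d.lipschitz x hx y hy).trans
      (mul_le_mul_of_nonneg_right (Real.le_coe_toNNReal L) (norm_nonneg _))
  exact h.continuousOn

/-- The gradient is continuous on `S` only and arbitrary elsewhere, so `w` is factored through the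
subtype `S`. -/
theorem DistGen.measurable_grad_comp {E Ω : Type*} [NormedAddCommGroup E] [NormedSpace ℝ E]
    [MeasurableSpace E] [BorelSpace E] {S : Set E} {L : ℝ} (d : DistGen S L) {m : MeasurableSpace Ω}
    {w : Ω → E} (hw : Measurable w) (hS : ∀ ω, w ω ∈ S) : Measurable fun ω => d.grad (w ω) := by
  have h1 : Continuous (S.domRestrict d.grad) := d.continuousOn_grad.domRestrict
  exact h1.measurable.comp (hw.subtype_mk (h := hS))

namespace Problem

variable {E Ξ : Type*} [NormedAddCommGroup E] [NormedSpace ℝ E] [MeasurableSpace Ξ]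
  {Q : Problem E Ξ}

theorem continuous_coprod₃ : Continuous fun b : StrongDual ℝ E × StrongDual ℝ ℝ × StrongDual ℝ ℝ =>
    b.1.coprod (b.2.1.coprod b.2.2) := by
  have h : (fun b : StrongDual ℝ E × StrongDual ℝ ℝ × StrongDual ℝ ℝ =>
      b.1.coprod (b.2.1.coprod b.2.2)) = fun b =>
      b.1.comp (ContinuousLinearMap.fst ℝ E (ℝ × ℝ)) +
        (b.2.1.comp (ContinuousLinearMap.fst ℝ ℝ ℝ) +
          b.2.2.comp (ContinuousLinearMap.snd ℝ ℝ ℝ)).comp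
            (ContinuousLinearMap.snd ℝ E (ℝ × ℝ)) := by
    funext b
    ext <;> simp
  rw [h]
  fun_prop

variable [MeasurableSpace E] [BorelSpace E] [FiniteDimensional ℝ E]

theorem Standing.measurable_smd_step (hQ : Q.Standing) (D : Q.Prox) {Ω : Type*}
    {m : MeasurableSpace Ω} (z g : ℝ) {u : Ω → E × ℝ × ℝ} (hu : Measurable u)
    (hU : ∀ ω, u ω ∈ Q.U) {ξ : Ω → Ξ} (hξ : Measurable ξ) :
    Measurable fun ω => hQ.prox D (g • Q.gradU z (u ω) (ξ ω) - D.grad (u ω)) := by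
  have := secondCountableTopology_of_finiteDimensional E
  have := secondCountableTopology_of_finiteDimensional (StrongDual ℝ E)
  have := secondCountableTopology_of_finiteDimensional (StrongDual ℝ ℝ)
  have := secondCountableTopology_of_finiteDimensional (StrongDual ℝ (E × ℝ × ℝ))
  have hp : Measurable fun ω => (u ω, ξ ω) := hu.prodMk hξ
  have h1 : Measurable fun ω => Q.gradX z (u ω) (ξ ω) := by
    simpa only [Function.comp_def] using (hQ.measurable_gradX z).comp hp
  have h2 : Measurable fun ω => Q.gradY z (u ω) (ξ ω) := by
    simpa only [Function.comp_def] using (hQ.measurable_gradY z).comp hp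
  have h3 : Measurable fun ω => -Q.gradΛ (u ω) (ξ ω) := by
    simpa only [Function.comp_def, Pi.neg_def] using (hQ.measurable_gradΛ.comp hp).neg
  have hid : Measurable fun a : ℝ => a • ContinuousLinearMap.id ℝ ℝ :=
    (by fun_prop : Continuous fun a : ℝ => a • ContinuousLinearMap.id ℝ ℝ).measurable
  have hG : Measurable fun ω => Q.gradU z (u ω) (ξ ω) := by
    simpa only [Function.comp_def, gradU] using (continuous_coprod₃ (E := E)).measurable.comp
      (h1.prodMk ((hid.comp h2).prodMk (hid.comp h3)))
  have hg : Measurable fun ω => D.grad (u ω) := by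
    simpa only [Function.comp_def, Prox.grad] using (continuous_coprod₃ (E := E)).measurable.comp
      ((D.dX.measurable_grad_comp (measurable_fst.comp hu) fun ω => (hU ω).1).prodMk
        ((D.dY.measurable_grad_comp (measurable_fst.comp (measurable_snd.comp hu))
            fun ω => (hU ω).2.1).prodMk
          (D.dΛ.measurable_grad_comp (measurable_snd.comp (measurable_snd.comp hu))
            fun ω => (hU ω).2.2)))
  have hη : Measurable fun ω => g • Q.gradU z (u ω) (ξ ω) - D.grad (u ω) :=
    (hG.const_smul g).sub hg
  simpa only [Function.comp_def] using (hQ.continuous_prox D).measurable.comp hη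

variable {Ω : Type*} {S : ℕ × ℕ × Bool → Ω → Ξ}

theorem Standing.measurable_smd (hQ : Q.Standing) (D : Q.Prox) (S : ℕ × ℕ × Bool → Ω → Ξ)
    (z : ℝ) (γ : ℕ → ℝ) (k t : ℕ) :
    Measurable[sampleSigma S (stepIdx k t)] fun ω => Q.smd D z γ (samplePath S k false ω) t := by
  induction t with
  | zero => exact measurable_const
  | succ t ih =>
    simp only [hQ.smd_succ]
    exact hQ.measurable_smd_step D z (γ t)
      (ih.mono (sampleSigma_mono S (stepIdx_subset_succ k t)) le_rfl)
      (fun ω => hQ.smd_mem D z γ _ t) (measurable_sampleSigma S (mem_stepIdx_succ k t false))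

theorem Standing.measurable_smdX (hQ : Q.Standing) (D : Q.Prox) (S : ℕ × ℕ × Bool → Ω → Ξ)
    (z : ℝ) (T : ℕ) (γ : ℕ → ℝ) (k : ℕ) :
    Measurable[sampleSigma S (iterIdx k)] fun ω => Q.smdX D z T γ (samplePath S k false ω) := by
  have := secondCountableTopology_of_finiteDimensional E
  simp only [smdX]
  refine Measurable.const_smul (Finset.measurable_sum _ fun t _ => ?_) _
  exact (measurable_fst.comp ((hQ.measurable_smd D S z γ k t).mono
    (sampleSigma_mono S (stepIdx_subset_iterIdx k t)) le_rfl)).const_smul (γ t)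

theorem Standing.measurable_smdζ (hQ : Q.Standing) (D : Q.Prox) (S : ℕ × ℕ × Bool → Ω → Ξ)
    (z : ℝ) (T : ℕ) (γ : ℕ → ℝ) (k : ℕ) :
    Measurable[sampleSigma S (iterIdx k)] fun ω =>
      Q.smdζ D z T γ (samplePath S k false ω) (samplePath S k true ω) := by
  simp only [smdζ]
  refine Measurable.const_mul (Finset.measurable_sum _ fun t _ => ?_) _
  refine Measurable.const_mul ((hQ.measurable_gradZ z).comp (Measurable.prodMk
    ((hQ.measurable_smd D S z γ k t).mono
      (sampleSigma_mono S (stepIdx_subset_iterIdx k t)) le_rfl) ?_)) (γ t)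
  exact measurable_sampleSigma S (i := (k, t, true)) rfl

variable [MeasurableSpace Ω] {μ : Measure Ω} [IsProbabilityMeasure μ]

theorem Standing.noiseU_moment (hQ : Q.Standing) (hM : Q.SemimomentBound)
    (hG : Q.SemidevLipschitz) (D : Q.Prox) (hS : ∀ i, Measurable (S i))
    (hlaw : ∀ i, μ.map (S i) = Q.P) (hindep : iIndepFun S μ) {z : ℝ} (hz : 0 < z) (T : ℕ) (g : ℝ)
    (k : ℕ) {d : E × ℝ × ℝ → E × ℝ × ℝ} (hd : Measurable d) {C : ℝ}
    (hC : ∀ u ∈ Q.U, sqNorm (d u) ≤ C) :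
    Measurable[sampleSigma S (iterIdx k)] (fun ω => Q.noiseU D z T g d (samplePath S k false ω)) ∧
      Integrable (fun ω => Q.noiseU D z T g d (samplePath S k false ω) ^ 2) μ ∧
      ∫ ω, Q.noiseU D z T g d (samplePath S k false ω) ^ 2 ∂μ ≤ T * (Q.Msq z * C) := by
  have := hQ.isProb
  have hMsq : 0 ≤ Q.Msq z :=
    (integral_nonneg fun s => gradSq_nonneg _ _ _).trans
      (hQ.integrable_gradSq_and_integral_le hM hG hz hQ.u0_mem).2
  have h := sum_centered_fresh_samples hS hlaw hindep (I := stepIdx k) (i := fun t => (k, t, false))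
    (fun t => notMem_stepIdx k t false) (stepIdx_subset_succ k)
    (fun t => mem_stepIdx_succ k t false) (hQ.measurable_smd D S z (fun _ => g) k)
    (fun t ω => hQ.smd_mem D z _ _ t) (φ := fun u s => Q.gradU z u s (d u))
    (hQ.measurable_gradU_apply z hd) (fun u hu => hQ.memLp_gradU_apply hM hG hz hu (d u))
    (C := Q.Msq z * C) (fun u hu => (hQ.integral_sq_gradU_le hM hG hz hu (d u)).trans
      (mul_le_mul_of_nonneg_left (hC u hu) hMsq)) T
  exact ⟨h.1.mono (sampleSigma_mono S (stepIdx_subset_iterIdx k T)) le_rfl, h.2.1, h.2.2⟩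

theorem Standing.gradSq_moment (hQ : Q.Standing) (hM : Q.SemimomentBound)
    (hG : Q.SemidevLipschitz) (D : Q.Prox) (hS : ∀ i, Measurable (S i))
    (hlaw : ∀ i, μ.map (S i) = Q.P) (hindep : iIndepFun S μ) {z : ℝ} (hz : 0 < z) (T : ℕ) (g : ℝ)
    (k : ℕ) :
    let Γ : Ω → ℝ := fun ω => ∑ t ∈ Finset.range T, g ^ 2 *
      Q.gradSq z (Q.smd D z (fun _ => g) (samplePath S k false ω) t) (samplePath S k false ω t)
    Measurable[sampleSigma S (iterIdx k)] Γ ∧ Integrable Γ μ ∧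
      ∫ ω, Γ ω ∂μ ≤ g ^ 2 * (T * Q.Msq z) := by
  have := hQ.isProb
  have h := fun t => integrable_fresh_sample hS hlaw hindep (notMem_stepIdx k t false)
    (hQ.measurable_smd D S z (fun _ => g) k t) (fun ω => hQ.smd_mem D z _ _ t)
    (φ := Q.gradSq z) (hQ.measurable_gradSq z) (gradSq_nonneg z)
    (fun u hu => (hQ.integrable_gradSq_and_integral_le hM hG hz hu).1)
    (fun u hu => (hQ.integrable_gradSq_and_integral_le hM hG hz hu).2)
  refine ⟨Finset.measurable_sum _ fun t _ => Measurable.const_mul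
    ((hQ.measurable_gradSq z).comp (Measurable.prodMk ((hQ.measurable_smd D S z _ k t).mono
      (sampleSigma_mono S (stepIdx_subset_iterIdx k t)) le_rfl)
      (measurable_sampleSigma S (i := (k, t, false)) rfl))) _,
    integrable_finsetSum _ fun t _ => (h t).1.const_mul _, ?_⟩
  refine (le_of_eq (integral_finsetSum (Finset.range T)
    fun t _ => (h t).1.const_mul (g ^ 2))).trans ?_
  simp only [integral_const_mul]
  rw [← Finset.mul_sum]
  refine mul_le_mul_of_nonneg_left ?_ (sq_nonneg g)
  refine (Finset.sum_le_sum fun t _ => (h t).2).trans (le_of_eq ?_)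
  simp

/-- With `D = D_V²`, inside the bracket of `smdErr` the regret and Young terms give `2D`, the
squared gradients `D/2` and the two squared noises `D + 1/2`. The total is at most `9D/2` because `D
≥ 1/2`. -/
theorem Standing.smdErr_moment (hQ : Q.Standing) (hM : Q.SemimomentBound)
    (hG : Q.SemidevLipschitz) (D : Q.Prox) (hS : ∀ i, Measurable (S i))
    (hlaw : ∀ i, μ.map (S i) = Q.P) (hindep : iIndepFun S μ) {z : ℝ} (hz : 0 < z) {T : ℕ}
    {g : ℝ} (hg : 0 < g) (hgT : g ^ 2 * (T * Q.Msq z) = Q.DVsq) (k : ℕ) {x : E} (hx : x ∈ Q.X)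
    {y : ℝ} (hy : y ∈ Q.Y) :
    Measurable[sampleSigma S (iterIdx k)]
        (fun ω => Q.smdErr D z T g x y (samplePath S k false ω)) ∧
      Integrable (fun ω => Q.smdErr D z T g x y (samplePath S k false ω)) μ ∧
      ∫ ω, Q.smdErr D z T g x y (samplePath S k false ω) ∂μ ≤ (g * T)⁻¹ * (9 / 2 * Q.DVsq) := by
  have := secondCountableTopology_of_finiteDimensional E
  have hD := D.DVsq_pos
  have hD2 := D.half_le_DVsq
  obtain ⟨a1, a2, a3⟩ := hQ.gradSq_moment hM hG D hS hlaw hindep hz T g k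
  obtain ⟨b1, b2, b3⟩ := hQ.noiseU_moment hM hG D hS hlaw hindep hz T g k
    (d := fun u => u - (x, y, 0)) (by fun_prop) (C := 2 * Q.DVsq)
    (fun u hu => hQ.sqNorm_sub_le D hu ⟨hx, hy, by simp⟩)
  obtain ⟨c1, c2, c3⟩ := hQ.noiseU_moment hM hG D hS hlaw hindep hz T g k
    (d := fun _ => (0, 0, 1)) (by fun_prop) (C := 1) (fun u _ => by simp [sqNorm])
  simp only [smdErr]
  have i1 := (integrable_const (μ := μ) (2 * Q.DVsq)).add (a2.const_mul (1 / 2))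
  have i2 := (b2.add c2).const_mul (g ^ 2 / (2 * Q.DVsq))
  refine ⟨?_, (i1.add i2).const_mul _, ?_⟩
  · exact (((a1.const_mul _).const_add _).add
      (((b1.pow_const 2).add (c1.pow_const 2)).const_mul _)).const_mul _
  · rw [integral_const_mul]
    refine mul_le_mul_of_nonneg_left ?_ (by positivity)
    have e := integral_add' i1 i2
    refine (le_of_eq e).trans ?_
    rw [integral_add' (integrable_const _) (a2.const_mul _), integral_const_mul,
      integral_const_mul, integral_const_mul, integral_add' b2 c2]
    simp only [integral_const, probReal_univ, one_smul]
    have hq : 0 ≤ g ^ 2 / (2 * Q.DVsq) := by positivity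
    have h1 := mul_le_mul_of_nonneg_left (add_le_add b3 c3) hq
    have h2 : g ^ 2 / (2 * Q.DVsq) * (T * (Q.Msq z * (2 * Q.DVsq)) + T * (Q.Msq z * 1)) =
        Q.DVsq + 1 / 2 := by
      have : g ^ 2 / (2 * Q.DVsq) * (T * (Q.Msq z * (2 * Q.DVsq)) + T * (Q.Msq z * 1)) =
        g ^ 2 * (T * Q.Msq z) * (2 * Q.DVsq + 1) / (2 * Q.DVsq) := by ring
      rw [this, hgT]; field_simp
    rw [hgT] at a3
    rw [h2] at h1
    linarith

/-- The sample `(k, t, true)` is fresh relative to the iterate it is used with, so the estimation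
error is an average of martingale differences. Subtracting the constant `κ` leaves the differences
unchanged and reduces their second moment to that of a pure power of the excess. -/
theorem Standing.noiseZ_moment (hQ : Q.Standing) (hM : Q.SemimomentBound)
    (D : Q.Prox) (hS : ∀ i, Measurable (S i))
    (hlaw : ∀ i, μ.map (S i) = Q.P) (hindep : iIndepFun S μ) {z : ℝ} (hz : 0 < z) {T : ℕ}
    (hT : 0 < T) {g : ℝ} (hg : 0 < g) (k : ℕ) {C : ℝ}
    (hC : ∀ u ∈ Q.U, ∫ s, (Q.gradZ z u s - Q.κ) ^ 2 ∂Q.P ≤ C) :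
    let N : Ω → ℝ := fun ω =>
      Q.smdζ D z T (fun _ => g) (samplePath S k false ω) (samplePath S k true ω)
        - Q.smdMeanZ D z T g (samplePath S k false ω)
    Measurable[sampleSigma S (iterIdx k)] N ∧ Integrable (fun ω => N ω ^ 2) μ ∧
      ∫ ω, N ω ^ 2 ∂μ ≤ C / T := by
  have := hQ.isProb
  intro N
  have hT' : (0 : ℝ) < T := Nat.cast_pos.2 hT
  have hm : Measurable (Function.uncurry fun (u : E × ℝ × ℝ) s => Q.gradZ z u s - Q.κ) :=
    (hQ.measurable_gradZ z).sub_const _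
  obtain ⟨h1, h2, h3⟩ := sum_centered_fresh_samples hS hlaw hindep (I := stepIdx k)
    (i := fun t => (k, t, true)) (fun t => notMem_stepIdx k t true) (stepIdx_subset_succ k)
    (fun t => mem_stepIdx_succ k t true) (hQ.measurable_smd D S z (fun _ => g) k)
    (fun t ω => hQ.smd_mem D z _ _ t) (φ := fun u s => Q.gradZ z u s - Q.κ) hm
    (fun u hu => (memLp_two_iff_integrable_sq (hm.comp
      (measurable_const.prodMk measurable_id : Measurable fun s : Ξ => (u, s))).aestronglyMeasurable).2
      (hQ.integrable_sq_gradZ_sub hM hz hu)) hC T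
  have hN : N = fun ω => (T : ℝ)⁻¹ * ∑ t ∈ Finset.range T,
      ((Q.gradZ z (Q.smd D z (fun _ => g) (samplePath S k false ω) t) (S (k, t, true) ω) - Q.κ)
        - ∫ s, (Q.gradZ z (Q.smd D z (fun _ => g) (samplePath S k false ω) t) s - Q.κ) ∂Q.P) := by
    funext ω
    show Q.smdζ D z T (fun _ => g) (samplePath S k false ω) (samplePath S k true ω)
        - Q.smdMeanZ D z T g (samplePath S k false ω) = _
    rw [smdζ_const D z hg, smdMeanZ, ← Finset.sum_sub_distrib, Finset.mul_sum]
    refine Finset.sum_congr rfl fun t _ => ?_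
    rw [integral_sub (hQ.integrable_gradZ hM z (hQ.smd_mem D z _ _ t)) (integrable_const _),
      meanZ]
    simp only [integral_const, probReal_univ, one_smul, samplePath]
    ring
  rw [hN]
  refine ⟨(h1.mono (sampleSigma_mono S (stepIdx_subset_iterIdx k T)) le_rfl).const_mul _, ?_, ?_⟩
  · simp only [mul_pow]
    exact h2.const_mul _
  · simp only [mul_pow]
    rw [integral_const_mul]
    refine (mul_le_mul_of_nonneg_left h3 (by positivity)).trans (le_of_eq ?_)
    field_simp

end Problem

/-! ### Deterministic analysis of the bisection. -/

/-- Constants and data of a run of the bisection method in which the approximate derivatives `ζ`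
are close to derivatives `ζ'` that certify success: an iteration succeeds as soon as
`ζ' k * (z_k - z*) ≤ ε / 2`. -/
structure BisectRun (st : ℕ → BisectState) (ζ ζ' : ℕ → ℝ) (zs z0 θ ε ρ κ B p w : ℝ) (K₁ K₂ : ℕ)
    (good : ℕ → Prop) : Prop where
  init : st 0 = ⟨0, z0, false, false⟩
  step : ∀ k, st (k + 1) = (st k).next θ (ζ k)
  zs_nonneg : 0 ≤ zs
  z0_pos : 0 < z0
  θ_pos : 0 < θ
  ε_pos : 0 < ε
  one_le_ρ : 1 ≤ ρ
  zs_le : zs ≤ ρ * z0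
  κ_nonneg : 0 ≤ κ
  B_nonneg : 0 ≤ B
  p_nonneg : 0 ≤ p
  κ_mul_θ : κ * θ ≤ ε / 2
  w_eq : w = max zs (z0 / 2)
  doubling : 2 * zs ≤ z0 * 2 ^ K₁
  one_le_K₁ : 1 ≤ K₁
  one_le_K₂ : 1 ≤ K₂
  width_κ : κ * (2 * w) ≤ ε / 2 * 2 ^ K₂
  width_B : B / (θ / 2) ^ p * (2 * w) ≤ ε / 2 * 2 ^ K₂
  noise : ∀ k < K₁ + K₂, |ζ k - ζ' k| * ((st k).query * ρ) ≤ ε / 4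
  deriv_le : ∀ k < K₁ + K₂, ζ' k ≤ κ
  neg_deriv_le : ∀ k < K₁ + K₂, -ζ' k ≤ B / (st k).query ^ p
  good_of_le : ∀ k < K₁ + K₂, ζ' k * ((st k).query - zs) ≤ ε / 2 → good k

namespace BisectRun

variable {st : ℕ → BisectState} {ζ ζ' : ℕ → ℝ} {zs z0 θ ε ρ κ B p w : ℝ} {K₁ K₂ : ℕ}
  {good : ℕ → Prop}

/-- The state of an unsuccessful run. -/
def Inv (zs z0 θ w : ℝ) (K₁ k : ℕ) (s : BisectState) : Prop :=
  s.stopped = false ∧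
    ((s.phaseTwo = false ∧ s.a = 0 ∧ s.b = z0 * 2 ^ k ∧ (k = 0 ∨ z0 * 2 ^ k < 2 * zs)) ∨
      (s.phaseTwo = true ∧ 0 ≤ s.a ∧ s.a ≤ zs ∧ zs ≤ s.b ∧ θ < s.b ∧
        (s.b - s.a) * 2 ^ k ≤ 2 * w * 2 ^ K₁))

/-- While doubling, `z_k ≥ z0` and `z* ≤ ρ z0`. While bisecting, `z_k ≥ b / 2` with `b ≥ z*` and `b
> θ`. The relative bound on `z* - z_k` is what makes the noise condition usable; the opposite
difference is trivially at most `z_k`. -/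
theorem Inv.query_bounds (h : BisectRun st ζ ζ' zs z0 θ ε ρ κ B p w K₁ K₂ good) {k : ℕ}
    {s : BisectState} (hs : Inv zs z0 θ w K₁ k s) :
    min z0 (max (zs / 2) (θ / 2)) ≤ s.query ∧ zs - s.query ≤ s.query * ρ ∧ 0 < s.query := by
  have hz0 := h.z0_pos
  have hρ := h.one_le_ρ
  have hpos : 0 < min z0 (max (zs / 2) (θ / 2)) :=
    lt_min hz0 (lt_max_of_lt_right (by linarith [h.θ_pos]))
  suffices h' : min z0 (max (zs / 2) (θ / 2)) ≤ s.query ∧ zs - s.query ≤ s.query * ρ from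
    ⟨h'.1, h'.2, hpos.trans_le h'.1⟩
  rcases hs with ⟨-, ⟨h1, h2, h3, h4⟩ | ⟨h1, h2, h3, h4, h5, h6⟩⟩
  · have hq : s.query = z0 * 2 ^ k := by simp [BisectState.query, h1, h3]
    have hle : z0 ≤ z0 * 2 ^ k := le_mul_of_one_le_right hz0.le (one_le_pow₀ one_le_two)
    rw [hq]
    refine ⟨(min_le_left _ _).trans hle, ?_⟩
    have := h.zs_le
    have := mul_le_mul_of_nonneg_left hle (by linarith : 0 ≤ ρ)
    linarith
  · have hq : s.query = (s.a + s.b) / 2 := by simp [BisectState.query, h1]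
    rw [hq]
    refine ⟨(min_le_right _ _).trans (max_le (by linarith) (by linarith)), ?_⟩
    have : (s.a + s.b) / 2 ≤ (s.a + s.b) / 2 * ρ :=
      le_mul_of_one_le_right (by linarith [h.zs_nonneg]) hρ
    linarith

/-- Failure means `ζ' (z - z*) > ε/2`, and replacing `ζ'` by `ζ` changes this product by at most
`ε/4`, so `ζ` points away from `z*`. Moreover `z ≤ θ` is impossible on the right of `z*`, because
there `ζ' (z - z*) ≤ κ θ ≤ ε/2`; hence a failed iteration does not terminate the method. -/
theorem sign_of_not_good (h : BisectRun st ζ ζ' zs z0 θ ε ρ κ B p w K₁ K₂ good) {k : ℕ}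
    (hk : k < K₁ + K₂) (hs : Inv zs z0 θ w K₁ k (st k)) (hg : ¬ good k) :
    (ζ k < 0 → (st k).query < zs) ∧ (0 ≤ ζ k → zs < (st k).query ∧ θ < (st k).query) := by
  obtain ⟨-, hb, hq⟩ := hs.query_bounds h
  have hn := h.noise k hk
  have hε := h.ε_pos
  have hρ := h.one_le_ρ
  have hng : ε / 2 < ζ' k * ((st k).query - zs) := by
    by_contra! hle
    exact hg (h.good_of_le k hk hle)
  set z := (st k).query with hz
  have hsmall : ∀ d, d ≤ z * ρ → 0 ≤ d → |ζ k - ζ' k| * d ≤ ε / 4 := fun d hd _ =>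
    (mul_le_mul_of_nonneg_left hd (abs_nonneg _)).trans hn
  have h1 := le_abs_self (ζ k - ζ' k)
  have h2 := neg_abs_le (ζ k - ζ' k)
  have hzρ : z ≤ z * ρ := le_mul_of_one_le_right hq.le hρ
  have hzs := h.zs_nonneg
  refine ⟨fun hζ => ?_, fun hζ => ?_⟩
  · by_contra! hle
    have := hsmall (z - zs) (by linarith) (by linarith)
    nlinarith
  · have hlt : zs < z := by
      by_contra! hle
      have := hsmall (zs - z) hb (by linarith)
      nlinarith
    refine ⟨hlt, ?_⟩
    by_contra! hle
    have a1 := h.deriv_le k hk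
    have a2 := h.κ_mul_θ
    have a3 : ζ' k * (z - zs) ≤ κ * (z - zs) := mul_le_mul_of_nonneg_right a1 (by linarith)
    have a4 : κ * (z - zs) ≤ κ * θ := mul_le_mul_of_nonneg_left (by linarith) h.κ_nonneg
    linarith

theorem inv_succ (h : BisectRun st ζ ζ' zs z0 θ ε ρ κ B p w K₁ K₂ good) {k : ℕ}
    (hk : k < K₁ + K₂) (hs : Inv zs z0 θ w K₁ k (st k)) (hg : ¬ good k) :
    Inv zs z0 θ w K₁ (k + 1) (st (k + 1)) := by
  obtain ⟨hneg, hnn⟩ := h.sign_of_not_good hk hs hg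
  have hz0 := h.z0_pos
  have hzs := h.zs_nonneg
  have hw1 : zs ≤ w := h.w_eq ▸ le_max_left _ _
  have hw2 : z0 / 2 ≤ w := h.w_eq ▸ le_max_right _ _
  rw [h.step]
  rcases hs with ⟨hst, ⟨h1, h2, h3, h4⟩ | ⟨h1, h2, h3, h4, h5, h6⟩⟩
  · have hq : (st k).query = (st k).b := by simp [BisectState.query, h1]
    rw [hq] at hneg hnn
    rcases lt_or_ge (ζ k) 0 with hζ | hζ
    · have := hneg hζ
      refine ⟨by simp [BisectState.next, hst, h1, hζ], Or.inl ⟨?_, ?_, ?_, Or.inr ?_⟩⟩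
      · simp [BisectState.next, hst, h1, hζ]
      · simp [BisectState.next, hst, h1, hζ, h2]
      · simp only [BisectState.next, hst, h1, hζ, h3]
        simp; ring
      · rw [h3] at this; rw [pow_succ]; linarith
    · obtain ⟨a1, a2⟩ := hnn hζ
      have hn : (st k).next θ (ζ k) = ⟨(st k).a, (st k).b, true, false⟩ := by
        simp [BisectState.next, hst, h1, not_lt.2 hζ]
      rw [hn]
      refine ⟨rfl, Or.inr ⟨rfl, h2.ge, h2.trans_le hzs, a1.le, a2, ?_⟩⟩
      show ((st k).b - (st k).a) * 2 ^ (k + 1) ≤ 2 * w * 2 ^ K₁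
      rw [h2, sub_zero]
      -- Either no doubling took place and `b = z0`, or the last doubling started below `z*`; this
      -- is why `w` is the maximum of `z*` and `z0 / 2`.
      have hb : (st k).b ≤ 2 * w := by
        rcases h4 with rfl | h4
        · rw [h3]; linarith
        · rw [h3]; linarith
      -- The phase change, which leaves the interval as it is, is counted among the `K₁` iterations,
      -- so the halvings after it number at least `k - K₁`.
      have hkK : k + 1 ≤ K₁ := by
        rcases h4 with rfl | h4
        · exact h.one_le_K₁
        · have := h4.trans_le h.doubling
          exact (pow_lt_pow_iff_right₀ one_lt_two).1 (lt_of_mul_lt_mul_left this hz0.le)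
      have hb0 : 0 ≤ 2 * w := by linarith
      exact mul_le_mul hb (pow_le_pow_right₀ one_le_two hkK) (by positivity) hb0
  · have hq : (st k).query = ((st k).a + (st k).b) / 2 := by simp [BisectState.query, h1]
    have hpow : (2 : ℝ) ^ (k + 1) = 2 ^ k * 2 := pow_succ _ _
    rcases lt_or_ge (ζ k) 0 with hζ | hζ
    · have := hneg hζ
      have hn : (st k).next θ (ζ k) = ⟨(st k).query, (st k).b, true, false⟩ := by
        simp [BisectState.next, hst, h1, hζ, h5]
      rw [hn]
      refine ⟨rfl, Or.inr ⟨rfl, ?_, this.le, h4, h5, ?_⟩⟩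
      · show 0 ≤ (st k).query
        rw [hq]; linarith
      · show ((st k).b - (st k).query) * 2 ^ (k + 1) ≤ 2 * w * 2 ^ K₁
        rw [hq, hpow]
        linarith
    · obtain ⟨a1, a2⟩ := hnn hζ
      have hn : (st k).next θ (ζ k) = ⟨(st k).a, (st k).query, true, false⟩ := by
        simp [BisectState.next, hst, h1, not_lt.2 hζ, a2]
      rw [hn]
      refine ⟨rfl, Or.inr ⟨rfl, h2, h3, a1.le, a2, ?_⟩⟩
      show ((st k).query - (st k).a) * 2 ^ (k + 1) ≤ 2 * w * 2 ^ K₁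
      rw [hq, hpow]
      linarith

theorem inv_of_not_good (h : BisectRun st ζ ζ' zs z0 θ ε ρ κ B p w K₁ K₂ good) {k : ℕ}
    (hk : k ≤ K₁ + K₂) (hg : ∀ j < k, ¬ good j) : Inv zs z0 θ w K₁ k (st k) := by
  induction k with
  | zero =>
    rw [h.init]
    exact ⟨rfl, Or.inl ⟨rfl, rfl, by simp, Or.inl rfl⟩⟩
  | succ k ih =>
    exact h.inv_succ (Nat.lt_of_succ_le hk)
      (ih (Nat.le_of_succ_le hk) fun j hj => hg j (hj.trans (Nat.lt_succ_self k)))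
      (hg k (Nat.lt_succ_self k))

/-- If all iterations fail, the last one bisects an interval containing `z*`, and its midpoint is
within `2w / 2^K₂` of `z*`. Since `κ` bounds `ζ'` from above and `B / (θ/2)^p` bounds `-ζ'` because
`z ≥ θ/2`, the product `ζ' (z - z*)` is then at most `ε/2`: the iteration succeeds after all. -/
theorem exists_good (h : BisectRun st ζ ζ' zs z0 θ ε ρ κ B p w K₁ K₂ good) :
    ∃ k < K₁ + K₂, good k := by
  by_contra! hg
  have h1K := h.one_le_K₁
  have h2K := h.one_le_K₂
  obtain ⟨k, hk⟩ : ∃ k, K₁ + K₂ = k + 1 := ⟨K₁ + K₂ - 1, by omega⟩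
  have hkl : k < K₁ + K₂ := by omega
  have hs := h.inv_of_not_good hkl.le fun j hj => hg j (hj.trans hkl)
  obtain ⟨-, -, hqpos⟩ := hs.query_bounds h
  have hz0 := h.z0_pos
  refine hg k hkl (h.good_of_le k hkl ?_)
  rcases hs with ⟨-, ⟨h1, h2, h3, h4⟩ | ⟨h1, h2, h3, h4, h5, h6⟩⟩
  · exfalso
    rcases h4 with rfl | h4
    · omega
    · have := h4.trans_le h.doubling
      have := (pow_lt_pow_iff_right₀ one_lt_two).1 (lt_of_mul_lt_mul_left this hz0.le)
      omega
  · have hq : (st k).query = ((st k).a + (st k).b) / 2 := by simp [BisectState.query, h1]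
    obtain ⟨n, hn⟩ : ∃ n, K₂ = n + 1 := ⟨K₂ - 1, by omega⟩
    have hkn : k = K₁ + n := by omega
    have hwid : ((st k).b - (st k).a) * 2 ^ K₂ ≤ 2 * (2 * w) := by
      rw [hkn, pow_add] at h6
      have h7 : (((st (K₁ + n)).b - (st (K₁ + n)).a) * 2 ^ n) * 2 ^ K₁ ≤ 2 * w * 2 ^ K₁ := by
        linarith
      have h8 := le_of_mul_le_mul_right h7 (by positivity : (0 : ℝ) < 2 ^ K₁)
      rw [hkn, hn, pow_succ]; linarith
    have h2pos : (0 : ℝ) < 2 ^ K₂ := by positivity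
    refine le_of_mul_le_mul_right ?_ h2pos
    have hd := h.deriv_le k hkl
    have hnd := h.neg_deriv_le k hkl
    set z := (st k).query with hz
    have hc : ∀ A d : ℝ, 0 ≤ A → d ≤ ((st k).b - (st k).a) / 2 → A * (2 * w) ≤ ε / 2 * 2 ^ K₂ →
        A * d * 2 ^ K₂ ≤ ε / 2 * 2 ^ K₂ := fun A d hA hdle hle => by
      have h9 : d * 2 ^ K₂ ≤ 2 * w := by
        have := mul_le_mul_of_nonneg_right hdle h2pos.le
        linarith
      have := mul_le_mul_of_nonneg_left h9 hA
      linarith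
    rcases le_total zs z with hle | hle
    · have h9 := hc κ (z - zs) h.κ_nonneg (by linarith) h.width_κ
      have h10 := mul_le_mul_of_nonneg_right (mul_le_mul_of_nonneg_right hd
        (by linarith : 0 ≤ z - zs)) h2pos.le
      linarith
    · have hB : -ζ' k ≤ B / (θ / 2) ^ p := by
        refine hnd.trans (div_le_div_of_nonneg_left h.B_nonneg
          (Real.rpow_pos_of_pos (by linarith [h.θ_pos]) _) ?_)
        exact Real.rpow_le_rpow (by linarith [h.θ_pos]) (by linarith) h.p_nonneg
      have h9 := hc (B / (θ / 2) ^ p) (zs - z)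
        (div_nonneg h.B_nonneg (Real.rpow_nonneg (by linarith [h.θ_pos]) _))
        (by linarith) h.width_B
      have h10 := mul_le_mul_of_nonneg_right (mul_le_mul_of_nonneg_right hB
        (by linarith : 0 ≤ zs - z)) h2pos.le
      linarith

/-- The run succeeds within `K₁ + K₂` iterations, before termination, and the values examined until
then are bounded from below. -/
theorem exists_first_good (h : BisectRun st ζ ζ' zs z0 θ ε ρ κ B p w K₁ K₂ good) :
    ∃ k < K₁ + K₂, good k ∧ (st k).stopped = false ∧
      ∀ j ≤ k, min z0 (max (zs / 2) (θ / 2)) ≤ (st j).query := by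
  classical
  obtain ⟨hk, hg⟩ := Nat.find_spec h.exists_good
  have hmin : ∀ j < Nat.find h.exists_good, ¬ good j := fun j hj hgj =>
    Nat.find_min h.exists_good hj ⟨hj.trans hk, hgj⟩
  refine ⟨_, hk, hg, (h.inv_of_not_good hk.le hmin).1, fun j hj => ?_⟩
  exact ((h.inv_of_not_good (hj.trans hk.le)
    fun i hi => hmin i (hi.trans_le hj)).query_bounds h).1

end BisectRun

/-! ### The constants of the method. -/

theorem le_two_pow_of_ceil_logb_le {a : ℝ} {n : ℕ} (h : ⌈Real.logb 2 a⌉₊ ≤ n) : a ≤ 2 ^ n := by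
  rcases le_or_gt a 0 with ha | ha
  · exact ha.trans (by positivity)
  · have h1 : Real.logb 2 a ≤ n := (Nat.le_ceil _).trans (Nat.cast_le.2 h)
    rw [Real.logb_le_iff_le_rpow one_lt_two ha, Real.rpow_natCast] at h1
    exact h1

namespace Problem

variable {E Ξ : Type*} [NormedAddCommGroup E] [NormedSpace ℝ E] [MeasurableSpace Ξ]
  {Q : Problem E Ξ}

/-- The factor bounding `|z - z*| / z` in the course of the method. -/
noncomputable def ρ (Q : Problem E Ξ) : ℝ := max 1 (2 * Q.p ^ (1 / (Q.p - 1)) * Q.Mf / Q.z0)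

theorem one_le_ρ : 1 ≤ Q.ρ := le_max_left _ _

theorem one_le_K (zs ε : ℝ) : 1 ≤ Q.K zs ε :=
  (le_max_left _ _).trans (Nat.le_add_right _ _)

theorem Msq_ge (z : ℝ) : 3 * Q.c ^ 2 / z ^ (2 * Q.p - 2) * Q.m ^ 2 *
      (Q.LG ^ 2 + Q.p ^ 2 * (Q.Lf ^ 2 + 1) * Q.Mf ^ (2 * Q.p - 2)
        + Q.p ^ 2 * ((2 : ℝ) ^ (2 * Q.p) * (Q.Lf ^ 2 + Q.σf ^ 2) + (2 : ℝ) ^ (2 * Q.p - 2))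
          * Q.R ^ (2 * Q.p - 2)) + 3 ≤ Q.Msq z := by
  unfold Params.Msq
  have := sq_nonneg Q.Lf
  have := sq_nonneg Q.σf
  have := sq_nonneg Q.R
  have := sq_nonneg Q.β
  linarith

theorem m_pos : 0 < Q.m := lt_max_of_lt_right one_pos

theorem Ctilde_ge {K : ℕ} {α : ℝ} : 16 * (K : ℝ) ^ 2 / α ^ 2 ≤ Q.Ctilde K α := le_max_left _ _

theorem Ctilde_pos {K : ℕ} {α : ℝ} (hK : 1 ≤ K) (hα : 0 < α) : 0 < Q.Ctilde K α := by
  have : (0 : ℝ) < K := by exact_mod_cast hK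
  exact lt_of_lt_of_le (by positivity) Ctilde_ge

theorem T_ge (zs ε α z : ℝ) : 81 * Q.Ctilde (Q.K zs ε) α * Q.Msq z * Q.DVsq / ε ^ 2
    ≤ Q.T zs ε α z := Nat.le_ceil _

variable [MeasurableSpace E]

theorem Standing.three_le_Msq (hQ : Q.Standing) (hM : Q.SemimomentBound) {z : ℝ} (hz : 0 < z) :
    3 ≤ Q.Msq z := by
  have h := Msq_ge (Q := Q) z
  have hR := hQ.R_pos
  have := Real.rpow_nonneg hM.Mf_nonneg (2 * Q.p - 2)
  have : 0 ≤ 3 * Q.c ^ 2 / z ^ (2 * Q.p - 2) * Q.m ^ 2 *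
      (Q.LG ^ 2 + Q.p ^ 2 * (Q.Lf ^ 2 + 1) * Q.Mf ^ (2 * Q.p - 2)
        + Q.p ^ 2 * ((2 : ℝ) ^ (2 * Q.p) * (Q.Lf ^ 2 + Q.σf ^ 2) + (2 : ℝ) ^ (2 * Q.p - 2))
          * Q.R ^ (2 * Q.p - 2)) := by positivity
  linarith

theorem Standing.LG_le_Msq (hQ : Q.Standing) (hM : Q.SemimomentBound) {z : ℝ} (hz : 0 < z) :
    3 * Q.c ^ 2 / z ^ (2 * Q.p - 2) * Q.m ^ 2 * Q.LG ^ 2 ≤ Q.Msq z := by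
  have h := Msq_ge (Q := Q) z
  have hR := hQ.R_pos
  have := Real.rpow_nonneg hM.Mf_nonneg (2 * Q.p - 2)
  have : 0 ≤ 3 * Q.c ^ 2 / z ^ (2 * Q.p - 2) * Q.m ^ 2 *
      (Q.p ^ 2 * (Q.Lf ^ 2 + 1) * Q.Mf ^ (2 * Q.p - 2)
        + Q.p ^ 2 * ((2 : ℝ) ^ (2 * Q.p) * (Q.Lf ^ 2 + Q.σf ^ 2) + (2 : ℝ) ^ (2 * Q.p - 2))
          * Q.R ^ (2 * Q.p - 2)) := by positivity
  linarith

theorem Standing.Msq_antitone (hQ : Q.Standing) (hM : Q.SemimomentBound) {z z' : ℝ} (hz : 0 < z)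
    (hzz' : z ≤ z') : Q.Msq z' ≤ Q.Msq z := by
  have hR := hQ.R_pos
  have hp := hQ.one_lt_p
  have := Real.rpow_nonneg hM.Mf_nonneg (2 * Q.p - 2)
  have h1 : z ^ (2 * Q.p - 2) ≤ z' ^ (2 * Q.p - 2) :=
    Real.rpow_le_rpow hz.le hzz' (by linarith)
  have h2 := Real.rpow_pos_of_pos hz (2 * Q.p - 2)
  unfold Params.Msq
  gcongr

theorem Standing.T_pos (hQ : Q.Standing) (hM : Q.SemimomentBound) (D : Q.Prox) (zs : ℝ)
    {ε α z : ℝ} (hε : 0 < ε) (hα : 0 < α) (hz : 0 < z) : 0 < Q.T zs ε α z := by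
  have h1 := Ctilde_pos (Q := Q) (one_le_K (Q := Q) zs ε) hα
  have h2 := hQ.three_le_Msq hM hz
  have h3 := D.DVsq_pos
  refine Nat.ceil_pos.2 ?_
  have : 0 < Q.Msq z := by linarith
  positivity

theorem Standing.T_antitone (hQ : Q.Standing) (hM : Q.SemimomentBound) (D : Q.Prox) (zs : ℝ)
    {ε α z z' : ℝ} (hα : 0 < α) (hz : 0 < z) (hzz' : z ≤ z') :
    Q.T zs ε α z' ≤ Q.T zs ε α z := by
  have h1 := Ctilde_pos (Q := Q) (one_le_K (Q := Q) zs ε) hα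
  have h2 := hQ.Msq_antitone hM hz hzz'
  have h3 := D.DVsq_pos
  refine Nat.ceil_le_ceil ?_
  gcongr

theorem Standing.γ_pos (hQ : Q.Standing) (hM : Q.SemimomentBound) (D : Q.Prox) (zs : ℝ)
    {ε α z : ℝ} (hε : 0 < ε) (hα : 0 < α) (hz : 0 < z) (t : ℕ) : 0 < Q.γ zs ε α z t := by
  have h1 : (0 : ℝ) < Q.T zs ε α z := Nat.cast_pos.2 (hQ.T_pos hM D zs hε hα hz)
  have h2 := hQ.three_le_Msq hM hz
  have h3 := D.DVsq_pos
  have : 0 < Q.Msq z := by linarith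
  unfold Params.γ
  positivity

theorem Standing.sq_γ (hQ : Q.Standing) (hM : Q.SemimomentBound) (D : Q.Prox) (zs : ℝ)
    {ε α z : ℝ} (hε : 0 < ε) (hα : 0 < α) (hz : 0 < z) (t : ℕ) :
    Q.γ zs ε α z t ^ 2 * (Q.T zs ε α z * Q.Msq z) = Q.DVsq := by
  have h1 : (0 : ℝ) < Q.T zs ε α z := Nat.cast_pos.2 (hQ.T_pos hM D zs hε hα hz)
  have h2 := hQ.three_le_Msq hM hz
  have h3 := D.DVsq_pos
  have h4 : 0 < Q.Msq z := by linarith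
  unfold Params.γ
  rw [div_pow, mul_pow, Real.sq_sqrt h3.le, Real.sq_sqrt h4.le, Real.sq_sqrt h1.le]
  field_simp

/-- The left side is `(9/2) D_V M_z / √T`. The first entry of `Ctilde` gives `T ≥ (36 K D_V M_z / (ε
α))²`, because `81 · 16 = 36²`. -/
theorem Standing.expected_err_le (hQ : Q.Standing) (hM : Q.SemimomentBound) (D : Q.Prox) (zs : ℝ)
    {ε α z : ℝ} (hε : 0 < ε) (hα : 0 < α) (hz : 0 < z) (t : ℕ) :
    (Q.γ zs ε α z t * Q.T zs ε α z)⁻¹ * (9 / 2 * Q.DVsq) ≤ ε * α / (8 * Q.K zs ε) := by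
  have hT : (0 : ℝ) < Q.T zs ε α z := Nat.cast_pos.2 (hQ.T_pos hM D zs hε hα hz)
  have h2 := hQ.three_le_Msq hM hz
  have hD := D.DVsq_pos
  have hM0 : 0 < Q.Msq z := by linarith
  have hK : (0 : ℝ) < Q.K zs ε := by exact_mod_cast one_le_K (Q := Q) zs ε
  have hγ := hQ.γ_pos hM D zs hε hα hz t
  have hsq := hQ.sq_γ hM D zs hε hα hz t
  have hTge := T_ge (Q := Q) zs ε α z
  have hC := Ctilde_ge (Q := Q) (K := Q.K zs ε) (α := α)
  set g := Q.γ zs ε α z t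
  set T : ℝ := (Q.T zs ε α z : ℝ)
  set K : ℝ := (Q.K zs ε : ℝ)
  set M := Q.Msq z
  have h1 : (36 * K) ^ 2 * Q.DVsq * M ≤ ε ^ 2 * α ^ 2 * T := by
    have h3 : 81 * (16 * K ^ 2 / α ^ 2) * M * Q.DVsq / ε ^ 2 ≤ T :=
      le_trans (by gcongr) hTge
    rw [div_le_iff₀ (by positivity)] at h3
    have h4 := mul_le_mul_of_nonneg_left h3 (by positivity : 0 ≤ α ^ 2)
    have e : α ^ 2 * (81 * (16 * K ^ 2 / α ^ 2) * M * Q.DVsq) = (36 * K) ^ 2 * Q.DVsq * M := by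
      field_simp; ring
    linarith
  have h5 : 36 * K * Q.DVsq ≤ ε * α * (g * T) := by
    refine le_of_sq_le_sq ?_ (by positivity)
    have e1 : (ε * α * (g * T)) ^ 2 * M = ε ^ 2 * α ^ 2 * T * Q.DVsq := by
      rw [← hsq]; ring
    have e2 := mul_le_mul_of_nonneg_right h1 hD.le
    refine le_of_mul_le_mul_right ?_ hM0
    rw [e1]
    linarith
  rw [inv_mul_le_iff₀ (by positivity), mul_div_assoc', le_div_iff₀ (by positivity)]
  linarith

/-- The second entry of `Ctilde` serves here. The `L_G` term of `M_z²` cancels the `L_G²` in its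
denominator and supplies `z^(-(2p-2))`; the remaining `z^(-2)` in the variance is absorbed by the
factor `z²` from the relative distance bound. -/
theorem Standing.noise_le (hQ : Q.Standing) (hM : Q.SemimomentBound) (hG : Q.SemidevLipschitz)
    (D : Q.Prox) (zs : ℝ) {ε α z : ℝ} (hε : 0 < ε) (hα : 0 < α) (hz : 0 < z) :
    (z * Q.ρ) ^ 2 * ((Q.c * (Q.p - 1)) ^ 2 / z ^ (2 * Q.p) *
      ((2 : ℝ) ^ (2 * Q.p - 1) * (Q.Mf ^ (2 * Q.p) + (2 * Q.R) ^ (2 * Q.p))) / Q.T zs ε α z)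
      ≤ ε ^ 2 * α / (48 * Q.K zs ε) := by
  have hT : (0 : ℝ) < Q.T zs ε α z := Nat.cast_pos.2 (hQ.T_pos hM D zs hε hα hz)
  have hD := D.DVsq_pos
  have hK : (0 : ℝ) < Q.K zs ε := by exact_mod_cast one_le_K (Q := Q) zs ε
  have hTge := T_ge (Q := Q) zs ε α z
  have hMge := hQ.LG_le_Msq hM hz
  have hp := hQ.one_lt_p
  have hc := hQ.c_pos
  have hR := hQ.R_pos
  have hz0 := hQ.z0_pos
  have hm := m_pos (Q := Q)
  have hLG := hG.LG_pos
  have hMf := hM.Mf_nonneg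
  have hp1 : 0 < Q.p - 1 := by linarith
  have hρ : max 1 (4 * Q.p ^ (2 / (Q.p - 1)) * Q.Mf ^ 2 / Q.z0 ^ 2) = Q.ρ ^ 2 := by
    have e : 4 * Q.p ^ (2 / (Q.p - 1)) * Q.Mf ^ 2 / Q.z0 ^ 2 =
        (2 * Q.p ^ (1 / (Q.p - 1)) * Q.Mf / Q.z0) ^ 2 := by
      have : Q.p ^ (2 / (Q.p - 1)) = (Q.p ^ (1 / (Q.p - 1))) ^ 2 := by
        rw [← Real.rpow_mul_natCast (by linarith)]; congr 1; push_cast; ring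
      rw [this]; ring
    have h0 : 0 ≤ 2 * Q.p ^ (1 / (Q.p - 1)) * Q.Mf / Q.z0 := by
      have : 0 ≤ Q.p ^ (1 / (Q.p - 1)) := Real.rpow_nonneg (by linarith) _
      positivity
    rw [e, ρ]
    rcases le_total 1 (2 * Q.p ^ (1 / (Q.p - 1)) * Q.Mf / Q.z0) with h | h
    · rw [max_eq_right h, max_eq_right (one_le_pow₀ h)]
    · rw [max_eq_left h, max_eq_left (pow_le_one₀ h0 h), one_pow]
  have hC : 32 * (Q.K zs ε : ℝ) * Q.ρ ^ 2 * (Q.p - 1) ^ 2 * (2 : ℝ) ^ (2 * Q.p - 2)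
        * (Q.Mf ^ (2 * Q.p) + (2 * Q.R) ^ (2 * Q.p))
      / (81 * α * Q.m ^ 2 * Q.DVsq * Q.LG ^ 2) ≤ Q.Ctilde (Q.K zs ε) α := by
    refine le_trans ?_ (le_max_right _ _)
    rw [hρ, Real.mul_rpow (by norm_num) hR.le]
    have := Real.rpow_nonneg hMf (2 * Q.p)
    gcongr
    linarith
  set B := Q.Mf ^ (2 * Q.p) + (2 * Q.R) ^ (2 * Q.p) with hB
  have hB0 : 0 ≤ B := add_nonneg (Real.rpow_nonneg hMf _) (Real.rpow_nonneg (by linarith) _)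
  have e1 : z ^ (2 * Q.p) = z ^ (2 * Q.p - 2) * z ^ 2 := by
    rw [← Real.rpow_natCast z 2, ← Real.rpow_add hz]; congr 1; push_cast; ring
  have e2 : (2 : ℝ) ^ (2 * Q.p - 1) = 2 * (2 : ℝ) ^ (2 * Q.p - 2) := by
    rw [show 2 * Q.p - 1 = 1 + (2 * Q.p - 2) by ring, Real.rpow_add (by norm_num), Real.rpow_one]
  rw [e1, e2]
  set Z := z ^ (2 * Q.p - 2) with hZ
  have hZ0 : 0 < Z := Real.rpow_pos_of_pos hz _
  set t := (2 : ℝ) ^ (2 * Q.p - 2) with ht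
  have ht0 : 0 < t := Real.rpow_pos_of_pos (by norm_num) _
  set r := Q.ρ with hr
  have hr0 : 0 < r := one_pos.trans_le one_le_ρ
  have h1 : 81 * (32 * (Q.K zs ε : ℝ) * r ^ 2 * (Q.p - 1) ^ 2 * t * B
      / (81 * α * Q.m ^ 2 * Q.DVsq * Q.LG ^ 2)) * (3 * Q.c ^ 2 / Z * Q.m ^ 2 * Q.LG ^ 2) * Q.DVsq
        / ε ^ 2 ≤ Q.T zs ε α z := by
    refine le_trans ?_ hTge
    gcongr
    have := Ctilde_pos (Q := Q) (one_le_K (Q := Q) zs ε) hα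
    positivity
  have e3 : 81 * (32 * (Q.K zs ε : ℝ) * r ^ 2 * (Q.p - 1) ^ 2 * t * B
      / (81 * α * Q.m ^ 2 * Q.DVsq * Q.LG ^ 2)) * (3 * Q.c ^ 2 / Z * Q.m ^ 2 * Q.LG ^ 2) * Q.DVsq
        / ε ^ 2 = (96 * Q.K zs ε * r ^ 2 * (Q.p - 1) ^ 2 * t * B * Q.c ^ 2 / Z) / (ε ^ 2 * α) := by
    field_simp
    ring
  rw [e3, div_le_iff₀ (by positivity)] at h1
  have e4 : (z * r) ^ 2 * ((Q.c * (Q.p - 1)) ^ 2 / (Z * z ^ 2) * (2 * t * B) / Q.T zs ε α z) =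
      (96 * Q.K zs ε * r ^ 2 * (Q.p - 1) ^ 2 * t * B * Q.c ^ 2 / Z)
        / (48 * Q.K zs ε * Q.T zs ε α z) := by
    field_simp
    ring
  rw [e4, div_le_div_iff₀ (by positivity) (by positivity)]
  have := mul_le_mul_of_nonneg_right h1 (by positivity : 0 ≤ 48 * (Q.K zs ε : ℝ))
  linarith

theorem Standing.θ_pos (hQ : Q.Standing) {ε : ℝ} (hε : 0 < ε) : 0 < Q.θ ε := by
  have hp := hQ.one_lt_p
  have hc := hQ.c_pos
  have : 0 < Q.p ^ (1 / (Q.p - 1)) := Real.rpow_pos_of_pos (by linarith) _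
  unfold Params.θ
  positivity

theorem Standing.κ_nonneg (hQ : Q.Standing) : 0 ≤ Q.κ := by
  have hp := hQ.one_lt_p
  have hc := hQ.c_pos
  have hp1 : 0 < Q.p - 1 := by linarith
  unfold κ
  positivity

/-- The product equals `(p-1)/p · ε/2`. -/
theorem Standing.κ_mul_θ_le (hQ : Q.Standing) {ε : ℝ} (hε : 0 < ε) : Q.κ * Q.θ ε ≤ ε / 2 := by
  have hp := hQ.one_lt_p
  have hc := hQ.c_pos
  have hp0 : 0 < Q.p := by linarith
  have hp1 : Q.p - 1 ≠ 0 := by linarith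
  have h : Q.p ^ (-Q.p / (Q.p - 1)) * Q.p ^ (1 / (Q.p - 1)) = 1 / Q.p := by
    rw [← Real.rpow_add hp0, ← add_div, show -Q.p + 1 = -(Q.p - 1) by ring, neg_div,
      div_self hp1, Real.rpow_neg_one, one_div]
  have e : Q.κ * Q.θ ε = (Q.p - 1) / Q.p * (ε / 2) := by
    calc Q.κ * Q.θ ε = Q.c / Q.c * (Q.p - 1) *
          (Q.p ^ (-Q.p / (Q.p - 1)) * Q.p ^ (1 / (Q.p - 1))) * (ε / 2) := by
          unfold κ Params.θ; field_simp
      _ = _ := by rw [h, div_self hc.ne']; ring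
  rw [e]
  exact mul_le_of_le_one_left (by linarith) ((div_le_one hp0).2 (by linarith))

theorem Standing.exists_K_split (hQ : Q.Standing) (hM : Q.SemimomentBound) {zs ε : ℝ} (hε : 0 < ε)
    : ∃ K₁ K₂ : ℕ, Q.K zs ε = K₁ + K₂ ∧ 1 ≤ K₁ ∧ 1 ≤ K₂ ∧
      2 * zs ≤ Q.z0 * 2 ^ K₁ ∧ Q.κ * (2 * max zs (Q.z0 / 2)) ≤ ε / 2 * 2 ^ K₂ ∧
      Q.c * (Q.p - 1) * ((2 : ℝ) ^ (Q.p - 1) * (Q.Mf ^ Q.p + (2 * Q.R) ^ Q.p))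
        / (Q.θ ε / 2) ^ Q.p * (2 * max zs (Q.z0 / 2)) ≤ ε / 2 * 2 ^ K₂ := by
  have hp := hQ.one_lt_p
  have hc := hQ.c_pos
  have hz0 := hQ.z0_pos
  have hR := hQ.R_pos
  have hp0 : 0 < Q.p := by linarith
  have hp1 : 0 < Q.p - 1 := by linarith
  refine ⟨_, _, rfl, le_max_left _ _, le_max_left _ _, ?_, ?_⟩
  · have h := le_two_pow_of_ceil_logb_le
      (le_max_right 1 ⌈Real.logb 2 (2 * zs / Q.z0)⌉₊)
    rw [div_le_iff₀ hz0] at h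
    linarith
  · set w := max zs (Q.z0 / 2) with hw
    have hw0 : 0 < w := lt_max_of_lt_right (by linarith)
    generalize hA1 : ⌈Real.logb 2 (8 * Q.c * w / ε * Q.p ^ (-1 / (Q.p - 1)))⌉₊ = A1
    set A := Q.c ^ (Q.p + 1) * w / ε ^ (Q.p + 1) * (Q.p - 1) * Q.p ^ (-Q.p / (Q.p - 1))
            * (2 : ℝ) ^ (3 * Q.p + 1) * (Q.Mf ^ Q.p + (2 : ℝ) ^ Q.p * Q.R ^ Q.p) with hA
    set B := 4 * Q.c * w / ε * (Q.p - 1) * Q.p ^ (-Q.p / (Q.p - 1)) with hB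
    -- The logarithm of the sum settles both width conditions: `B` is the one for the upper
    -- derivative bound and `A` the one for the lower bound, each scaled by `2/ε`.
    have h := le_two_pow_of_ceil_logb_le ((le_max_right A1 ⌈Real.logb 2 (A + B)⌉₊).trans
      (le_max_right 1 _))
    have hMfp := Real.rpow_nonneg hM.Mf_nonneg Q.p
    have hA0 : 0 ≤ A := by positivity
    have hB0 : 0 ≤ B := by positivity
    set N := max 1 (max A1 ⌈Real.logb 2 (A + B)⌉₊) with hN
    have e1 : Q.κ * (2 * w) = ε / 2 * B := by
      rw [hB, κ]; field_simp; ring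
    have e2 : Q.c * (Q.p - 1) * ((2 : ℝ) ^ (Q.p - 1) * (Q.Mf ^ Q.p + (2 * Q.R) ^ Q.p))
        / (Q.θ ε / 2) ^ Q.p * (2 * w) = ε / 2 * A := by
      have hθ : Q.θ ε / 2 = Q.p ^ (1 / (Q.p - 1)) * ε / (4 * Q.c) := by
        unfold Params.θ; field_simp; ring
      have hθp : (Q.θ ε / 2) ^ Q.p = Q.p ^ (Q.p / (Q.p - 1)) * ε ^ Q.p / (4 ^ Q.p * Q.c ^ Q.p) := by
        have h0 : 0 ≤ Q.p ^ (1 / (Q.p - 1)) := by positivity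
        rw [hθ, Real.div_rpow (by positivity) (by positivity), Real.mul_rpow h0 hε.le,
          Real.mul_rpow (by norm_num) hc.le, ← Real.rpow_mul hp0.le]
        congr 3
        ring_nf
      have h4 : (4 : ℝ) ^ Q.p = (2 : ℝ) ^ (2 * Q.p) := by
        rw [Real.rpow_mul (by norm_num)]; norm_num
      have h2 : (2 : ℝ) ^ (3 * Q.p + 1) = 4 * ((2 : ℝ) ^ (2 * Q.p) * (2 : ℝ) ^ (Q.p - 1)) := by
        rw [← Real.rpow_add (by norm_num), show (4 : ℝ) = (2 : ℝ) ^ (2 : ℝ) by norm_num,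
          ← Real.rpow_add (by norm_num)]
        congr 1; ring
      have hneg : Q.p ^ (-Q.p / (Q.p - 1)) = (Q.p ^ (Q.p / (Q.p - 1)))⁻¹ := by
        rw [neg_div, Real.rpow_neg hp0.le]
      have hc1 : Q.c ^ (Q.p + 1) = Q.c ^ Q.p * Q.c := Real.rpow_add_one hc.ne' _
      have hε1 : ε ^ (Q.p + 1) = ε ^ Q.p * ε := Real.rpow_add_one hε.ne' _
      rw [hA, hθp, h4, h2, hneg, hc1, hε1, Real.mul_rpow (by norm_num) hR.le]
      have a1 := (Real.rpow_pos_of_pos hp0 (Q.p / (Q.p - 1))).ne'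
      have a2 := (Real.rpow_pos_of_pos hε Q.p).ne'
      have a3 := (Real.rpow_pos_of_pos hc Q.p).ne'
      generalize Q.p ^ (Q.p / (Q.p - 1)) = b1 at *
      generalize ε ^ Q.p = b2 at *
      generalize Q.c ^ Q.p = b3 at *
      field_simp
      norm_num
    rw [e1, e2]
    have hε2 : 0 ≤ ε / 2 := by linarith
    exact ⟨mul_le_mul_of_nonneg_left (by linarith) hε2,
      mul_le_mul_of_nonneg_left (by linarith) hε2⟩

theorem Standing.zs_le_ρ_mul (hQ : Q.Standing) {zs : ℝ} (hM : Q.SemimomentBound)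
    (hzs : zs ≤ Q.p ^ (1 / (Q.p - 1)) * Q.Mf) : zs ≤ Q.ρ * Q.z0 := by
  have hz0 := hQ.z0_pos
  have hp := hQ.one_lt_p
  have h1 := mul_le_mul_of_nonneg_right
    (le_max_right 1 (2 * Q.p ^ (1 / (Q.p - 1)) * Q.Mf / Q.z0)) hz0.le
  rw [div_mul_cancel₀ _ hz0.ne'] at h1
  have h2 : 0 ≤ Q.p ^ (1 / (Q.p - 1)) * Q.Mf :=
    mul_nonneg (Real.rpow_nonneg (by linarith) _) hM.Mf_nonneg
  unfold ρ
  linarith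

end Problem

/-! ### Independence across outer iterations and the probability of noise. -/

/-- If `s` is independent of the events `A b`, the event `A s` is at most as likely as each `A b`. -/
theorem measureReal_mem_apply_le {Ω β : Type*} {m₁ m₂ mΩ : MeasurableSpace Ω} {μ : Measure Ω}
    [IsProbabilityMeasure μ] (hm₁ : m₁ ≤ mΩ) (hind : Indep m₁ m₂ μ) {s : Ω → β}
    (hfin : (Set.range s).Finite) (hs : ∀ b, MeasurableSet[m₁] {ω | s ω = b}) {A : β → Set Ω}
    {c : ℝ} (hA : ∀ b ∈ Set.range s, MeasurableSet[m₂] (A b) ∧ μ.real (A b) ≤ c) :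
    μ.real {ω | ω ∈ A (s ω)} ≤ c := by
  have hc : 0 ≤ c := by
    obtain ⟨ω⟩ := nonempty_of_isProbabilityMeasure μ
    exact measureReal_nonneg.trans (hA (s ω) ⟨ω, rfl⟩).2
  have hsub : {ω | ω ∈ A (s ω)} ⊆ ⋃ b ∈ hfin.toFinset, {ω | s ω = b} ∩ A b := by
    intro ω hω
    simp only [Set.mem_iUnion]
    exact ⟨s ω, by simp, rfl, hω⟩
  have hterm : ∀ b ∈ hfin.toFinset, μ.real ({ω | s ω = b} ∩ A b) ≤ μ.real {ω | s ω = b} * c := by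
    intro b hb
    obtain ⟨h1, h2⟩ := hA b (hfin.mem_toFinset.1 hb)
    have h3 := (Indep_iff m₁ m₂ μ).1 hind _ _ (hs b) h1
    rw [measureReal_def, h3, ENNReal.toReal_mul]
    exact mul_le_mul_of_nonneg_left h2 ENNReal.toReal_nonneg
  have hone : ∑ b ∈ hfin.toFinset, μ.real {ω | s ω = b} ≤ 1 := by
    rw [← measureReal_biUnion_finset]
    · exact measureReal_le_one
    · intro b _ b' _ hbb'
      exact Set.disjoint_left.2 fun ω h h' => hbb' (h.symm.trans h')
    · exact fun b _ => hm₁ _ (hs b)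
  calc μ.real {ω | ω ∈ A (s ω)} ≤ μ.real (⋃ b ∈ hfin.toFinset, {ω | s ω = b} ∩ A b) :=
        measureReal_mono hsub (measure_ne_top _ _)
    _ ≤ ∑ b ∈ hfin.toFinset, μ.real ({ω | s ω = b} ∩ A b) := measureReal_biUnion_finset_le _ _
    _ ≤ ∑ b ∈ hfin.toFinset, μ.real {ω | s ω = b} * c := Finset.sum_le_sum hterm
    _ = (∑ b ∈ hfin.toFinset, μ.real {ω | s ω = b}) * c := (Finset.sum_mul _ _ _).symm
    _ ≤ c := mul_le_of_le_one_left hc hone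

/-- Only the sign of `ζ` matters, so a state has at most two successors; -1 and 0 represent the two
cases. -/
theorem BisectState.next_eq_ite (θ : ℝ) (s : BisectState) (ζ : ℝ) [Decidable (ζ < 0)] :
    s.next θ ζ = if ζ < 0 then s.next θ (-1) else s.next θ 0 := by
  split_ifs with h <;> simp [BisectState.next, h]

theorem BisectState.measurableSet_next_eq {Ω : Type*} {m : MeasurableSpace Ω} {ζ : Ω → ℝ}
    (hζ : Measurable ζ) (θ : ℝ) (r s : BisectState) :
    MeasurableSet {ω | r.next θ (ζ ω) = s} := by
  classical
  have hneg := measurableSet_lt hζ (measurable_const (a := (0 : ℝ)))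
  simp only [BisectState.next_eq_ite θ r (ζ _)]
  by_cases h1 : r.next θ (-1) = s <;> by_cases h2 : r.next θ 0 = s
  · convert MeasurableSet.univ
    ext ω
    simp only [Set.mem_ofPred_eq, Set.mem_univ, iff_true]
    split_ifs <;> assumption
  · convert hneg
    split_ifs with h <;> simp [h, h1, h2]
  · convert hneg.compl using 1
    ext ω
    simp only [Set.mem_ofPred_eq, Set.mem_compl_iff]
    split_ifs with h <;> simp [h, h1, h2]
  · convert MeasurableSet.empty
    ext ω
    simp only [Set.mem_ofPred_eq, Set.mem_empty_iff_false, iff_false]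
    split_ifs <;> assumption

theorem BisectState.query_pos {s : BisectState} (ha : 0 ≤ s.a) (hb : 0 < s.b) : 0 < s.query := by
  unfold BisectState.query
  split_ifs <;> linarith

theorem BisectState.next_nonneg_pos (θ ζ : ℝ) {s : BisectState} (h : 0 ≤ s.a ∧ 0 < s.b) :
    0 ≤ (s.next θ ζ).a ∧ 0 < (s.next θ ζ).b := by
  have hq := s.query_pos h.1 h.2
  unfold BisectState.next
  split_ifs
  all_goals first | exact h | exact ⟨hq.le, h.2⟩ | exact ⟨h.1, hq⟩ | exact ⟨h.1, by simpa using h.2⟩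

namespace Problem

variable {E Ξ : Type*} [NormedAddCommGroup E] [NormedSpace ℝ E] [MeasurableSpace Ξ]
  {Q : Problem E Ξ}

theorem bisection_nonneg_pos (hz0 : 0 < Q.z0) (D : Q.Prox) (θ : ℝ) (T : ℝ → ℕ) (γ : ℝ → ℕ → ℝ)
    (σ : ℕ × ℕ × Bool → Ξ) (k : ℕ) :
    0 ≤ (Q.bisection D θ T γ σ k).a ∧ 0 < (Q.bisection D θ T γ σ k).b := by
  induction k with
  | zero => exact ⟨le_rfl, hz0⟩
  | succ k ih => exact BisectState.next_nonneg_pos _ _ ih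

theorem query_bisection_pos (hz0 : 0 < Q.z0) (D : Q.Prox) (θ : ℝ) (T : ℝ → ℕ) (γ : ℝ → ℕ → ℝ)
    (σ : ℕ × ℕ × Bool → Ξ) (k : ℕ) : 0 < (Q.bisection D θ T γ σ k).query :=
  have h := bisection_nonneg_pos hz0 D θ T γ σ k
  BisectState.query_pos h.1 h.2

theorem finite_range_bisection {Ω : Type*} (D : Q.Prox) (θ : ℝ) (T : ℝ → ℕ) (γ : ℝ → ℕ → ℝ)
    (σ : Ω → ℕ × ℕ × Bool → Ξ) (k : ℕ) :
    (Set.range fun ω => Q.bisection D θ T γ (σ ω) k).Finite := by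
  classical
  induction k with
  | zero => exact (Set.finite_singleton _).subset (Set.range_subset_iff.2 fun ω => rfl)
  | succ k ih =>
    refine ((ih.image fun s => s.next θ (-1)).union (ih.image fun s => s.next θ 0)).subset ?_
    rintro _ ⟨ω, rfl⟩
    simp only [bisection]
    rw [BisectState.next_eq_ite]
    split_ifs
    · exact Or.inl ⟨_, ⟨ω, rfl⟩, rfl⟩
    · exact Or.inr ⟨_, ⟨ω, rfl⟩, rfl⟩

variable [FiniteDimensional ℝ E] [MeasurableSpace E] [BorelSpace E] {Ω : Type*}

/-- The state before iteration `k` is determined by the samples of the previous iterations. -/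
theorem Standing.measurableSet_bisection_eq (hQ : Q.Standing) (D : Q.Prox) (θ : ℝ) (T : ℝ → ℕ)
    (γ : ℝ → ℕ → ℝ) (S : ℕ × ℕ × Bool → Ω → Ξ) (k : ℕ) (s : BisectState) :
    MeasurableSet[sampleSigma S {i | i.1 < k}]
      {ω | Q.bisection D θ T γ (fun i => S i ω) k = s} := by
  classical
  induction k generalizing s with
  | zero =>
    simp only [bisection]
    exact MeasurableSet.const _
  | succ k ih =>
    have hle : sampleSigma S {i | i.1 < k} ≤ sampleSigma S {i | i.1 < k + 1} :=
      sampleSigma_mono S fun i (hi : i.1 < k) => hi.trans (Nat.lt_succ_self k)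
    have hle' : sampleSigma S (iterIdx k) ≤ sampleSigma S {i | i.1 < k + 1} :=
      sampleSigma_mono S fun i (hi : i.1 = k) => hi.trans_lt (Nat.lt_succ_self k)
    -- States carry no σ-algebra. Splitting over the finitely many previous states freezes the
    -- examined value, for which measurability of `smdζ` is known.
    have e : {ω | Q.bisection D θ T γ (fun i => S i ω) (k + 1) = s} =
        ⋃ r ∈ Set.range fun ω => Q.bisection D θ T γ (fun i => S i ω) k,
          {ω | Q.bisection D θ T γ (fun i => S i ω) k = r} ∩
            {ω | r.next θ (Q.smdζ D r.query (T r.query) (γ r.query) (samplePath S k false ω)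
              (samplePath S k true ω)) = s} := by
      ext ω
      simp only [Set.mem_iUnion, Set.mem_inter_iff, Set.mem_ofPred_eq, exists_prop]
      constructor
      · intro h
        exact ⟨_, ⟨ω, rfl⟩, rfl, h⟩
      · rintro ⟨r, -, rfl, h⟩
        exact h
    rw [e]
    refine (finite_range_bisection D θ T γ (fun ω i => S i ω) k).measurableSet_biUnion
      fun r _ => (hle _ (ih r)).inter (hle' _ ?_)
    exact BisectState.measurableSet_next_eq
      (hQ.measurable_smdζ D S r.query (T r.query) (γ r.query) k) θ r s

variable [MeasurableSpace Ω] {μ : Measure Ω} [IsProbabilityMeasure μ]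
  {S : ℕ × ℕ × Bool → Ω → Ξ}

/-- The output of the inner method at the value `z` is too noisy. -/
def IsNoisy (Q : Problem E Ξ) (D : Q.Prox) (xs : E) (ε α z : ℝ) (ξ ξ' : ℕ → Ξ) : Prop :=
  ε / 4 ≤ Q.smdErr D z (Q.T (Q.zstar xs) ε α z) (Q.γ (Q.zstar xs) ε α z 0) xs (Q.f xs) ξ ∨
  (ε / 4) ^ 2 ≤ (z * Q.ρ) ^ 2 *
    (Q.smdζ D z (Q.T (Q.zstar xs) ε α z) (Q.γ (Q.zstar xs) ε α z) ξ ξ'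
      - Q.smdMeanZ D z (Q.T (Q.zstar xs) ε α z) (Q.γ (Q.zstar xs) ε α z 0) ξ) ^ 2

/-- Markov's inequality: the saddle point error exceeds `ε/4` with probability at most `α / (2K)`,
the derivative error is too large with probability at most `α / (3K)`. -/
theorem Standing.isNoisy_small (hQ : Q.Standing) (hM : Q.SemimomentBound)
    (hG : Q.SemidevLipschitz) (D : Q.Prox) (hS : ∀ i, Measurable (S i))
    (hlaw : ∀ i, μ.map (S i) = Q.P) (hindep : iIndepFun S μ) {xs : E} (hxs : xs ∈ Q.X)
    {ε α z : ℝ} (hε : 0 < ε) (hα : 0 < α) (hz : 0 < z) (k : ℕ) :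
    MeasurableSet[sampleSigma S (iterIdx k)]
      {ω | Q.IsNoisy D xs ε α z (samplePath S k false ω) (samplePath S k true ω)} ∧
    μ.real {ω | Q.IsNoisy D xs ε α z (samplePath S k false ω) (samplePath S k true ω)} ≤
      α / Q.K (Q.zstar xs) ε := by
  have hK : (0 : ℝ) < Q.K (Q.zstar xs) ε := by exact_mod_cast one_le_K (Q := Q) (Q.zstar xs) ε
  have hγ := hQ.γ_pos hM D (Q.zstar xs) hε hα hz 0
  have hT := hQ.T_pos hM D (Q.zstar xs) hε hα hz
  obtain ⟨a1, a2, a3⟩ := hQ.smdErr_moment hM hG D hS hlaw hindep hz hγ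
    (hQ.sq_γ hM D (Q.zstar xs) hε hα hz 0) k hxs (hQ.mean_mem_Y xs hxs)
  obtain ⟨b1, b2, b3⟩ := hQ.noiseZ_moment hM D hS hlaw hindep hz hT hγ k
    (fun u hu => hQ.integral_sq_gradZ_sub_le hM hz hu)
  have a4 := a3.trans (hQ.expected_err_le hM D (Q.zstar xs) hε hα hz 0)
  have b4 := (mul_le_mul_of_nonneg_left b3 (sq_nonneg (z * Q.ρ))).trans
    (hQ.noise_le hM hG D (Q.zstar xs) hε hα hz)
  rw [← integral_const_mul] at b4
  set A := {ω | ε / 4 ≤ Q.smdErr D z (Q.T (Q.zstar xs) ε α z) (Q.γ (Q.zstar xs) ε α z 0) xs (Q.f xs)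
    (samplePath S k false ω)} with hA
  set B := {ω | (ε / 4) ^ 2 ≤ (z * Q.ρ) ^ 2 *
    (Q.smdζ D z (Q.T (Q.zstar xs) ε α z) (fun _ => Q.γ (Q.zstar xs) ε α z 0)
      (samplePath S k false ω) (samplePath S k true ω)
      - Q.smdMeanZ D z (Q.T (Q.zstar xs) ε α z) (Q.γ (Q.zstar xs) ε α z 0)
        (samplePath S k false ω)) ^ 2} with hB
  have hAB : {ω | Q.IsNoisy D xs ε α z (samplePath S k false ω) (samplePath S k true ω)} = A ∪ B :=
    rfl
  rw [hAB]
  refine ⟨(measurableSet_le measurable_const a1).union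
    (measurableSet_le measurable_const ((b1.pow_const 2).const_mul _)), ?_⟩
  have hA' : ε / 4 * μ.real A ≤ ε * α / (8 * Q.K (Q.zstar xs) ε) :=
    (mul_meas_ge_le_integral_of_nonneg
      (Filter.Eventually.of_forall fun ω => smdErr_nonneg D z _ hγ _ _ _) a2 _).trans a4
  have hB' : (ε / 4) ^ 2 * μ.real B ≤ ε ^ 2 * α / (48 * Q.K (Q.zstar xs) ε) :=
    (mul_meas_ge_le_integral_of_nonneg
      (Filter.Eventually.of_forall fun ω => by positivity) (b2.const_mul _) _).trans b4
  rw [le_div_iff₀ (by positivity)] at hA' hB'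
  have hA2 : μ.real A * (2 * Q.K (Q.zstar xs) ε) ≤ α := by
    refine le_of_mul_le_mul_left ?_ hε
    linarith
  have hB2 : μ.real B * (3 * Q.K (Q.zstar xs) ε) ≤ α := by
    refine le_of_mul_le_mul_left ?_ (pow_pos hε 2)
    linarith
  rw [le_div_iff₀ hK]
  have := mul_le_mul_of_nonneg_right (measureReal_union_le (μ := μ) A B) hK.le
  linarith

/-- The examined value is random but determined by earlier samples and finitely valued, so the bound
at a fixed value applies to it; then a union bound over the `K` iterations. -/
theorem Standing.exists_bad_le (hQ : Q.Standing) (hM : Q.SemimomentBound)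
    (hG : Q.SemidevLipschitz) (D : Q.Prox) (hS : ∀ i, Measurable (S i))
    (hlaw : ∀ i, μ.map (S i) = Q.P) (hindep : iIndepFun S μ) {xs : E} (hxs : xs ∈ Q.X)
    {ε α : ℝ} (hε : 0 < ε) (hα : 0 < α) (θ : ℝ) (T : ℝ → ℕ) (γ : ℝ → ℕ → ℝ) :
    μ.real {ω | ∃ k < Q.K (Q.zstar xs) ε,
      Q.IsNoisy D xs ε α (Q.bisection D θ T γ (fun i => S i ω) k).query
        (samplePath S k false ω) (samplePath S k true ω)} ≤ α := by
  set K := Q.K (Q.zstar xs) ε with hKdef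
  have hK : (0 : ℝ) < K := by exact_mod_cast one_le_K (Q := Q) (Q.zstar xs) ε
  have hk : ∀ k, μ.real {ω | Q.IsNoisy D xs ε α (Q.bisection D θ T γ (fun i => S i ω) k).query
        (samplePath S k false ω) (samplePath S k true ω)} ≤ α / K := by
    intro k
    refine measureReal_mem_apply_le (sampleSigma_le hS {i | i.1 < k})
      (indep_sampleSigma hS hindep
        (Set.disjoint_left.2 fun i (h : i.1 < k) (h' : i.1 = k) => h.ne h'))
      (s := fun ω => Q.bisection D θ T γ (fun i => S i ω) k)
      (finite_range_bisection D θ T γ (fun ω i => S i ω) k)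
      (hQ.measurableSet_bisection_eq D θ T γ S k)
      (A := fun s => {ω | Q.IsNoisy D xs ε α s.query
        (samplePath S k false ω) (samplePath S k true ω)}) ?_
    rintro _ ⟨ω, rfl⟩
    exact hQ.isNoisy_small hM hG D hS hlaw hindep hxs hε hα
      (query_bisection_pos hQ.z0_pos D θ T γ _ k) k
  have hsub : {ω | ∃ k < K, Q.IsNoisy D xs ε α (Q.bisection D θ T γ (fun i => S i ω) k).query
        (samplePath S k false ω) (samplePath S k true ω)} ⊆
      ⋃ k ∈ Finset.range K, {ω | Q.IsNoisy D xs ε α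
        (Q.bisection D θ T γ (fun i => S i ω) k).query
        (samplePath S k false ω) (samplePath S k true ω)} := by
    rintro ω ⟨k, h1, h2⟩
    simp only [Set.mem_iUnion]
    exact ⟨k, Finset.mem_range.2 h1, h2⟩
  calc _ ≤ _ := measureReal_mono hsub (measure_ne_top _ _)
    _ ≤ _ := measureReal_biUnion_finset_le _ _
    _ ≤ ∑ _k ∈ Finset.range K, α / K := Finset.sum_le_sum fun k _ => hk k
    _ = α := by rw [Finset.sum_const, Finset.card_range, nsmul_eq_mul]; field_simp

end Problem

/-! ### Success of the method. -/

namespace Problem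

variable {E Ξ : Type*} [NormedAddCommGroup E] [NormedSpace ℝ E] [MeasurableSpace Ξ]
  {Q : Problem E Ξ} [FiniteDimensional ℝ E] [MeasurableSpace E] [BorelSpace E]

/-- The comparator is `(xs, f(xs), z*)`, where the Lagrangian has the value `h(xs)` for every
multiplier. -/
theorem Standing.lag_smd_le_opt (hQ : Q.Standing) (hM : Q.SemimomentBound)
    (hG : Q.SemidevLipschitz) (D : Q.Prox) {z : ℝ} (hz : 0 < z) {T : ℕ} (hT : 0 < T) {g : ℝ}
    (hg : 0 < g) (ξ : ℕ → Ξ) {xs : E} (hxs : xs ∈ Q.X) {l : ℝ} (hl : l ∈ Set.Icc (0 : ℝ) 1) :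
    Q.lag (Q.smdX D z T (fun _ => g) ξ) (Q.smdY D z T g ξ) z l ≤
      Q.h xs + Q.smdErr D z T g xs (Q.f xs) ξ + Q.smdMeanZ D z T g ξ * (z - Q.zstar xs) := by
  refine hQ.lag_smd_le hM hG D hz hT hg ξ hxs (hQ.mean_mem_Y xs hxs) hl.1 hl.2 ?_
    fun l' _ => (hQ.lag_zstar hM hxs l').le
  have hp : 0 < Q.p ^ (1 / (Q.p - 1)) := Real.rpow_pos_of_pos (by linarith [hQ.one_lt_p]) _
  rcases (hQ.zstar_mem hM hxs).1.eq_or_lt with h0 | h0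
  · refine Or.inr ⟨h0.symm, hQ.posPart_ae_eq_zero hM hxs ?_⟩
    exact (mul_eq_zero.1 h0.symm).resolve_left hp.ne'
  · exact Or.inl h0

/-- If no iteration is bad, one of the first `K` iterations succeeds, and no smaller value than
`ẑ` is examined before. -/
theorem Standing.exists_first_success (hQ : Q.Standing) (hM : Q.SemimomentBound)
    (hG : Q.SemidevLipschitz) (D : Q.Prox) {xs : E} (hxs : xs ∈ Q.X) {ε α : ℝ} (hε : 0 < ε)
    (hα : 0 < α) (σ : ℕ × ℕ × Bool → Ξ) :
    let zs := Q.zstar xs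
    let st := Q.bisection D (Q.θ ε) (Q.T zs ε α) (Q.γ zs ε α) σ
    (∀ k < Q.K zs ε, ¬ Q.IsNoisy D xs ε α (st k).query (fun t => σ (k, t, false))
      (fun t => σ (k, t, true))) →
    ∃ k < Q.K zs ε, (∀ l ∈ Set.Icc (0 : ℝ) 1,
        Q.lag (Q.smdX D (st k).query (Q.T zs ε α (st k).query) (Q.γ zs ε α (st k).query)
            fun t => σ (k, t, false))
          (Q.smdY D (st k).query (Q.T zs ε α (st k).query) (Q.γ zs ε α (st k).query 0)
            fun t => σ (k, t, false)) (st k).query l ≤ Q.h xs + 3 / 4 * ε) ∧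
      (st k).stopped = false ∧
      ∀ j ≤ k, min Q.z0 (max (zs / 2) (Q.p ^ (1 / (Q.p - 1)) * ε / (4 * Q.c))) ≤ (st j).query := by
  intro zs st hgood
  have hz : ∀ k, 0 < (st k).query := query_bisection_pos hQ.z0_pos D _ _ _ σ
  have hT := fun k => hQ.T_pos hM D zs hε hα (hz k)
  have hγ := fun k => hQ.γ_pos hM D zs hε hα (hz k) 0
  have hp := hQ.one_lt_p
  have hc := hQ.c_pos
  have hp1 : 0 < Q.p - 1 := by linarith
  have hB : 0 ≤ Q.Mf ^ Q.p + (2 * Q.R) ^ Q.p :=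
    add_nonneg (Real.rpow_nonneg hM.Mf_nonneg _) (Real.rpow_nonneg (by linarith [hQ.R_pos]) _)
  obtain ⟨hzs0, hzs1⟩ := hQ.zstar_mem hM hxs
  obtain ⟨K₁, K₂, hK, h1, h2, h3, h4, h5⟩ := hQ.exists_K_split hM (zs := zs) hε
  rw [hK] at hgood ⊢
  have hθ : Q.p ^ (1 / (Q.p - 1)) * ε / (4 * Q.c) = Q.θ ε / 2 := by
    unfold Params.θ; field_simp; ring
  rw [hθ]
  refine BisectRun.exists_first_good (ζ := fun k => Q.smdζ D (st k).query
      (Q.T zs ε α (st k).query) (Q.γ zs ε α (st k).query) (fun t => σ (k, t, false))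
      (fun t => σ (k, t, true)))
    (ζ' := fun k => Q.smdMeanZ D (st k).query (Q.T zs ε α (st k).query)
      (Q.γ zs ε α (st k).query 0) (fun t => σ (k, t, false)))
    (ε := ε) (ρ := Q.ρ) (κ := Q.κ) (p := Q.p)
    (B := Q.c * (Q.p - 1) * ((2 : ℝ) ^ (Q.p - 1) * (Q.Mf ^ Q.p + (2 * Q.R) ^ Q.p)))
    (w := max zs (Q.z0 / 2)) ?_
  exact
    { init := rfl
      step := fun k => rfl
      zs_nonneg := hzs0
      z0_pos := hQ.z0_pos
      θ_pos := hQ.θ_pos hε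
      ε_pos := hε
      one_le_ρ := one_le_ρ
      zs_le := hQ.zs_le_ρ_mul hM hzs1
      κ_nonneg := hQ.κ_nonneg
      B_nonneg := by positivity
      p_nonneg := by linarith
      κ_mul_θ := hQ.κ_mul_θ_le hε
      w_eq := rfl
      doubling := h3
      one_le_K₁ := h1
      one_le_K₂ := h2
      width_κ := h4
      width_B := h5
      noise := by
        intro k hk
        have h := hgood k hk
        simp only [IsNoisy, not_or, not_le] at h
        have h0 : 0 ≤ (st k).query * Q.ρ :=
          mul_nonneg (hz k).le (zero_le_one.trans one_le_ρ)
        rw [← abs_of_nonneg h0, ← abs_mul]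
        refine (abs_lt_of_sq_lt_sq ?_ (by positivity)).le
        rw [mul_pow, mul_comm]
        exact h.2
      deriv_le := fun k _ => hQ.sum_inv_mul_le D _ (hT k) _ _ fun u hu => hQ.meanZ_le hM (hz k) hu
      neg_deriv_le := by
        intro k _
        have h := hQ.sum_inv_mul_le D (st k).query (hT k) (Q.γ zs ε α (st k).query 0)
          (fun t => σ (k, t, false)) (φ := fun u => -Q.meanZ (st k).query u)
          fun u hu => hQ.neg_meanZ_le hM (hz k) hu
        simp only [mul_neg, Finset.sum_neg_distrib] at h
        refine h.trans (le_of_eq ?_)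
        ring
      good_of_le := by
        intro k hk hle l hl
        have h := hgood k hk
        simp only [IsNoisy, not_or, not_le] at h
        have := hQ.lag_smd_le_opt hM hG D (hz k) (hT k) (hγ k) (fun t => σ (k, t, false)) hxs hl
        refine this.trans ?_
        linarith [h.1] }

theorem Standing.h_le_of_lag_le (hQ : Q.Standing) (hM : Q.SemimomentBound) {x : E} (hx : x ∈ Q.X)
    {y : ℝ} (hy : y ∈ Q.Y) {z : ℝ} (hz : 0 < z) {C : ℝ}
    (h : ∀ l ∈ Set.Icc (0 : ℝ) 1, Q.lag x y z l ≤ C) : Q.h x ≤ C := by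
  rcases hQ.h_le_lag hM hx hy hz with h' | h'
  · exact h'.trans (h 0 ⟨le_rfl, zero_le_one⟩)
  · exact h'.trans (h 1 ⟨zero_le_one, le_rfl⟩)

theorem Standing.abs_h_le (hQ : Q.Standing) (hM : Q.SemimomentBound) {x : E} (hx : x ∈ Q.X) :
    |Q.h x| ≤ |Q.y0| + Q.R + Q.c * Q.Mf := by
  have h1 : |Q.f x - Q.y0| ≤ Q.R := hQ.mean_mem_Y x hx
  have h2 := mul_le_mul_of_nonneg_left (hQ.semidev_le hM hx) hQ.c_pos.le
  have h3 := mul_nonneg hQ.c_pos.le (semidev_nonneg (Q := Q) x)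
  have h4 := abs_add_three Q.y0 (Q.f x - Q.y0) (Q.c * Q.semidev x)
  rw [abs_of_nonneg h3] at h4
  have e : Q.h x = Q.y0 + (Q.f x - Q.y0) + Q.c * Q.semidev x := by rw [h]; ring
  rw [e]
  linarith

variable {Ω : Type*} [MeasurableSpace Ω] {μ : Measure Ω} [IsProbabilityMeasure μ]
  {S : ℕ × ℕ × Bool → Ω → Ξ}

theorem Standing.integrable_h_smdX (hQ : Q.Standing) (hM : Q.SemimomentBound) (D : Q.Prox)
    (hS : ∀ i, Measurable (S i)) (z : ℝ) {T : ℕ} (hT : 0 < T) {g : ℝ} (hg : 0 < g) (k : ℕ) :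
    Integrable (fun ω => Q.h (Q.smdX D z T (fun _ => g) (samplePath S k false ω))) μ := by
  have hm : Measurable fun ω => Q.h (Q.smdX D z T (fun _ => g) (samplePath S k false ω)) :=
    hQ.measurable_h.comp ((hQ.measurable_smdX D S z T (fun _ => g) k).mono
      (sampleSigma_le hS _) le_rfl)
  refine Integrable.of_bound hm.aestronglyMeasurable (|Q.y0| + Q.R + Q.c * Q.Mf)
    (Filter.Eventually.of_forall fun ω => ?_)
  exact hQ.abs_h_le hM (hQ.smdX_mem D z hT hg _)

/-- A pair `(x, y)` of small lifted value at `z` certifies that the inner method at `z` is accurate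
in expectation. -/
theorem Standing.integral_h_smdX_le (hQ : Q.Standing) (hM : Q.SemimomentBound)
    (hG : Q.SemidevLipschitz) (D : Q.Prox) (hS : ∀ i, Measurable (S i))
    (hlaw : ∀ i, μ.map (S i) = Q.P) (hindep : iIndepFun S μ) {z : ℝ} (hz : 0 < z) {T : ℕ}
    (hT : 0 < T) {g : ℝ} (hg : 0 < g) (hgT : g ^ 2 * (T * Q.Msq z) = Q.DVsq) (k : ℕ) {x : E}
    (hx : x ∈ Q.X) {y : ℝ} (hy : y ∈ Q.Y) {C : ℝ}
    (hC : ∀ l ∈ Set.Icc (0 : ℝ) 1, Q.lag x y z l ≤ C) :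
    ∫ ω, Q.h (Q.smdX D z T (fun _ => g) (samplePath S k false ω)) ∂μ ≤
      C + (g * T)⁻¹ * (9 / 2 * Q.DVsq) := by
  obtain ⟨-, h2, h3⟩ := hQ.smdErr_moment hM hG D hS hlaw hindep hz hg hgT k hx hy
  have h4 : ∀ ω, Q.h (Q.smdX D z T (fun _ => g) (samplePath S k false ω)) ≤
      C + Q.smdErr D z T g x y (samplePath S k false ω) := by
    intro ω
    refine hQ.h_le_of_lag_le hM (hQ.smdX_mem D z hT hg _) (hQ.smdY_mem D z hT g (samplePath S k false ω)) hz
      fun l hl => ?_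
    -- Comparing at the same value `z' = z` removes the derivative term.
    have := hQ.lag_smd_le hM hG D hz hT hg (samplePath S k false ω) hx hy hl.1 hl.2 (Or.inl hz) hC
    rwa [sub_self, mul_zero, add_zero] at this
  refine (integral_mono (hQ.integrable_h_smdX hM D hS z hT hg k)
    ((integrable_const C).add h2) h4).trans ?_
  rw [integral_add' (integrable_const C) h2]
  simp only [integral_const, probReal_univ, one_smul]
  linarith

theorem Standing.probability_success (hQ : Q.Standing) (hM : Q.SemimomentBound)
    (hG : Q.SemidevLipschitz) (D : Q.Prox) {xs : E} (hxs : xs ∈ Q.X) (hS : ∀ i, Measurable (S i))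
    (hlaw : ∀ i, μ.map (S i) = Q.P) (hindep : iIndepFun S μ) {α : ℝ} (hα0 : 0 < α) (hα1 : α < 1)
    {ε : ℝ} (hε : 0 < ε) :
    let zs : ℝ := Q.zstar xs
    let K : ℕ := Q.K zs ε
    let T : ℝ → ℕ := Q.T zs ε α
    let γ : ℝ → ℕ → ℝ := Q.γ zs ε α
    let st : ℕ → Ω → BisectState := fun k ω => Q.bisection D (Q.θ ε) T γ (fun i => S i ω) k
    let z : ℕ → Ω → ℝ := fun k ω => (st k ω).query
    let xbar : ℕ → ℝ → Ω → E := fun k ζ ω =>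
      Q.smdX D ζ (T ζ) (γ ζ) (fun t => S (k, t, false) ω)
    1 - α ≤ μ.real {ω | ∃ k < K,
      (st k ω).stopped = false ∧
      xbar k (z k ω) ω ∈ Q.X ∧
      Q.h (xbar k (z k ω) ω) - Q.h xs ≤ ε ∧
      Integrable (fun ω' => Q.h (xbar k (z k ω) ω')) μ ∧
      (∫ ω', Q.h (xbar k (z k ω) ω') ∂μ) - Q.h xs ≤ ε ∧
      ∑ j ∈ Finset.range (k + 1), 2 * T (z j ω) ≤ 2 * K * Q.Ttilde zs ε α} := by
  intro zs K T γ st z xbar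
  have hbad := hQ.exists_bad_le hM hG D hS hlaw hindep hxs hε hα0 (Q.θ ε) T γ
  set Bad := {ω | ∃ k < Q.K (Q.zstar xs) ε,
      Q.IsNoisy D xs ε α (Q.bisection D (Q.θ ε) T γ (fun i => S i ω) k).query
        (samplePath S k false ω) (samplePath S k true ω)} with hBad
  set Good := {ω | ∃ k < K, (st k ω).stopped = false ∧
      xbar k (z k ω) ω ∈ Q.X ∧
      Q.h (xbar k (z k ω) ω) - Q.h xs ≤ ε ∧
      Integrable (fun ω' => Q.h (xbar k (z k ω) ω')) μ ∧
      (∫ ω', Q.h (xbar k (z k ω) ω') ∂μ) - Q.h xs ≤ ε ∧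
      ∑ j ∈ Finset.range (k + 1), 2 * T (z j ω) ≤ 2 * K * Q.Ttilde zs ε α} with hGood
  -- A covering suffices: monotonicity and subadditivity of the measure need no measurability of
  -- either event.
  have hcover : Set.univ ⊆ Bad ∪ Good := by
    intro ω _
    by_cases hω : ω ∈ Bad
    · exact Or.inl hω
    refine Or.inr ?_
    have hno : ∀ k < Q.K zs ε, ¬ Q.IsNoisy D xs ε α (z k ω) (samplePath S k false ω)
        (samplePath S k true ω) := fun k hk h => hω ⟨k, hk, h⟩
    obtain ⟨k, hk, hlag, hrun, hquery⟩ :=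
      hQ.exists_first_success hM hG D hxs hε hα0 (fun i => S i ω) hno
    have hz : 0 < z k ω := query_bisection_pos hQ.z0_pos D _ _ _ _ k
    have hT := hQ.T_pos hM D zs hε hα0 hz
    have hγ := hQ.γ_pos hM D zs hε hα0 hz 0
    have hX : xbar k (z k ω) ω ∈ Q.X := hQ.smdX_mem D _ hT hγ _
    have hY : Q.smdY D (z k ω) (T (z k ω)) (γ (z k ω) 0) (samplePath S k false ω) ∈ Q.Y :=
      hQ.smdY_mem D _ hT _ _
    have hh : Q.h (xbar k (z k ω) ω) ≤ Q.h xs + 3 / 4 * ε := hQ.h_le_of_lag_le hM hX hY hz hlag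
    refine ⟨k, hk, hrun, hX, by linarith, hQ.integrable_h_smdX hM D hS _ hT hγ k, ?_, ?_⟩
    -- The output at this `ω` is a deterministic certificate for the average over `ω'` at the frozen
    -- value `z k ω`; its `3ε/4` plus the expected error, at most `ε/8`, is below `ε`.
    · have h1 := hQ.integral_h_smdX_le hM hG D hS hlaw hindep hz hT hγ
        (hQ.sq_γ hM D zs hε hα0 hz 0) k hX hY hlag
      have h2 := hQ.expected_err_le hM D zs hε hα0 hz 0
      have h3 : ε * α / (8 * Q.K zs ε) ≤ ε / 8 := by
        have hK : (1 : ℝ) ≤ Q.K zs ε := by exact_mod_cast one_le_K (Q := Q) zs ε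
        rw [div_le_div_iff₀ (by positivity) (by norm_num)]
        have : α ≤ Q.K zs ε := hα1.le.trans hK
        have := mul_le_mul_of_nonneg_left this hε.le
        linarith
      have h4 : ∫ ω', Q.h (xbar k (z k ω) ω') ∂μ ≤ Q.h xs + 3 / 4 * ε +
        (Q.γ zs ε α (z k ω) 0 * Q.T zs ε α (z k ω))⁻¹ * (9 / 2 * Q.DVsq) := h1
      linarith
    · have hpos : 0 < min Q.z0 (max (zs / 2) (Q.p ^ (1 / (Q.p - 1)) * ε / (4 * Q.c))) := by
        have hp : 0 < Q.p ^ (1 / (Q.p - 1)) := Real.rpow_pos_of_pos (by linarith [hQ.one_lt_p]) _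
        have hc := hQ.c_pos
        exact lt_min hQ.z0_pos (lt_max_of_lt_right (by positivity))
      have hTj : ∀ j ∈ Finset.range (k + 1), 2 * T (z j ω) ≤ 2 * Q.Ttilde zs ε α := fun j hj =>
        Nat.mul_le_mul_left 2 (hQ.T_antitone hM D zs hα0 hpos
          (hquery j (Nat.lt_succ_iff.1 (Finset.mem_range.1 hj))))
      refine (Finset.sum_le_card_nsmul _ _ _ hTj).trans ?_
      rw [Finset.card_range, smul_eq_mul]
      have := Nat.mul_le_mul_right (2 * Q.Ttilde zs ε α) (Nat.succ_le_of_lt hk)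
      refine this.trans (le_of_eq ?_)
      ring
  have h1 : 1 ≤ μ.real Bad + μ.real Good := by
    calc (1 : ℝ) = μ.real Set.univ := probReal_univ.symm
      _ ≤ μ.real (Bad ∪ Good) := measureReal_mono hcover (measure_ne_top _ _)
      _ ≤ _ := measureReal_union_le _ _
  linarith

end Problem

/-! ### Order of the sample bound. -/

theorem one_le_log_div {ε : ℝ} (hε : 0 < ε) (hε2 : ε ≤ 1 / 2) :
    1 ≤ Real.log (1 / ε) / Real.log 2 := by
  rw [one_le_div (Real.log_pos one_lt_two)]
  refine Real.log_le_log two_pos ?_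
  rw [le_div_iff₀ hε]
  linarith

/-- For `ε ≤ 1/2` the binary logarithm of `1/ε` is at least 1, so it absorbs the additive constants
and the rounding. -/
theorem ceil_logb_le {ε x A q : ℝ} (hε : 0 < ε) (hε2 : ε ≤ 1 / 2) (hx : 0 ≤ x) (hA : 1 ≤ A)
    (hq : 0 ≤ q) (hxA : x ≤ A / ε ^ q) :
    (⌈Real.logb 2 x⌉₊ : ℝ) ≤ (Real.logb 2 A + q + 1) * (Real.log (1 / ε) / Real.log 2) := by
  have hΛ := one_le_log_div hε hε2
  have hl := Real.logb_nonneg one_lt_two hA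
  have hqΛ : 0 ≤ q * (Real.log (1 / ε) / Real.log 2) := mul_nonneg hq (by linarith)
  have hlog : Real.logb 2 x ≤ Real.logb 2 A + q * (Real.log (1 / ε) / Real.log 2) := by
    rcases hx.eq_or_lt with h | h
    · rw [← h, Real.logb_zero]; linarith
    · refine (Real.logb_le_logb_of_le one_lt_two h hxA).trans (le_of_eq ?_)
      have h1 : ε ^ q ≠ 0 := (Real.rpow_pos_of_pos hε q).ne'
      rw [Real.logb_div (by linarith) h1, Real.logb_rpow_eq_mul_logb_of_pos hε, one_div,
        Real.log_inv]
      simp only [Real.logb]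
      ring
  have hceil : (⌈Real.logb 2 x⌉₊ : ℝ) ≤
      Real.logb 2 A + q * (Real.log (1 / ε) / Real.log 2) + 1 := by
    rcases le_or_gt (Real.logb 2 x) 0 with h | h
    · rw [Nat.ceil_eq_zero.2 h, Nat.cast_zero]; linarith
    · exact (Nat.ceil_lt_add_one h.le).le.trans (by linarith)
  have := mul_le_mul_of_nonneg_left hΛ hl
  refine hceil.trans ?_
  generalize Real.log (1 / ε) / Real.log 2 = Λ at *
  linarith

namespace Problem

variable {E Ξ : Type*} [NormedAddCommGroup E] [NormedSpace ℝ E] [MeasurableSpace Ξ]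
  {Q : Problem E Ξ} [MeasurableSpace E]

theorem Standing.exists_K_le (hQ : Q.Standing) (hM : Q.SemimomentBound) :
    ∃ C : ℝ, 0 < C ∧ ∀ ε : ℝ, 0 < ε → ε ≤ 1 / 2 →
      ∀ zs ∈ Set.Icc (0 : ℝ) (Q.p ^ (1 / (Q.p - 1)) * Q.Mf),
        (Q.K zs ε : ℝ) ≤ C * (Real.log (1 / ε) / Real.log 2) := by
  have hp := hQ.one_lt_p
  have hc := hQ.c_pos
  have hz0 := hQ.z0_pos
  have hR := hQ.R_pos
  have hp0 : 0 < Q.p := by linarith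
  have hp1 : 0 < Q.p - 1 := by linarith
  have hMfp := Real.rpow_nonneg hM.Mf_nonneg Q.p
  set Z := Q.p ^ (1 / (Q.p - 1)) * Q.Mf with hZ
  set W := max Z (Q.z0 / 2) with hW
  have hW0 : 0 < W := lt_max_of_lt_right (by linarith)
  set a1 := 2 * Z / Q.z0 with ha1
  set a2 := 8 * Q.c * W * Q.p ^ (-1 / (Q.p - 1)) with ha2
  set D1 := (Q.p - 1) * Q.p ^ (-Q.p / (Q.p - 1)) * (2 : ℝ) ^ (3 * Q.p + 1)
    * (Q.Mf ^ Q.p + (2 : ℝ) ^ Q.p * Q.R ^ Q.p) with hD1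
  set D2 := (Q.p - 1) * Q.p ^ (-Q.p / (Q.p - 1)) with hD2
  have hD10 : 0 ≤ D1 := by positivity
  have hD20 : 0 ≤ D2 := by positivity
  set a3 := Q.c ^ (Q.p + 1) * W * D1 + 4 * Q.c * W * D2 with ha3
  have hl1 := Real.logb_nonneg one_lt_two (le_max_left 1 a1)
  have hl2 := Real.logb_nonneg one_lt_two (le_max_left 1 a2)
  have hl3 := Real.logb_nonneg one_lt_two (le_max_left 1 a3)
  refine ⟨(1 + (Real.logb 2 (max 1 a1) + 0 + 1)) + (1 + ((Real.logb 2 (max 1 a2) + 1 + 1) +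
    (Real.logb 2 (max 1 a3) + (Q.p + 1) + 1))), by linarith, fun ε hε hε2 zs hzs => ?_⟩
  have hΛ := one_le_log_div hε hε2
  set w := max zs (Q.z0 / 2) with hw
  have hw0 : 0 < w := lt_max_of_lt_right (by linarith)
  have hwW : w ≤ W := max_le_max hzs.2 le_rfl
  have n1 := ceil_logb_le (x := 2 * zs / Q.z0) (A := max 1 a1) (q := 0) hε hε2
    (by have := hzs.1; positivity) (le_max_left _ _) le_rfl (by
      rw [Real.rpow_zero, div_one]
      refine le_trans ?_ (le_max_right _ _)
      have := hzs.2
      rw [ha1]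
      gcongr)
  have n2 := ceil_logb_le (x := 8 * Q.c * w / ε * Q.p ^ (-1 / (Q.p - 1))) (A := max 1 a2) (q := 1)
    hε hε2 (by positivity) (le_max_left _ _) zero_le_one (by
      rw [Real.rpow_one]
      calc 8 * Q.c * w / ε * Q.p ^ (-1 / (Q.p - 1)) ≤
          8 * Q.c * W / ε * Q.p ^ (-1 / (Q.p - 1)) := by gcongr
        _ = a2 / ε := by rw [ha2]; ring
        _ ≤ max 1 a2 / ε := by gcongr; exact le_max_right _ _)
  have e3 : Q.c ^ (Q.p + 1) * w / ε ^ (Q.p + 1) * (Q.p - 1) * Q.p ^ (-Q.p / (Q.p - 1))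
            * (2 : ℝ) ^ (3 * Q.p + 1) * (Q.Mf ^ Q.p + (2 : ℝ) ^ Q.p * Q.R ^ Q.p)
          + 4 * Q.c * w / ε * (Q.p - 1) * Q.p ^ (-Q.p / (Q.p - 1)) =
      Q.c ^ (Q.p + 1) * w * D1 / ε ^ (Q.p + 1) + 4 * Q.c * w * D2 / ε := by
    rw [hD1, hD2]; ring
  have hεp : ε ^ (Q.p + 1) ≤ ε := by
    calc ε ^ (Q.p + 1) ≤ ε ^ (1 : ℝ) :=
          Real.rpow_le_rpow_of_exponent_ge hε (by linarith) (by linarith)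
      _ = ε := Real.rpow_one ε
  have hεp0 : 0 < ε ^ (Q.p + 1) := Real.rpow_pos_of_pos hε _
  have n3 := ceil_logb_le (x := Q.c ^ (Q.p + 1) * w * D1 / ε ^ (Q.p + 1) + 4 * Q.c * w * D2 / ε)
    (A := max 1 a3) (q := Q.p + 1) hε hε2 (by positivity) (le_max_left _ _) (by linarith) (by
      calc Q.c ^ (Q.p + 1) * w * D1 / ε ^ (Q.p + 1) + 4 * Q.c * w * D2 / ε
          ≤ Q.c ^ (Q.p + 1) * W * D1 / ε ^ (Q.p + 1) + 4 * Q.c * W * D2 / ε ^ (Q.p + 1) := by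
            gcongr
        _ = a3 / ε ^ (Q.p + 1) := by rw [ha3]; ring
        _ ≤ max 1 a3 / ε ^ (Q.p + 1) := by gcongr; exact le_max_right _ _)
  have hK : Q.K zs ε ≤ (1 + ⌈Real.logb 2 (2 * zs / Q.z0)⌉₊) +
      (1 + (⌈Real.logb 2 (8 * Q.c * w / ε * Q.p ^ (-1 / (Q.p - 1)))⌉₊ +
        ⌈Real.logb 2 (Q.c ^ (Q.p + 1) * w * D1 / ε ^ (Q.p + 1) + 4 * Q.c * w * D2 / ε)⌉₊)) := by
    rw [← e3]
    unfold Params.K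
    dsimp only
    rw [← hw]
    refine Nat.add_le_add (max_le (Nat.le_add_right _ _) (Nat.le_add_left _ _))
      (max_le (Nat.le_add_right _ _) (max_le ?_ ?_)) <;> omega
  have hK' := Nat.cast_le (α := ℝ).2 hK
  simp only [Nat.cast_add, Nat.cast_one] at hK'
  refine hK'.trans ?_
  rw [add_mul, add_mul 1, add_mul 1, add_mul (Real.logb 2 (max 1 a2) + 1 + 1)]
  linarith

/-- The two entries grow like `K²` and `K`. With the factor `K` in the number of samples this gives
the third power of the logarithm. -/
theorem Standing.exists_Ctilde_le (hQ : Q.Standing) (hM : Q.SemimomentBound) (D : Q.Prox) {α : ℝ}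
    (hα : 0 < α) : ∃ C : ℝ, 0 < C ∧ ∀ K : ℕ, 1 ≤ K → Q.Ctilde K α ≤ C * (K : ℝ) ^ 2 := by
  have hD := D.DVsq_pos
  have hR := hQ.R_pos
  have hMf := Real.rpow_nonneg hM.Mf_nonneg (2 * Q.p)
  set b := 32 * max 1 (4 * Q.p ^ (2 / (Q.p - 1)) * Q.Mf ^ 2 / Q.z0 ^ 2)
        * (Q.p - 1) ^ 2 * (2 : ℝ) ^ (2 * Q.p - 2)
        * (5 * Q.Mf ^ (2 * Q.p) + (2 : ℝ) ^ (2 * Q.p) * Q.R ^ (2 * Q.p))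
      / (81 * α * Q.m ^ 2 * Q.DVsq * Q.LG ^ 2) with hb
  have hb0 : 0 ≤ b := by positivity
  refine ⟨16 / α ^ 2 + b, by positivity, fun K hK => max_le ?_ ?_⟩
  · have : 0 ≤ b * (K : ℝ) ^ 2 := by positivity
    have e : 16 * (K : ℝ) ^ 2 / α ^ 2 = 16 / α ^ 2 * (K : ℝ) ^ 2 := by ring
    rw [e, add_mul]
    linarith
  · have hK1 : (1 : ℝ) ≤ K := by exact_mod_cast hK
    have h1 : b * (K : ℝ) ≤ b * (K : ℝ) ^ 2 :=
      mul_le_mul_of_nonneg_left (le_self_pow₀ hK1 two_ne_zero) hb0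
    have h2 : 0 ≤ 16 / α ^ 2 * (K : ℝ) ^ 2 := by positivity
    rw [add_mul]
    refine le_trans (le_of_eq ?_) (h1.trans (by linarith))
    rw [hb]
    ring

theorem Standing.exists_Msq_le (hQ : Q.Standing) (hM : Q.SemimomentBound) :
    ∃ C : ℝ, 0 < C ∧ ∀ ε : ℝ, 0 < ε → ε ≤ 1 / 2 →
      ∀ zs ∈ Set.Icc (0 : ℝ) (Q.p ^ (1 / (Q.p - 1)) * Q.Mf),
        1 ≤ C / max zs ε ^ (2 * Q.p - 2) ∧
        Q.Msq (min Q.z0 (max (zs / 2) (Q.p ^ (1 / (Q.p - 1)) * ε / (4 * Q.c))))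
          ≤ C / max zs ε ^ (2 * Q.p - 2) := by
  have hp := hQ.one_lt_p
  have hc := hQ.c_pos
  have hz0 := hQ.z0_pos
  have hp0 : 0 < Q.p := by linarith
  set Z := Q.p ^ (1 / (Q.p - 1)) * Q.Mf with hZ
  set W := max Z 1 with hW
  have hW0 : 0 < W := lt_max_of_lt_right one_pos
  set t := Q.p ^ (1 / (Q.p - 1)) / (4 * Q.c) with ht
  have ht0 : 0 < t := by positivity
  -- Chosen so that `r * max zs ε ≤ ẑ`: the three entries handle `z0`, `zs / 2` and the multiple `t
  -- * ε` of `ε`. Then `M_z²` at `ẑ` is at most its value at `r * max zs ε`.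
  set r := min (Q.z0 / W) (min (1 / 2) t) with hr
  have hr0 : 0 < r := lt_min (by positivity) (lt_min (by norm_num) ht0)
  have hrp : 0 < r ^ (2 * Q.p - 2) := Real.rpow_pos_of_pos hr0 _
  have hWp : 0 < W ^ (2 * Q.p - 2) := Real.rpow_pos_of_pos hW0 _
  obtain ⟨A, B, hA, hB, hAB⟩ : ∃ A B : ℝ, 0 ≤ A ∧ 0 ≤ B ∧
      ∀ z, Q.Msq z = A / z ^ (2 * Q.p - 2) + B := by
    have hR := hQ.R_pos
    have := Real.rpow_nonneg hM.Mf_nonneg (2 * Q.p - 2)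
    refine ⟨3 * Q.c ^ 2 * Q.m ^ 2 * (Q.LG ^ 2 + Q.p ^ 2 * (Q.Lf ^ 2 + 1) * Q.Mf ^ (2 * Q.p - 2)
        + Q.p ^ 2 * ((2 : ℝ) ^ (2 * Q.p) * (Q.Lf ^ 2 + Q.σf ^ 2) + (2 : ℝ) ^ (2 * Q.p - 2))
          * Q.R ^ (2 * Q.p - 2)),
      12 * (Q.Lf ^ 2 + Q.σf ^ 2) + 8 * Q.R ^ 2 + 2 * Q.β ^ 2 + 3, by positivity, by positivity,
      fun z => ?_⟩
    unfold Params.Msq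
    ring
  -- Since `max zs ε ≤ W`, the part `B` not depending on `z` is also dominated by a multiple of
  -- `(max zs ε)^(-(2p-2))`. The extra 1 gives the first inequality, used to absorb the rounding of
  -- `T`.
  refine ⟨A / r ^ (2 * Q.p - 2) + (B + 1) * W ^ (2 * Q.p - 2), by positivity,
    fun ε hε hε2 zs hzs => ?_⟩
  set n := max zs ε with hn
  have hn0 : 0 < n := lt_max_of_lt_right hε
  have hnW : n ≤ W := max_le (hzs.2.trans (le_max_left _ _)) (by linarith [le_max_right Z 1])
  have hnp : 0 < n ^ (2 * Q.p - 2) := Real.rpow_pos_of_pos hn0 _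
  have hone : 1 ≤ W ^ (2 * Q.p - 2) / n ^ (2 * Q.p - 2) := by
    rw [one_le_div hnp]
    exact Real.rpow_le_rpow hn0.le hnW (by linarith)
  have hz : r * n ≤ min Q.z0 (max (zs / 2) (Q.p ^ (1 / (Q.p - 1)) * ε / (4 * Q.c))) := by
    have e : Q.p ^ (1 / (Q.p - 1)) * ε / (4 * Q.c) = t * ε := by rw [ht]; ring
    rw [e]
    refine le_min ?_ ?_
    · calc r * n ≤ Q.z0 / W * W := by
            gcongr
            exact min_le_left _ _
        _ = Q.z0 := div_mul_cancel₀ _ hW0.ne'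
    · have hr1 : r ≤ 1 / 2 := (min_le_right _ _).trans (min_le_left _ _)
      have hr2 : r ≤ t := (min_le_right _ _).trans (min_le_right _ _)
      rw [hn, mul_max_of_nonneg _ _ hr0.le]
      refine max_le_max ?_ (mul_le_mul_of_nonneg_right hr2 hε.le)
      have := mul_le_mul_of_nonneg_right hr1 hzs.1
      linarith
  have hA' : 0 ≤ A / (r ^ (2 * Q.p - 2) * n ^ (2 * Q.p - 2)) := by positivity
  have e : (A / r ^ (2 * Q.p - 2) + (B + 1) * W ^ (2 * Q.p - 2)) / n ^ (2 * Q.p - 2) =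
      A / (r ^ (2 * Q.p - 2) * n ^ (2 * Q.p - 2)) +
        (B + 1) * (W ^ (2 * Q.p - 2) / n ^ (2 * Q.p - 2)) := by
    field_simp
  have hB1 := mul_le_mul_of_nonneg_left hone (by linarith : 0 ≤ B + 1)
  rw [e]
  refine ⟨by linarith, (hQ.Msq_antitone hM (mul_pos hr0 hn0) hz).trans ?_⟩
  rw [hAB, Real.mul_rpow hr0.le hn0.le]
  linarith

/-- The sample bound is of order `log³(1/ε) / (max {z*, ε}^(2p-2) ε²)`. -/
theorem Standing.exists_complexity_le (hQ : Q.Standing) (hM : Q.SemimomentBound) (D : Q.Prox)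
    {α : ℝ} (hα : 0 < α) :
    ∃ C : ℝ, 0 < C ∧ ∀ ε : ℝ, 0 < ε → ε ≤ 1 / 2 →
      ∀ zs ∈ Set.Icc (0 : ℝ) (Q.p ^ (1 / (Q.p - 1)) * Q.Mf),
        (2 * Q.K zs ε * Q.Ttilde zs ε α : ℝ)
          ≤ C * Real.log (1 / ε) ^ 3 / (max zs ε ^ (2 * Q.p - 2) * ε ^ 2) := by
  obtain ⟨C1, hC1, hK⟩ := hQ.exists_K_le hM
  obtain ⟨C2, hC2, hCt⟩ := hQ.exists_Ctilde_le hM D hα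
  obtain ⟨C3, hC3, hMs⟩ := hQ.exists_Msq_le hM
  have hD := D.DVsq_pos
  have hl2 : 0 < Real.log 2 := Real.log_pos one_lt_two
  refine ⟨2 * (81 * C2 * C3 * Q.DVsq + C3) * (C1 / Real.log 2) ^ 3, by positivity,
    fun ε hε hε2 zs hzs => ?_⟩
  have hK' := hK ε hε hε2 zs hzs
  have hK1 : (1 : ℝ) ≤ Q.K zs ε := by exact_mod_cast one_le_K (Q := Q) zs ε
  have hCt' := hCt (Q.K zs ε) (one_le_K zs ε)
  obtain ⟨h1, hMs'⟩ := hMs ε hε hε2 zs hzs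
  have hC0 := Ctilde_pos (Q := Q) (one_le_K (Q := Q) zs ε) hα
  have hM0 : 0 ≤ Q.Msq (min Q.z0 (max (zs / 2) (Q.p ^ (1 / (Q.p - 1)) * ε / (4 * Q.c)))) := by
    refine le_trans (by norm_num) (hQ.three_le_Msq hM (lt_min hQ.z0_pos (lt_max_of_lt_right ?_)))
    have := hQ.c_pos
    have := hQ.one_lt_p
    positivity
  have hn : 0 < max zs ε ^ (2 * Q.p - 2) := Real.rpow_pos_of_pos (lt_max_of_lt_right hε) _
  have hT : (Q.Ttilde zs ε α : ℝ) ≤ 81 * Q.Ctilde (Q.K zs ε) α *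
      Q.Msq (min Q.z0 (max (zs / 2) (Q.p ^ (1 / (Q.p - 1)) * ε / (4 * Q.c)))) * Q.DVsq / ε ^ 2
        + 1 := (Nat.ceil_lt_add_one (by positivity)).le
  set n := max zs ε ^ (2 * Q.p - 2) with hndef
  set k : ℝ := (Q.K zs ε : ℝ) with hk
  have hT2 : (Q.Ttilde zs ε α : ℝ) ≤
      (81 * C2 * C3 * Q.DVsq + C3) * k ^ 2 / (n * ε ^ 2) := by
    have h2 : 81 * Q.Ctilde (Q.K zs ε) α *
      Q.Msq (min Q.z0 (max (zs / 2) (Q.p ^ (1 / (Q.p - 1)) * ε / (4 * Q.c)))) * Q.DVsq / ε ^ 2 ≤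
        81 * (C2 * k ^ 2) * (C3 / n) * Q.DVsq / ε ^ 2 := by gcongr
    have h3 : 1 ≤ C3 / n * k ^ 2 / ε ^ 2 := by
      rw [one_le_div (by positivity)]
      have : ε ^ 2 ≤ 1 := pow_le_one₀ hε.le (by linarith)
      exact this.trans (one_le_mul_of_one_le_of_one_le h1 (one_le_pow₀ hK1))
    refine (hT.trans (add_le_add h2 h3)).trans (le_of_eq ?_)
    field_simp
  calc 2 * k * Q.Ttilde zs ε α ≤
        2 * k * ((81 * C2 * C3 * Q.DVsq + C3) * k ^ 2 / (n * ε ^ 2)) := by gcongr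
    _ = 2 * (81 * C2 * C3 * Q.DVsq + C3) * k ^ 3 / (n * ε ^ 2) := by ring
    _ ≤ 2 * (81 * C2 * C3 * Q.DVsq + C3) * (C1 * (Real.log (1 / ε) / Real.log 2)) ^ 3
          / (n * ε ^ 2) := by gcongr
    _ = _ := by ring

end Problem

end LpRisk

theorem mainTheorem3 {E Ξ Ω : Type*} [NormedAddCommGroup E] [NormedSpace ℝ E]
    [FiniteDimensional ℝ E] [MeasurableSpace E] [BorelSpace E] [MeasurableSpace Ξ]
    [MeasurableSpace Ω]
    (Q : LpRisk.Problem E Ξ) (hQ : Q.Standing)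
    (hM : Q.SemimomentBound) (hG : Q.SemidevLipschitz) (D : Q.Prox)
    (xs : E) (hxs : xs ∈ Q.X) (hopt : ∀ x ∈ Q.X, Q.h xs ≤ Q.h x)
    -- independent samples with the law of the random data
    (μ : MeasureTheory.Measure Ω) [MeasureTheory.IsProbabilityMeasure μ]
    (S : ℕ × ℕ × Bool → Ω → Ξ) (hS : ∀ i, Measurable (S i))
    (hlaw : ∀ i, μ.map (S i) = Q.P) (hindep : ProbabilityTheory.iIndepFun S μ)
    (α : ℝ) (hα0 : 0 < α) (hα1 : α < 1) :
    -- with probability at least `1 - α`, one of the first `K` outer iterations is carried out,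
    -- returns an `ε`-optimal solution, and at most `2 K T̃` samples have been drawn by then
    (∀ ε : ℝ, 0 < ε →
      let zs : ℝ := Q.zstar xs
      let K : ℕ := Q.K zs ε
      let T : ℝ → ℕ := Q.T zs ε α
      let γ : ℝ → ℕ → ℝ := Q.γ zs ε α
      let st : ℕ → Ω → LpRisk.BisectState := fun k ω =>
        Q.bisection D (Q.θ ε) T γ (fun i => S i ω) k
      let z : ℕ → Ω → ℝ := fun k ω => (st k ω).query
      -- output of the inner method in outer iteration `k` for the trial value `ζ`
      let xbar : ℕ → ℝ → Ω → E := fun k ζ ω =>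
        Q.smdX D ζ (T ζ) (γ ζ) (fun t => S (k, t, false) ω)
      1 - α ≤ μ.real {ω | ∃ k < K,
        (st k ω).stopped = false ∧
        xbar k (z k ω) ω ∈ Q.X ∧
        Q.h (xbar k (z k ω) ω) - Q.h xs ≤ ε ∧
        -- `ε`-optimality in expectation over the samples of iteration `k`, given `z_k`
        MeasureTheory.Integrable (fun ω' => Q.h (xbar k (z k ω) ω')) μ ∧
        (∫ ω', Q.h (xbar k (z k ω) ω') ∂μ) - Q.h xs ≤ ε ∧
        ∑ j ∈ Finset.range (k + 1), 2 * T (z j ω) ≤ 2 * K * Q.Ttilde zs ε α}) ∧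
    -- `2 K T̃` is `Õ(1 / (max {z*, ε}^(2p-2) ε²))`, uniformly over all possible values of `z*`
    Q.zstar xs ∈ Set.Icc 0 (Q.p ^ (1 / (Q.p - 1)) * Q.Mf) ∧
    ∃ C : ℝ, 0 < C ∧ ∀ ε : ℝ, 0 < ε → ε ≤ 1 / 2 →
      ∀ zs ∈ Set.Icc (0 : ℝ) (Q.p ^ (1 / (Q.p - 1)) * Q.Mf),
        (2 * Q.K zs ε * Q.Ttilde zs ε α : ℝ)
          ≤ C * Real.log (1 / ε) ^ 3 / (max zs ε ^ (2 * Q.p - 2) * ε ^ 2) :=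
  ⟨fun _ hε => hQ.probability_success hM hG D hxs hS hlaw hindep hα0 hα1 hε,
    hQ.zstar_mem hM hxs, hQ.exists_complexity_le hM D hα0⟩
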